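/- **Setting.** Graphs are directed with real edge weights; $d$ denotes distance and $d^h(s,t)$ the minimum weight of an $(s,t)$-walk with at most $h$ negative edges. Let $G_\tau$ be a graph whose vertices are base vertices and copies of base vertices; write $v_0$ for the base vertex of which a vertex $v$ is a copy ($v_0=v$ if $v$ is a base vertex). Each vertex $v$ has a shift $\delta(v)\in\mathbb R$, with $\delta(v)=0$ for base vertices, and every edge satisfies $\omega(u,v)\ge d_{G_\tau}(u_0,v_0)+\delta(v)-\delta(u)$. Every vertex is incident to at most one negative edge, negative edges join base vertices, and the negative edge $(r,r')$ at a negative vertex $r$ (a vertex with a negative out-edge) is its only out-edge. Let $N$ be the set of negative vertices, and let $|V(G_\tau)|\le C\,n\log^2 n$ for a constant $C$, $n\ge2$. Let $H_\tau$ be $G_\tau$ together with an edge $(v,\bar v)$ of weight $\delta(\bar v)-\delta(v)$ for any two copies $v,\bar v$ of the same vertex. Freeze the sets of negative edges, let $\phi$ be a potential that makes no non-negative edge of $H_\tau$ negative, let $\Gamma,H$ be $G_\tau,H_\tau$ with weights $\omega(u,v)+\phi(u)-\phi(v)$, and replace $\delta(v)$ by $\delta(v)-\phi(v)+\phi(v_0)$.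 Assume that for all $s,t$ there are at most $2^{\sqrt{\log n}}$ vertices $v\in N$ for which there are $s',t'$ with $d^2_H(s',s)+d^2_H(s,v)+d^2_H(v,t)+d^2_H(t,t')<0$. For each $r\in N$ let $\Delta_r\in\mathbb R$ and vertex sets $\tilde V^{out}_r,\tilde V^{in}_r$ be given such that in $H$: 1. for $v\in\tilde V^{out}_r$ some walk from $r$ through $v$ with at most 2 negative edges has weight $\le-\Delta_r$; for $v\notin\tilde V^{out}_r$ all such walks have weight $\ge-\Delta_r$; 2. for $v\in\tilde V^{in}_r$ some walk to $r$ through $v$ with at most 1 negative edge has weight $\le\Delta_r$; for $v\notin\tilde V^{in}_r$ all such walks have weight $\ge\Delta_r$; 3. the inequality $\le$ holds strictly throughout (1), or strictly throughout (2), and $\big||\tilde V^{out}_r|-|\tilde V^{in}_r|\big|\le1$. With distances in $\Gamma$, let $V^{out}_r=\{v\in\tilde V^{out}_r:d^1(r,v)\le-\Delta_r\}$ and $V^{in}_r=\{v\in\tilde V^{in}_r:d^0(v,r)\le\Delta_r\}$, where the inequality is replaced by the strict one on the side designated as strict in (3). Let $G'_{\tau+1}$ be the multigraph obtained from $\Gamma$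 by adding, for each $r\in N$, * (S1) a new base vertex $\tilde r$ of shift $0$ (Steiner vertex); * (S2) for $v\in V^{out}_r\cup\{r'\}$ an edge $(\tilde r,v)$ of weight $d^1(r,v)+\Delta_r$; * (S3) for $v\in V^{in}_r\cup\{r\}$ an edge $(v,\tilde r)$ of weight $d^0(v,r)-\Delta_r$; * (S4) for each negative edge $(v,v')$ of $\Gamma$ with $v\in V^{out}_r$ an edge $(r,v')$ of weight $d^1(r,v)+\omega(v,v')$; * (S5) for each negative edge $(u,u')$ of $\Gamma$ with $u'\in V^{in}_r$ an edge $(u,r')$ of weight $\omega(u,u')+d^0(u',r)+\omega(r,r')$. An edge of negative weight of $G'_{\tau+1}$ incident to a Steiner vertex is called imaginary. Two consecutive edges $(a,b),(b,c)$ of $G'_{\tau+1}$, at least one of them imaginary, with total weight $\ge0$ form a locally-negative two-edge path. It is shortcut in a graph if that graph has a walk from $a$ to $c$ of the same weight all of whose edges have non-negative weight. **Lemma.** There is a deterministic algorithm (one program for a word RAM with $O(\log n)$-bit words and real cells that can be added, subtracted and compared, each operation taking one step) that, given $n$, $\Gamma$ with its negative edges, base vertices and shifts, the sets $\tilde V^{out}_r,\tilde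 V^{in}_r$ and $G'_{\tau+1}$ as above, outputs in $n^{7/3+o(1)}$ steps (the $o(1)$ and the constant in $O(\log n)$ depending only on $C$) a multigraph $G_{\tau+1}$ such that 1. every locally-negative two-edge path of $G'_{\tau+1}$ is shortcut in $G_{\tau+1}$; 2. the vertices of $G_{\tau+1}$ are those of $G'_{\tau+1}$ and at most 2 further copies, with shifts, of each base vertex of $G_\tau$, and every edge $(a,b)$ of $G_{\tau+1}$ has weight at least $d_{G'_{\tau+1}}(a_0,b_0)+\delta(b)-\delta(a)$; 3. $G_{\tau+1}$ contains the edges (S4) and (S5), and indeed all edges of $G'_{\tau+1}$ that are not imaginary; all its other edges are non-negative. -/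

import Mathlib

open Filter Topology

namespace Shortcut

/-! ### Weighted directed multigraphs, walks and hop distances -/

/-- A directed multigraph with real weights and marked edges: `E u v w b` says that there is an edge
from `u` to `v` of weight `w`; it counts as a *negative* edge (as a hop) iff `b = true`.  The marks
are needed because the set of negative edges is frozen before a reweighting. -/
abbrev MGraph (V : Type) := V → V → ℝ → Bool → Prop

/-- `Walk E s t x k`: there is a directed walk from `s` to `t` of total weight `x` with exactly `k`
negative (marked) edges. -/
inductive Walk {V : Type} (E : MGraph V) : V → V → ℝ → ℕ → Prop
  | nil (v : V) : Walk E v v 0 0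
  | cons {u v t : V} {w x : ℝ} {b : Bool} {k : ℕ} (he : E u v w b) (hp : Walk E v t x k) :
      Walk E u t (w + x) (b.toNat + k)

/-- The distance `d(s,t)`. -/
noncomputable def dist {V : Type} (E : MGraph V) (s t : V) : EReal :=
  ⨅ (x : ℝ) (k : ℕ) (_ : Walk E s t x k), (x : EReal)

/-- The `h`-negative hop distance `d^h(s,t)`. -/
noncomputable def hopDist {V : Type} (E : MGraph V) (h : ℕ) (s t : V) : EReal :=
  ⨅ (x : ℝ) (k : ℕ) (_ : Walk E s t x k ∧ k ≤ h), (x : EReal)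

/-- An unmarked multigraph, its negative edges being those of negative weight. -/
def mark {V : Type} (E : V → V → ℝ → Prop) : MGraph V :=
  fun u v w b => E u v w ∧ (b = true ↔ w < 0)

/-- The `h`-hop strong betweenness of `(s,t)` with respect to `N`. -/
noncomputable def strongBetweenness {V : Type} (E : MGraph V) (N : Set V) (h : ℕ) (s t : V) : ℕ :=
  {v ∈ N | ∃ s' t' : V,
    hopDist E h s' s + hopDist E h s v + hopDist E h v t + hopDist E h t t' < 0}.ncard

/-! ### The data of one iteration -/

/-- The data at the start of the construction: the graph `G_τ` (`wt u v = none` if there is no edge)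
on vertex set `Fin m`, the base vertex `base v` of which `v` is a copy, the shifts, the potential
`pot`, and the outcome of the forward and backward searches: the numbers `Δ_r`, the sets `sOut r`
and `sIn r`, and a flag telling on which side the inequality is strict. Search data at vertices that
are not negative is irrelevant. -/
structure Stage (m : ℕ) where
  wt : Fin m → Fin m → Option ℝ
  base : Fin m → Fin m
  shift : Fin m → ℝ
  pot : Fin m → ℝ
  Δ : Fin m → ℝ
  outStrict : Fin m → Bool
  sOut : Fin m → Finset (Fin m)
  sIn : Fin m → Finset (Fin m)

namespace Stage

variable {m : ℕ} (S : Stage m)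

/-- The graph `G_τ`. -/
def graph : MGraph (Fin m) := mark fun u v w => S.wt u v = some w

/-- The negative vertices (the tails of the negative edges of `G_τ`). -/
def N : Set (Fin m) := {u | ∃ v w, S.wt u v = some w ∧ w < 0}

/-- `Γ`: the graph `G_τ` reweighted by the potential, with the negative edges of `G_τ` frozen. -/
def Γ : MGraph (Fin m) := fun u v w b =>
  ∃ w₀, S.wt u v = some w₀ ∧ w = w₀ + S.pot u - S.pot v ∧ (b = true ↔ w₀ < 0)

/-- The shifts after the reweighting. -/
def shiftΓ (v : Fin m) : ℝ := S.shift v - S.pot v + S.pot (S.base v)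

/-- `H`: `G_τ` with an edge of weight `δ(v_j) - δ(v_i)` between any two copies of the same vertex,
reweighted by the potential, with negative edges frozen before the reweighting. -/
def H : MGraph (Fin m) := fun u v w b =>
  S.Γ u v w b ∨
    (S.base u = S.base v ∧ w = S.shift v - S.shift u + S.pot u - S.pot v ∧
      (b = true ↔ S.shift v - S.shift u < 0))

/-- The standing properties of `G_τ` and the validity of the potential. -/
structure Valid : Prop where
  base_base : ∀ v, S.base (S.base v) = S.base v
  /-- invariant on shifts: base vertices have shift `0` -/
  shift_base : ∀ v, S.shift (S.base v) = 0
  /-- invariant on edges: `ω(u_i,v_j) ≥ d(u_0,v_0) + δ(v_j) - δ(u_i)` -/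
  edge_ge : ∀ u v w, S.wt u v = some w →
    dist S.graph (S.base u) (S.base v) ≤ ((w - S.shift v + S.shift u : ℝ) : EReal)
  /-- every vertex is incident to at most one negative edge -/
  one_neg : ∀ u v w u' v' w', S.wt u v = some w → w < 0 → S.wt u' v' = some w' → w' < 0 →
    (u = u' ∨ u = v' ∨ v = u' ∨ v = v') → u = u' ∧ v = v'
  /-- the negative edge at a negative vertex is its only out-edge -/
  neg_single : ∀ u v w v' w', S.wt u v = some w → w < 0 → S.wt u v' = some w' → v' = v
  /-- negative edges join base vertices -/
  neg_base : ∀ u v w, S.wt u v = some w → w < 0 → S.base u = u ∧ S.base v = v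
  /-- the potential is valid: non-negative edges stay non-negative -/
  pot_valid : ∀ u v w, S.H u v w false → 0 ≤ w

/-- The guarantee of strong betweenness reduction on `H` with hop bound `2` and
`b = k / 2 ^ √(log n)`, i.e. `k / b = 2 ^ √(log n)`. -/
def LowBetweenness (n : ℕ) : Prop :=
  ∀ s t, (strongBetweenness S.H S.N 2 s t : ℝ) ≤ (2 : ℝ) ^ Real.sqrt (Real.logb 2 n)

/-- Weight `x` is attained by a walk in `H` that starts at `r`, uses `v` and has at most `h` negative
edges. -/
def WalkFrom (h : ℕ) (r v : Fin m) (x : ℝ) : Prop :=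
  ∃ t x₁ k₁ x₂ k₂, Walk S.H r v x₁ k₁ ∧ Walk S.H v t x₂ k₂ ∧ k₁ + k₂ ≤ h ∧ x = x₁ + x₂

/-- Weight `x` is attained by a walk in `H` that ends at `r`, uses `v` and has at most `h` negative
edges. -/
def WalkTo (h : ℕ) (v r : Fin m) (x : ℝ) : Prop :=
  ∃ s x₁ k₁ x₂ k₂, Walk S.H s v x₁ k₁ ∧ Walk S.H v r x₂ k₂ ∧ k₁ + k₂ ≤ h ∧ x = x₁ + x₂

/-- The specification of the forward and backward searches on `H` with hop bound `h = 1`. -/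
structure Searched : Prop where
  out_mem : ∀ r ∈ S.N, ∀ v ∈ S.sOut r, ∃ x, S.WalkFrom 2 r v x ∧
    if S.outStrict r then x < -S.Δ r else x ≤ -S.Δ r
  out_not_mem : ∀ r ∈ S.N, ∀ v ∉ S.sOut r, ∀ x, S.WalkFrom 2 r v x → -S.Δ r ≤ x
  in_mem : ∀ r ∈ S.N, ∀ v ∈ S.sIn r, ∃ x, S.WalkTo 1 v r x ∧
    if S.outStrict r then x ≤ S.Δ r else x < S.Δ r
  in_not_mem : ∀ r ∈ S.N, ∀ v ∉ S.sIn r, ∀ x, S.WalkTo 1 v r x → S.Δ r ≤ x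
  card_le : ∀ r ∈ S.N, (S.sOut r).card ≤ (S.sIn r).card + 1 ∧ (S.sIn r).card ≤ (S.sOut r).card + 1

/-- `V^out_r`. -/
def vOut (r : Fin m) : Set (Fin m) :=
  {v | v ∈ S.sOut r ∧ if S.outStrict r then hopDist S.Γ 1 r v < ((-S.Δ r : ℝ) : EReal)
    else hopDist S.Γ 1 r v ≤ ((-S.Δ r : ℝ) : EReal)}

/-- `V^in_r`. -/
def vIn (r : Fin m) : Set (Fin m) :=
  {v | v ∈ S.sIn r ∧ if S.outStrict r then hopDist S.Γ 0 v r ≤ (S.Δ r : EReal)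
    else hopDist S.Γ 0 v r < (S.Δ r : EReal)}

/-! ### The auxiliary graph `G'_{τ+1}` -/

/-- Vertices of `G'_{τ+1}`: those of `G_τ` and a Steiner vertex `r̃` for each negative `r`. -/
abbrev SV : Type := Fin m ⊕ {r : Fin m // r ∈ S.N}

/-- (S2): edges `(r̃,v)` for `v ∈ V^out_r ∪ {r'}`, where `(r,r')` is the negative edge at `r`. -/
def s2 (r v : Fin m) (w : ℝ) : Prop :=
  (v ∈ S.vOut r ∨ ∃ x, S.Γ r v x true) ∧ w = (hopDist S.Γ 1 r v).toReal + S.Δ r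

/-- (S3): edges `(v,r̃)` for `v ∈ V^in_r ∪ {r}`. -/
def s3 (v r : Fin m) (w : ℝ) : Prop :=
  (v ∈ S.vIn r ∨ v = r) ∧ w = (hopDist S.Γ 0 v r).toReal - S.Δ r

/-- (S4): edges `(r,v')` for negative edges `(v,v')` with `v ∈ V^out_r`. -/
def s4 (r v' : Fin m) (w : ℝ) : Prop :=
  r ∈ S.N ∧ ∃ v ∈ S.vOut r, ∃ x, S.Γ v v' x true ∧ w = (hopDist S.Γ 1 r v).toReal + x

/-- (S5): edges `(u,r')` for negative edges `(u,u')` and `(r,r')` with `u' ∈ V^in_r`. -/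
def s5 (u r' : Fin m) (w : ℝ) : Prop :=
  ∃ r, ∃ u' ∈ S.vIn r, ∃ x y, S.Γ u u' x true ∧ S.Γ r r' y true ∧
    w = x + (hopDist S.Γ 0 u' r).toReal + y

/-- The edges of `G'_{τ+1}`. -/
def aug : S.SV → S.SV → ℝ → Prop
  | .inl u, .inl v, w => (∃ b, S.Γ u v w b) ∨ S.s4 u v w ∨ S.s5 u v w
  | .inr r, .inl v, w => S.s2 r v w
  | .inl v, .inr r, w => S.s3 v r w
  | .inr _, .inr _, _ => False

/-- Imaginary negative edges: negative edges incident to a Steiner vertex. -/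
def imaginary (a b : S.SV) (w : ℝ) : Prop :=
  S.aug a b w ∧ w < 0 ∧ (a.isRight = true ∨ b.isRight = true)

/-- Edges `(a,b)`, `(b,c)` of weights `x`, `y` form a locally-negative two-edge path. -/
def LocallyNegative (a b c : S.SV) (x y : ℝ) : Prop :=
  S.aug a b x ∧ S.aug b c y ∧ (S.imaginary a b x ∨ S.imaginary b c y) ∧ 0 ≤ x + y

/-! ### The output graph `G_{τ+1}` -/

/-- A candidate for `G_{τ+1}`: it has `q` vertices besides those of `G'_{τ+1}`, the `j`-th one
labelled as a copy of `newBase j` with shift `newShift j`. -/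
structure Out where
  q : ℕ
  newBase : Fin q → Fin m
  newShift : Fin q → ℝ
  E : S.SV ⊕ Fin q → S.SV ⊕ Fin q → ℝ → Prop

variable {S}

/-- The base vertex (in `G'_{τ+1}`) of a vertex of `G_{τ+1}`; Steiner vertices are base vertices. -/
def Out.baseOf (O : S.Out) : S.SV ⊕ Fin O.q → S.SV
  | .inl (.inl v) => .inl (S.base v)
  | .inl (.inr r) => .inr r
  | .inr j => .inl (O.newBase j)

/-- The shift of a vertex of `G_{τ+1}`. -/
def Out.shiftOf (O : S.Out) : S.SV ⊕ Fin O.q → ℝ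
  | .inl (.inl v) => S.shiftΓ v
  | .inl (.inr _) => 0
  | .inr j => O.newShift j

/-- The properties of `G_{τ+1}`. -/
structure Out.Good (O : S.Out) : Prop where
  /-- every locally-negative two-edge path is shortcut: there is a walk of the same weight without
  negative edges -/
  shortcut : ∀ a b c x y, S.LocallyNegative a b c x y →
    Walk (mark O.E) (.inl a) (.inl c) (x + y) 0
  /-- the additional vertices are labelled by base vertices of `G_τ` ... -/
  newBase_base : ∀ j, S.base (O.newBase j) = O.newBase j
  /-- ... each of them used at most twice, ... -/
  newBase_card : ∀ v : Fin m, {j | O.newBase j = v}.ncard ≤ 2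
  /-- ... and are copies: the invariant on edges holds -/
  edge_ge : ∀ a b w, O.E a b w →
    dist (mark S.aug) (O.baseOf a) (O.baseOf b) ≤ ((w - O.shiftOf b + O.shiftOf a : ℝ) : EReal)
  has_s4 : ∀ r v w, S.s4 r v w → O.E (.inl (.inl r)) (.inl (.inl v)) w
  has_s5 : ∀ u v w, S.s5 u v w → O.E (.inl (.inl u)) (.inl (.inl v)) w
  /-- all edges of `G'_{τ+1}` are kept, except for the imaginary negative ones ... -/
  keeps : ∀ a b w, S.aug a b w → ¬ S.imaginary a b w → O.E (.inl a) (.inl b) w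
  /-- ... and there are no further negative edges -/
  neg_old : ∀ a b w, O.E a b w → w < 0 →
    ∃ a' b', a = .inl a' ∧ b = .inl b' ∧ S.aug a' b' w ∧ ¬ S.imaginary a' b' w

end Stage

/-! ### The machine model: a word RAM with real cells -/

/-- Memory: word variables, real variables, word arrays and real arrays. A program mentions finitely
many variables and arrays; the cells of the arrays are addressed by words. -/
structure State where
  nv : ℕ → ℕ
  rv : ℕ → ℝ
  na : ℕ → ℕ → ℕ
  ra : ℕ → ℕ → ℝ

inductive Cond
  | lt (x y : ℕ)
  | eq (x y : ℕ)
  | rlt (x y : ℕ)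

/-- Programs. The arguments are indices of variables and arrays (`c` in `const` is a literal). -/
inductive Cmd
  | const (x c : ℕ)
  | add (x y z : ℕ)
  | sub (x y z : ℕ)
  | mul (x y z : ℕ)
  | div (x y z : ℕ)
  | load (x a y : ℕ)
  | store (a y x : ℕ)
  | rzero (x : ℕ)
  | radd (x y z : ℕ)
  | rsub (x y z : ℕ)
  | rload (x a y : ℕ)
  | rstore (a y x : ℕ)
  | seq (p q : Cmd)
  | ite (c : Cond) (p q : Cmd)
  | while (c : Cond) (p : Cmd)

def Cond.Holds (s : State) : Cond → Prop
  | .lt x y => s.nv x < s.nv y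
  | .eq x y => s.nv x = s.nv y
  | .rlt x y => s.rv x < s.rv y

namespace State

def setN (s : State) (x v : ℕ) : State := { s with nv := Function.update s.nv x v }

noncomputable def setR (s : State) (x : ℕ) (v : ℝ) : State :=
  { s with rv := Function.update s.rv x v }

def setNA (s : State) (a i v : ℕ) : State :=
  { s with na := Function.update s.na a (Function.update (s.na a) i v) }

noncomputable def setRA (s : State) (a i : ℕ) (v : ℝ) : State :=
  { s with ra := Function.update s.ra a (Function.update (s.ra a) i v) }

end State

/-- `Exec w p s s' t`: with words of `w` bits, program `p` started in memory `s` halts in memory `s'`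
after `t` steps. Every elementary instruction and every evaluation of a test takes one step. -/
inductive Exec (w : ℕ) : Cmd → State → State → ℕ → Prop
  | const (s x c) : Exec w (.const x c) s (s.setN x (c % 2 ^ w)) 1
  | add (s x y z) : Exec w (.add x y z) s (s.setN x ((s.nv y + s.nv z) % 2 ^ w)) 1
  | sub (s x y z) : Exec w (.sub x y z) s (s.setN x (s.nv y - s.nv z)) 1
  | mul (s x y z) : Exec w (.mul x y z) s (s.setN x ((s.nv y * s.nv z) % 2 ^ w)) 1
  | div (s x y z) : Exec w (.div x y z) s (s.setN x (s.nv y / s.nv z)) 1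
  | load (s x a y) : Exec w (.load x a y) s (s.setN x (s.na a (s.nv y))) 1
  | store (s a y x) : Exec w (.store a y x) s (s.setNA a (s.nv y) (s.nv x)) 1
  | rzero (s x) : Exec w (.rzero x) s (s.setR x 0) 1
  | radd (s x y z) : Exec w (.radd x y z) s (s.setR x (s.rv y + s.rv z)) 1
  | rsub (s x y z) : Exec w (.rsub x y z) s (s.setR x (s.rv y - s.rv z)) 1
  | rload (s x a y) : Exec w (.rload x a y) s (s.setR x (s.ra a (s.nv y))) 1
  | rstore (s a y x) : Exec w (.rstore a y x) s (s.setRA a (s.nv y) (s.rv x)) 1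
  | seq {p q s₁ s₂ s₃ t₁ t₂} : Exec w p s₁ s₂ t₁ → Exec w q s₂ s₃ t₂ →
      Exec w (.seq p q) s₁ s₃ (t₁ + t₂)
  | ite_true {c p q s s' t} : c.Holds s → Exec w p s s' t → Exec w (.ite c p q) s s' (t + 1)
  | ite_false {c p q s s' t} : ¬ c.Holds s → Exec w q s s' t → Exec w (.ite c p q) s s' (t + 1)
  | while_true {c p s₁ s₂ s₃ t₁ t₂} : c.Holds s₁ → Exec w p s₁ s₂ t₁ →
      Exec w (.while c p) s₂ s₃ t₂ → Exec w (.while c p) s₁ s₃ (t₁ + t₂ + 1)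
  | while_false {c p s} : ¬ c.Holds s → Exec w (.while c p) s s 1

/-! ### Encoding of input and output -/

/-- The arrays `src`, `dst`, `wt` list, in their first `cnt` cells, the edges of `E`; vertices are
numbered by `code`. -/
def ListsEdges {V : Type} (code : V → ℕ) (cnt : ℕ) (src dst : ℕ → ℕ) (wt : ℕ → ℝ)
    (E : V → V → ℝ → Prop) : Prop :=
  (∀ a b x, E a b x ↔ ∃ i < cnt, src i = code a ∧ dst i = code b ∧ wt i = x) ∧
    ∀ i < cnt, ∃ a b, src i = code a ∧ dst i = code b

namespace Stage

variable {m : ℕ} (S : Stage m)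

/-- Numbering of the vertices of `G'_{τ+1}`. -/
def code : S.SV → ℕ
  | .inl v => v
  | .inr r => m + r.1

/-- Numbering of the vertices of `G_{τ+1}`. -/
def codeOut (q : ℕ) : S.SV ⊕ Fin q → ℕ
  | .inl a => S.code a
  | .inr j => 2 * m + j

/-- The memory `s` holds the input: `n`, the number `m` of vertices, the base vertices and
(reweighted) shifts, `Γ` as an adjacency matrix (`0`: no edge, `1`: edge, `2`: negative edge), the
search sets as `0`-`1`-matrices, and the edges of `G'_{τ+1}` as a list without repetitions. All
other memory cells are arbitrary. -/
structure Input (n w : ℕ) (s : State) : Prop where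
  word_nv : ∀ i, s.nv i < 2 ^ w
  word_na : ∀ a i, s.na a i < 2 ^ w
  n_eq : s.nv 0 = n
  m_eq : s.nv 1 = m
  base_eq : ∀ v : Fin m, s.na 0 v = S.base v
  shift_eq : ∀ v : Fin m, s.ra 0 v = S.shiftΓ v
  adj_none : ∀ u v : Fin m, S.wt u v = none → s.na 1 (u * m + v) = 0
  adj_some : ∀ (u v : Fin m) (x : ℝ) (b : Bool), S.Γ u v x b →
    s.na 1 (u * m + v) = (if b then 2 else 1) ∧ s.ra 1 (u * m + v) = x
  out_eq : ∀ r ∈ S.N, ∀ v : Fin m, s.na 2 (r * m + v) = if v ∈ S.sOut r then 1 else 0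
  in_eq : ∀ r ∈ S.N, ∀ v : Fin m, s.na 3 (r * m + v) = if v ∈ S.sIn r then 1 else 0
  edges : ListsEdges S.code (s.nv 2) (s.na 4) (s.na 5) (s.ra 2) S.aug
  edges_nodup : ∀ i < s.nv 2, ∀ j < s.nv 2, s.na 4 i = s.na 4 j → s.na 5 i = s.na 5 j →
    s.ra 2 i = s.ra 2 j → i = j

variable {S}

/-- The memory `s` holds the graph `O`: the number of additional vertices, their base vertices and
shifts, and the list of edges. -/
structure Out.Output (O : S.Out) (s : State) : Prop where
  q_eq : s.nv 3 = O.q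
  base_eq : ∀ j : Fin O.q, s.na 6 j = O.newBase j
  shift_eq : ∀ j : Fin O.q, s.ra 3 j = O.newShift j
  edges : ListsEdges (S.codeOut O.q) (s.nv 4) (s.na 7) (s.na 8) (s.ra 4) O.E

end Stage

end Shortcut

open Shortcut

/-! A path whose first edge is imaginary is shortcut directly or through one new copy of each base
vertex. Paths whose second edge is imaginary are handled by the same procedure on the reversed graph
with negated shifts, with a second new copy. Below, `d` selects the direction, A_r is the search set
of r on the side of the phase and B_r the one on the other side.

An imaginary edge that enters a Steiner vertex r̃ is combined with all edges out of r̃, of which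
there are at most |A_r| + 1. An imaginary edge (r̃,v) is combined with all edges at v if |A_r|³ ≥
m². Otherwise it is redirected to the new copy of the base vertex of v. The shift D of this copy is
the maximum of δ(v) - ω(r̃,v) over all redirected edges into the group of copies, so the redirected
weight ω(r̃,v) - δ(v) + D is non-negative. An edge (v,c) moves to the copy with weight ω(v,c) + δ(v)
- D if this is non-negative; the two corrections cancel, so total weights are preserved. The
invariant on edges holds for every choice of D. The remaining "low" edges at v are combined with
(r̃,v) directly.

Maximality of D keeps the low edges few. D is attained by some (s̃,v') with v' a copy of the same
vertex and |A_s|³ < m². If (v,t) is a low non-negative edge of Γ, then going from s to v', across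
the copies to v and on to t gives a walk in H with few enough negative edges and weight below the
threshold of the search at s. Hence t ∈ A_s, and fewer than m^(2/3) such t exist
(`Searched.mem_search_of_low`, `Codes.length_partners_of_inl`). The other edges at v come from
negative edges and search sets and are counted by `excess`.

For the running time let β = 2^√(log n). Walks witnessing u ∈ B_r and v ∈ A_r join to a walk of
negative weight, so low betweenness allows at most β such r for each (u,v) (`Searched.spread`).
Therefore ∑|A_r||B_r| ≤ m²β, and since the two sizes differ by at most one, ∑|A_r|² = O(m²β). This
bounds the large sets by ∑|A_r|·m = O(m^(7/3)β) and the small ones by m^(2/3)·∑|A_r| = O(m^(7/3)β);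
the terms from `excess` are bounded by weighted double counting (`Spread.sum_load_mul_load`,
`Spread.sum_load_mul_card`). With m = O(n log² n), the polylogarithmic factor and β are n^(o(1)).

The program is verified by weakest preconditions, a loop rule (`runs_loop`) and syntactic frames.
`Inst` describes a phase in terms of numbers, `Codes` ties it to the graph, `good_of_newEdges` gives
the properties of the output and `Codes.sum_partners` the cost; `Input.exec_program` joins them. -/

namespace Shortcut

/-! ### Weakest preconditions for the word RAM -/

/-- Program `p` started in `s` halts after `t` steps in a memory `s'` with `Q s' t`. -/
def Runs (w : ℕ) (p : Cmd) (s : State) (Q : State → ℕ → Prop) : Prop :=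
  ∃ s' t, Exec w p s s' t ∧ Q s' t

section rules
variable {w : ℕ} {s : State} {Q R : State → ℕ → Prop}

/-- The implication may also use the execution itself, so that `Exec.frame` supplies whatever a
specification leaves unsaid. -/
theorem Runs.mono {p : Cmd} (h : Runs w p s Q) (hQ : ∀ s' t, Exec w p s s' t → Q s' t → R s' t) :
    Runs w p s R := by
  obtain ⟨s', t, he, hq⟩ := h
  exact ⟨s', t, he, hQ _ _ he hq⟩

/-- While the state is being simplified, the rest of the program is left alone. -/
@[congr] theorem runs_congr {p : Cmd} {s' : State} (h : s = s') : Runs w p s Q = Runs w p s' Q := by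
  rw [h]

@[simp] theorem runs_const {x c : ℕ} : Runs w (.const x c) s Q ↔ Q (s.setN x (c % 2 ^ w)) 1 :=
  ⟨fun ⟨_, _, h, q⟩ => by cases h; exact q, fun h => ⟨_, _, .const .., h⟩⟩

@[simp] theorem runs_add {x y z : ℕ} :
    Runs w (.add x y z) s Q ↔ Q (s.setN x ((s.nv y + s.nv z) % 2 ^ w)) 1 :=
  ⟨fun ⟨_, _, h, q⟩ => by cases h; exact q, fun h => ⟨_, _, .add .., h⟩⟩

@[simp] theorem runs_sub {x y z : ℕ} : Runs w (.sub x y z) s Q ↔ Q (s.setN x (s.nv y - s.nv z)) 1 :=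
  ⟨fun ⟨_, _, h, q⟩ => by cases h; exact q, fun h => ⟨_, _, .sub .., h⟩⟩

@[simp] theorem runs_mul {x y z : ℕ} :
    Runs w (.mul x y z) s Q ↔ Q (s.setN x ((s.nv y * s.nv z) % 2 ^ w)) 1 :=
  ⟨fun ⟨_, _, h, q⟩ => by cases h; exact q, fun h => ⟨_, _, .mul .., h⟩⟩

@[simp] theorem runs_div {x y z : ℕ} : Runs w (.div x y z) s Q ↔ Q (s.setN x (s.nv y / s.nv z)) 1 :=
  ⟨fun ⟨_, _, h, q⟩ => by cases h; exact q, fun h => ⟨_, _, .div .., h⟩⟩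

@[simp] theorem runs_load {x a y : ℕ} : Runs w (.load x a y) s Q ↔ Q (s.setN x (s.na a (s.nv y))) 1 :=
  ⟨fun ⟨_, _, h, q⟩ => by cases h; exact q, fun h => ⟨_, _, .load .., h⟩⟩

@[simp] theorem runs_store {a y x : ℕ} : Runs w (.store a y x) s Q ↔ Q (s.setNA a (s.nv y) (s.nv x)) 1 :=
  ⟨fun ⟨_, _, h, q⟩ => by cases h; exact q, fun h => ⟨_, _, .store .., h⟩⟩

@[simp] theorem runs_rzero {x : ℕ} : Runs w (.rzero x) s Q ↔ Q (s.setR x 0) 1 :=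
  ⟨fun ⟨_, _, h, q⟩ => by cases h; exact q, fun h => ⟨_, _, .rzero .., h⟩⟩

@[simp] theorem runs_radd {x y z : ℕ} : Runs w (.radd x y z) s Q ↔ Q (s.setR x (s.rv y + s.rv z)) 1 :=
  ⟨fun ⟨_, _, h, q⟩ => by cases h; exact q, fun h => ⟨_, _, .radd .., h⟩⟩

@[simp] theorem runs_rsub {x y z : ℕ} : Runs w (.rsub x y z) s Q ↔ Q (s.setR x (s.rv y - s.rv z)) 1 :=
  ⟨fun ⟨_, _, h, q⟩ => by cases h; exact q, fun h => ⟨_, _, .rsub .., h⟩⟩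

@[simp] theorem runs_rload {x a y : ℕ} : Runs w (.rload x a y) s Q ↔ Q (s.setR x (s.ra a (s.nv y))) 1 :=
  ⟨fun ⟨_, _, h, q⟩ => by cases h; exact q, fun h => ⟨_, _, .rload .., h⟩⟩

@[simp] theorem runs_rstore {a y x : ℕ} : Runs w (.rstore a y x) s Q ↔ Q (s.setRA a (s.nv y) (s.rv x)) 1 :=
  ⟨fun ⟨_, _, h, q⟩ => by cases h; exact q, fun h => ⟨_, _, .rstore .., h⟩⟩

@[simp] theorem runs_seq {p q : Cmd} :
    Runs w (.seq p q) s Q ↔ Runs w p s fun s₁ t₁ => Runs w q s₁ fun s₂ t₂ => Q s₂ (t₁ + t₂) := by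
  constructor
  · rintro ⟨_, _, h, hq⟩
    cases h with
    | seq h₁ h₂ => exact ⟨_, _, h₁, _, _, h₂, hq⟩
  · rintro ⟨_, _, h₁, _, _, h₂, hq⟩
    exact ⟨_, _, .seq h₁ h₂, hq⟩

@[simp] theorem runs_ite {c : Cond} {p q : Cmd} :
    Runs w (.ite c p q) s Q ↔
      (c.Holds s → Runs w p s fun s' t => Q s' (t + 1)) ∧
        (¬ c.Holds s → Runs w q s fun s' t => Q s' (t + 1)) := by
  constructor
  · rintro ⟨_, _, h, hq⟩
    cases h with
    | ite_true hc h => exact ⟨fun _ => ⟨_, _, h, hq⟩, fun h' => absurd hc h'⟩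
    | ite_false hc h => exact ⟨fun h' => absurd h' hc, fun _ => ⟨_, _, h, hq⟩⟩
  · rintro ⟨h₁, h₂⟩
    by_cases hc : c.Holds s
    · obtain ⟨_, _, h, hq⟩ := h₁ hc
      exact ⟨_, _, .ite_true hc h, hq⟩
    · obtain ⟨_, _, h, hq⟩ := h₂ hc
      exact ⟨_, _, .ite_false hc h, hq⟩

end rules

attribute [simp] Cond.Holds

/-! ### Reading and writing memory -/

namespace State
variable (s : State)

@[simp] theorem setN_nv (x v y : ℕ) : (s.setN x v).nv y = if y = x then v else s.nv y := by
  simp [setN, Function.update_apply]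
@[simp] theorem setN_rv (x v : ℕ) : (s.setN x v).rv = s.rv := rfl
@[simp] theorem setN_na (x v : ℕ) : (s.setN x v).na = s.na := rfl
@[simp] theorem setN_ra (x v : ℕ) : (s.setN x v).ra = s.ra := rfl
@[simp] theorem setR_nv (x : ℕ) (v : ℝ) : (s.setR x v).nv = s.nv := rfl
@[simp] theorem setR_rv (x : ℕ) (v : ℝ) (y : ℕ) :
    (s.setR x v).rv y = if y = x then v else s.rv y := by
  simp [setR, Function.update_apply]
@[simp] theorem setR_na (x : ℕ) (v : ℝ) : (s.setR x v).na = s.na := rfl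
@[simp] theorem setR_ra (x : ℕ) (v : ℝ) : (s.setR x v).ra = s.ra := rfl
@[simp] theorem setNA_nv (a i v : ℕ) : (s.setNA a i v).nv = s.nv := rfl
@[simp] theorem setNA_rv (a i v : ℕ) : (s.setNA a i v).rv = s.rv := rfl
@[simp] theorem setNA_na (a i v b : ℕ) :
    (s.setNA a i v).na b = if b = a then Function.update (s.na a) i v else s.na b := by
  simp [setNA, Function.update_apply]
@[simp] theorem setNA_ra (a i v : ℕ) : (s.setNA a i v).ra = s.ra := rfl
@[simp] theorem setRA_nv (a i : ℕ) (v : ℝ) : (s.setRA a i v).nv = s.nv := rfl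
@[simp] theorem setRA_rv (a i : ℕ) (v : ℝ) : (s.setRA a i v).rv = s.rv := rfl
@[simp] theorem setRA_na (a i : ℕ) (v : ℝ) : (s.setRA a i v).na = s.na := rfl
@[simp] theorem setRA_ra (a i : ℕ) (v : ℝ) (b : ℕ) :
    (s.setRA a i v).ra b = if b = a then Function.update (s.ra a) i v else s.ra b := by
  simp [setRA, Function.update_apply]

end State

/-! ### Frames -/

/-- The word variables a program may change. -/
def Cmd.modN : Cmd → ℕ → Prop
  | .const x _, y | .add x _ _, y | .sub x _ _, y | .mul x _ _, y | .div x _ _, y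
  | .load x _ _, y => y = x
  | .seq p q, y | .ite _ p q, y => p.modN y ∨ q.modN y
  | .while _ p, y => p.modN y
  | _, _ => False

/-- The real variables a program may change. -/
def Cmd.modR : Cmd → ℕ → Prop
  | .rzero x, y | .radd x _ _, y | .rsub x _ _, y | .rload x _ _, y => y = x
  | .seq p q, y | .ite _ p q, y => p.modR y ∨ q.modR y
  | .while _ p, y => p.modR y
  | _, _ => False

/-- The word arrays a program may change. -/
def Cmd.modNA : Cmd → ℕ → Prop
  | .store a _ _, b => b = a
  | .seq p q, y | .ite _ p q, y => p.modNA y ∨ q.modNA y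
  | .while _ p, y => p.modNA y
  | _, _ => False

/-- The real arrays a program may change. -/
def Cmd.modRA : Cmd → ℕ → Prop
  | .rstore a _ _, b => b = a
  | .seq p q, y | .ite _ p q, y => p.modRA y ∨ q.modRA y
  | .while _ p, y => p.modRA y
  | _, _ => False

/-- The memories `s` and `s'` agree outside the cells that `p` may change. -/
structure Frame (p : Cmd) (s s' : State) : Prop where
  nv : ∀ x, ¬ p.modN x → s'.nv x = s.nv x
  rv : ∀ x, ¬ p.modR x → s'.rv x = s.rv x
  na : ∀ a, ¬ p.modNA a → s'.na a = s.na a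
  ra : ∀ a, ¬ p.modRA a → s'.ra a = s.ra a

theorem Frame.refl (p : Cmd) (s : State) : Frame p s s :=
  ⟨fun _ _ => rfl, fun _ _ => rfl, fun _ _ => rfl, fun _ _ => rfl⟩

theorem Frame.trans {p : Cmd} {s₁ s₂ s₃ : State} (h : Frame p s₁ s₂) (h' : Frame p s₂ s₃) :
    Frame p s₁ s₃ :=
  ⟨fun x hx => (h'.nv x hx).trans (h.nv x hx), fun x hx => (h'.rv x hx).trans (h.rv x hx),
    fun x hx => (h'.na x hx).trans (h.na x hx), fun x hx => (h'.ra x hx).trans (h.ra x hx)⟩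

/-- The footprint is syntactic, so a specification only has to describe the cells that change. In
composite commands it is the union of the footprints of the parts. -/
theorem Exec.frame {w : ℕ} {p : Cmd} {s s' : State} {t : ℕ} (h : Exec w p s s' t) :
    Frame p s s' := by
  induction h with
  | @seq _ _ _ s₂ _ _ _ _ _ h₁ h₂ =>
    refine Frame.trans (s₂ := s₂) ?_ ?_
    · exact ⟨fun x hx => h₁.nv x (mt .inl hx), fun x hx => h₁.rv x (mt .inl hx),
        fun x hx => h₁.na x (mt .inl hx), fun x hx => h₁.ra x (mt .inl hx)⟩
    · exact ⟨fun x hx => h₂.nv x (mt .inr hx), fun x hx => h₂.rv x (mt .inr hx),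
        fun x hx => h₂.na x (mt .inr hx), fun x hx => h₂.ra x (mt .inr hx)⟩
  | ite_true _ _ h₁ =>
    exact ⟨fun x hx => h₁.nv x (mt .inl hx), fun x hx => h₁.rv x (mt .inl hx),
        fun x hx => h₁.na x (mt .inl hx), fun x hx => h₁.ra x (mt .inl hx)⟩
  | ite_false _ _ h₂ =>
    exact ⟨fun x hx => h₂.nv x (mt .inr hx), fun x hx => h₂.rv x (mt .inr hx),
        fun x hx => h₂.na x (mt .inr hx), fun x hx => h₂.ra x (mt .inr hx)⟩
  | while_true _ _ _ h₁ h₂ =>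
    refine Frame.trans ?_ h₂
    exact ⟨fun x hx => h₁.nv x hx, fun x hx => h₁.rv x hx, fun x hx => h₁.na x hx,
      fun x hx => h₁.ra x hx⟩
  | while_false => exact Frame.refl _ _
  | _ =>
    constructor <;> intro x hx <;> simp_all [Cmd.modN, Cmd.modR, Cmd.modNA, Cmd.modRA]

/-! ### Loops -/

/-- Run `body` for `i = 0, …, n - 1`; word variable `5` holds `1`. -/
def loop (i n : ℕ) (body : Cmd) : Cmd :=
  .seq (.const i 0) (.while (.lt i n) (.seq body (.add i i 5)))

/-- The body changes neither the counter nor the bound nor the constant 1, so the loop runs exactly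
`K` times. The frame relating each intermediate memory to the initial one is handed to `step`, so
`I` need not mention what stays fixed. The cost is the body plus one test and one increment per
round, and one initialization and one final test overall. -/
theorem runs_loop {w i n K : ℕ} {body : Cmd} {s : State} (I : ℕ → State → Prop) (T : ℕ → ℕ)
    (hK : s.nv n = K) (hw : K < 2 ^ w) (h5 : s.nv 5 = 1) (hni : n ≠ i) (h5i : 5 ≠ i)
    (hn : ¬ body.modN n) (h5b : ¬ body.modN 5) (hi : ¬ body.modN i)
    (h0 : I 0 (s.setN i 0))
    (step : ∀ k < K, ∀ s₁, Frame (loop i n body) s s₁ → s₁.nv i = k → I k s₁ →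
      Runs w body s₁ fun s₂ t => t ≤ T k ∧ I (k + 1) (s₂.setN i (k + 1))) :
    Runs w (loop i n body) s fun s' t => t ≤ 2 + ∑ k ∈ Finset.range K, (T k + 2) ∧ I K s' := by
  -- Induction on the number `d` of rounds still to come.
  have key : ∀ d k, d + k = K → ∀ s₁, Frame (loop i n body) s s₁ → s₁.nv i = k → I k s₁ →
      Runs w (.while (.lt i n) (.seq body (.add i i 5))) s₁ fun s' t =>
        t ≤ 1 + ∑ j ∈ Finset.range d, (T (k + j) + 2) ∧ I K s' := by
    intro d
    induction d with
    | zero =>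
      rintro k hk s₁ hF hik hI
      have h1 : s₁.nv n = K := by
        rw [hF.nv n (by simp [loop, Cmd.modN, hn, hni]), hK]
      refine ⟨s₁, 1, .while_false ?_, by simp, by rwa [show K = k by omega]⟩
      simp [Cond.Holds, h1, hik]; omega
    | succ d ih =>
      rintro k hk s₁ hF hik hI
      have h1 : s₁.nv n = K := by
        rw [hF.nv n (by simp [loop, Cmd.modN, hn, hni]), hK]
      obtain ⟨s₂, t, he, ht, hI'⟩ := step k (by omega) s₁ hF hik hI
      have e1 : s₂.nv i = k := by rw [he.frame.nv i hi, hik]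
      have e2 : s₂.nv 5 = 1 := by
        rw [he.frame.nv 5 h5b, hF.nv 5 (by simp [loop, Cmd.modN, h5b, h5i]), h5]
      have hE : Exec w (.seq body (.add i i 5)) s₁ (s₂.setN i (k + 1)) (t + 1) := by
        have h2 := Exec.add (w := w) s₂ i i 5
        rw [e1, e2, Nat.mod_eq_of_lt (by omega)] at h2
        exact .seq he h2
      have hF' : Frame (loop i n body) s (s₂.setN i (k + 1)) := by
        refine hF.trans ?_
        have := hE.frame
        exact ⟨fun x hx => this.nv x (mt .inr hx), fun x hx => this.rv x (mt .inr hx),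
          fun x hx => this.na x (mt .inr hx), fun x hx => this.ra x (mt .inr hx)⟩
      obtain ⟨s', t', he', ht', hI''⟩ := ih (k + 1) (by omega) _ hF' (by simp) hI'
      refine ⟨s', _, .while_true ?_ hE he', ?_, hI''⟩
      · simp [Cond.Holds, h1, hik]; omega
      · rw [Finset.sum_range_succ']
        rw [Finset.sum_congr rfl fun j _ => by rw [show k + (j + 1) = k + 1 + j by omega]]
        rw [add_zero]
        omega
  have hF0 : Frame (loop i n body) s (s.setN i 0) := by
    refine ⟨fun x hx => ?_, fun _ _ => rfl, fun _ _ => rfl, fun _ _ => rfl⟩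
    rw [State.setN_nv, if_neg]
    exact fun h => hx (.inl h)
  have h := key K 0 (by omega) (s.setN i 0) hF0 (by simp) h0
  rw [loop, runs_seq, runs_const]
  rw [Nat.zero_mod]
  refine h.mono ?_
  rintro s' t - ⟨ht, hI⟩
  simp only [zero_add] at ht
  exact ⟨by omega, hI⟩


/-! ### Emitting an edge -/

/-- Edges are emitted as they are (`d = false`) or reversed (`d = true`). -/
def orient : Bool → ℕ × ℕ × ℝ → ℕ × ℕ × ℝ
  | false, e => e
  | true, e => (e.2.1, e.1, e.2.2)

/-- The set of edges that have been output. -/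
def State.out (s : State) : Set (ℕ × ℕ × ℝ) :=
  {e | ∃ i < s.nv 4, e = (s.na 7 i, s.na 8 i, s.ra 4 i)}

/-- Append an edge to the output. -/
def emit (d : Bool) (x y z : ℕ) : Cmd :=
  .seq (.store (cond d 8 7) 4 x) <| .seq (.store (cond d 7 8) 4 y) <|
    .seq (.rstore 4 4 z) (.add 4 4 5)

namespace State

/-- The memory after an edge has been appended to the output. -/
noncomputable def emit (s : State) (d : Bool) (a b : ℕ) (v : ℝ) : State :=
  (((s.setNA (cond d 8 7) (s.nv 4) a).setNA (cond d 7 8) (s.nv 4) b).setRA 4 (s.nv 4) v).setN 4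
    (s.nv 4 + 1)

variable (s : State) (d : Bool) (a b : ℕ) (v : ℝ)

@[simp] theorem emit_nv (y : ℕ) : (s.emit d a b v).nv y = if y = 4 then s.nv 4 + 1 else s.nv y := by
  simp [emit]

@[simp] theorem emit_rv : (s.emit d a b v).rv = s.rv := rfl

theorem emit_na {c : ℕ} (h7 : c ≠ 7) (h8 : c ≠ 8) : (s.emit d a b v).na c = s.na c := by
  cases d <;> simp [emit, h7, h8]

theorem emit_ra {c : ℕ} (h : c ≠ 4) : (s.emit d a b v).ra c = s.ra c := by
  simp [emit, h]

@[simp] theorem out_setN {x n : ℕ} (h : x ≠ 4) : (s.setN x n).out = s.out := by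
  simp [out, h.symm]

@[simp] theorem out_setR {x : ℕ} {n : ℝ} : (s.setR x n).out = s.out := rfl

@[simp] theorem out_setNA {c i n : ℕ} (h7 : c ≠ 7) (h8 : c ≠ 8) : (s.setNA c i n).out = s.out := by
  simp [out, h7.symm, h8.symm]

@[simp] theorem out_emit : (s.emit d a b v).out = insert (orient d (a, b, v)) s.out := by
  ext e
  simp only [out, Set.mem_ofPred_eq, Set.mem_insert_iff, emit_nv, if_true]
  constructor
  · rintro ⟨i, hi, rfl⟩
    by_cases h : i = s.nv 4
    · left
      subst h
      cases d <;> simp [emit, orient]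
    · right
      refine ⟨i, by omega, ?_⟩
      cases d <;> simp [emit, h]
  · rintro (rfl | ⟨i, hi, rfl⟩)
    · refine ⟨s.nv 4, by omega, ?_⟩
      cases d <;> simp [emit, orient]
    · refine ⟨i, by omega, ?_⟩
      have h : i ≠ s.nv 4 := by omega
      cases d <;> simp [emit, h]

end State

theorem runs_emit {w : ℕ} {s : State} {Q : State → ℕ → Prop} {d : Bool} {x y z : ℕ}
    (h5 : s.nv 5 = 1) (hw : s.nv 4 + 1 < 2 ^ w) :
    Runs w (emit d x y z) s Q ↔ Q (s.emit d (s.nv x) (s.nv y) (s.rv z)) 4 := by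
  simp [emit, runs_seq, runs_store, runs_rstore, runs_add, h5, Nat.mod_eq_of_lt hw, State.emit]

/-! ### Linked lists -/

/-- The list `l` is stored as a linked list from `p`, with links `nx`; `j + 1` points to `j`. -/
def Chain (nx : ℕ → ℕ) : ℕ → List ℕ → Prop
  | p, [] => p = 0
  | p, j :: l => p = j + 1 ∧ Chain nx (nx j) l

theorem Chain.update {nx : ℕ → ℕ} {i v : ℕ} :
    ∀ {l : List ℕ} {p : ℕ}, i ∉ l → Chain nx p l → Chain (Function.update nx i v) p l
  | [], _, _, h => h
  | j :: l, p, hi, h => by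
    simp only [List.mem_cons, not_or] at hi
    refine ⟨h.1, ?_⟩
    rw [Function.update_of_ne (Ne.symm hi.1)]
    exact Chain.update hi.2 h.2

open Classical in
/-- The indices below `i` with property `f`, largest first. -/
noncomputable def sel (f : ℕ → Prop) : ℕ → List ℕ
  | 0 => []
  | i + 1 => if f i then i :: sel f i else sel f i

theorem mem_sel {f : ℕ → Prop} {i j : ℕ} : j ∈ sel f i ↔ j < i ∧ f j := by
  induction i with
  | zero => simp [sel]
  | succ i ih =>
    by_cases h : f i
    · simp only [sel, h, if_true, List.mem_cons, ih]
      constructor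
      · rintro (rfl | h')
        · exact ⟨by omega, h⟩
        · exact ⟨by omega, h'.2⟩
      · rintro ⟨h1, h2⟩
        rcases Nat.lt_succ_iff_lt_or_eq.mp h1 with h3 | h3
        · exact .inr ⟨h3, h2⟩
        · exact .inl h3
    · simp only [sel, h, if_false, ih]
      constructor
      · rintro h'
        exact ⟨by omega, h'.2⟩
      · rintro ⟨h1, h2⟩
        rcases Nat.lt_succ_iff_lt_or_eq.mp h1 with h3 | h3
        · exact ⟨h3, h2⟩
        · exact absurd (h3 ▸ h2) h

open Classical in
theorem length_sel (f : ℕ → Prop) (i : ℕ) :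
    (sel f i).length = ((Finset.range i).filter f).card := by
  induction i with
  | zero => simp [sel]
  | succ i ih =>
    rw [Finset.range_add_one, Finset.filter_insert]
    by_cases h : f i
    · simp [sel, h, ih]
    · simp [sel, h, ih]

theorem length_sel_le (f : ℕ → Prop) (i : ℕ) : (sel f i).length ≤ i := by
  classical
  rw [length_sel]
  exact (Finset.card_filter_le _ _).trans (by simp)

/-- Inserting `k` at the head of its list. -/
theorem Chain.link {nx hd key : ℕ → ℕ} {f : ℕ → Prop} {K k : ℕ} (hf : f k)
    (h : ∀ v < K, Chain nx (hd v) (sel (fun j => key j = v ∧ f j) k)) :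
    ∀ v < K, Chain (Function.update nx k (hd (key k)))
      (Function.update hd (key k) (k + 1) v) (sel (fun j => key j = v ∧ f j) (k + 1)) := by
  intro v hv
  have hk : ∀ v, k ∉ sel (fun j => key j = v ∧ f j) k := fun v h' => by
    have := (mem_sel.mp h').1
    omega
  by_cases e : key k = v
  · subst e
    simp only [sel, hf, and_self, if_true, Function.update_self]
    refine ⟨rfl, ?_⟩
    rw [Function.update_self]
    exact (h _ hv).update (hk _)
  · rw [Function.update_of_ne (Ne.symm e)]
    simp only [sel, e, false_and, if_false]
    exact (h v hv).update (hk _)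

theorem Chain.skip {nx hd key : ℕ → ℕ} {f : ℕ → Prop} {K k : ℕ} (hf : ¬ f k)
    (h : ∀ v < K, Chain nx (hd v) (sel (fun j => key j = v ∧ f j) k)) :
    ∀ v < K, Chain nx (hd v) (sel (fun j => key j = v ∧ f j) (k + 1)) := by
  intro v hv
  simp only [sel, hf, and_false, if_false]
  exact h v hv

/-! ### The program -/

/-- The array of the tails of the edges, in direction `d`. -/
def srcA (d : Bool) : ℕ := cond d 5 4

/-- The array of the heads of the edges, in direction `d`. -/
def dstA (d : Bool) : ℕ := cond d 4 5

/-- The array of the search sets, in direction `d`. -/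
def matA (d : Bool) : ℕ := cond d 3 2

/-- The array of the shifts, negated for `d = true`. -/
def potA (d : Bool) : ℕ := cond d 7 0

/-- The array of the shifts of the new copies, negated for `d = true`. -/
def shiftA (d : Bool) : ℕ := cond d 9 8

section arrays
variable {d : Bool} {n : ℕ}

-- These facts let `simp` evaluate array accesses without splitting on the direction.
@[simp] theorem dstA_eq (h : 6 ≤ n) : (dstA d = n) = False := by
  cases d <;> simp [dstA] <;> omega

@[simp] theorem matA_eq (h : 4 ≤ n) : (matA d = n) = False := by
  cases d <;> simp [matA] <;> omega

@[simp] theorem potA_eq_four : (potA d = 4) = False := by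
  cases d <;> simp [potA]

@[simp] theorem shiftA_eq (h : n < 8) : (shiftA d = n) = False := by
  cases d <;> simp [shiftA] <;> omega

@[simp] theorem eq_shiftA (h : n < 8) : (n = shiftA d) = False := by
  cases d <;> simp [shiftA] <;> omega

end arrays

/-- A command without effect. -/
def nop : Cmd := .const 30 0

@[simp] theorem runs_nop {w : ℕ} {s : State} {Q : State → ℕ → Prop} :
    Runs w nop s Q ↔ Q (s.setN 30 0) 1 := by
  simp [nop]

/-- Constants, the negated shifts, and numbers for two new copies of every base vertex. -/
def setup : Cmd :=
  .seq (.const 5 1) <| .seq (.const 6 0) <| .seq (.const 4 0) <| .seq (.add 7 1 1) <|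
  .seq (.mul 8 1 1) <| .seq (.rzero 0) (.const 3 0)

/-- Array 7 receives the negated shifts. A base vertex gets two consecutive numbers: the first, kept
in array 11, is its copy for the forward phase, the second its copy for the backward phase. Array 6
records the base vertex of each number. -/
def numberBody : Cmd :=
  .seq (.rload 1 0 10) <| .seq (.rsub 1 0 1) <| .seq (.rstore 7 10 1) <| .seq (.load 11 0 10) <|
  .ite (.eq 11 10)
    (.seq (.store 11 10 3) <| .seq (.store 6 3 10) <| .seq (.add 3 3 5) <|
      .seq (.store 6 3 10) (.add 3 3 5))
    nop

/-- The memory is arbitrary at the start, and the second phase reuses these arrays: counts (10),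
heads of the two families of lists (13, 15) and the flags of initialized shifts (17). Classes and
links need no clearing, being written before they are read. -/
def clearBody : Cmd :=
  .seq (.store 10 10 6) <| .seq (.store 13 10 6) <| .seq (.store 15 10 6) (.store 17 10 6)

/-- Count the vertices of the search sets. -/
def countBody (d : Bool) : Cmd :=
  .seq (.div 11 10 1) <| .seq (.load 12 10 11) <| .seq (.load 13 (matA d) 10) <|
  .seq (.add 12 12 13) (.store 10 11 12)

/-- Classify the edges: `0` not imaginary, `1` to be treated directly, `2` to be led to a copy. -/
def classBody (d : Bool) : Cmd :=
  .seq (.load 11 (srcA d) 10) <| .seq (.load 12 (dstA d) 10) <| .seq (.rload 1 2 10) <|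
  .seq (.const 15 0) <| .seq
    (.ite (.rlt 1 0)
      (.ite (.lt 12 1)
        (.ite (.lt 11 1) nop
          (.seq (.sub 13 11 1) <| .seq (.load 14 10 13) <| .seq (.mul 16 14 14) <|
            .seq (.mul 16 16 14) <| .ite (.lt 16 8) (.const 15 2) (.const 15 1)))
        (.const 15 1))
      nop)
    (.store 12 10 15)

/-- Lists of the edges at each tail. -/
def linkBody (d : Bool) : Cmd :=
  .seq (.load 11 (srcA d) 10) <| .seq (.load 13 13 11) <| .seq (.store 14 10 13) <|
  .seq (.add 13 10 5) (.store 13 11 13)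

/-- The shifts of the new copies. -/
def shiftBody (d : Bool) : Cmd :=
  .seq (.load 15 12 10) <| .seq (.const 16 2) <| .ite (.eq 15 16)
    (.seq (.load 12 (dstA d) 10) <| .seq (.rload 1 2 10) <| .seq (.rload 2 (potA d) 12) <|
      .seq (.rsub 2 2 1) <| .seq (.load 14 0 12) <| .seq (.load 13 17 14) <|
      .ite (.eq 13 6)
        (.seq (.store 17 14 5) (.rstore (shiftA d) 14 2))
        (.seq (.rload 3 (shiftA d) 14) <|
          .ite (.rlt 3 2) (.rstore (shiftA d) 14 2) nop))
    nop

/-- Output the edges that are not imaginary and those out of the new copies; list the edges at each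
tail that have no counterpart at the new copy. -/
def lowBody (d : Bool) : Cmd :=
  .seq (.load 11 (srcA d) 10) <| .seq (.load 12 (dstA d) 10) <| .seq (.rload 1 2 10) <|
  .seq (.load 15 12 10) <| .seq (.ite (.eq 15 6) (emit d 11 12 1) nop) <|
  .ite (.lt 11 1)
    (.seq (.load 14 0 11) <| .seq (.rload 2 (potA d) 11) <| .seq (.radd 2 1 2) <|
      .seq (.rload 3 (shiftA d) 14) <| .seq (.rsub 2 2 3) <|
      .ite (.rlt 2 0)
        (.seq (.load 13 15 11) <| .seq (.store 16 10 13) <| .seq (.add 13 10 5) (.store 15 11 13))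
        (.seq (.load 13 11 14) <| .seq (.add 13 13 9) (emit d 13 12 2)))
    nop

/-- Output the shortcuts of an edge with the edges of a list. -/
def scan (d : Bool) (nx : ℕ) : Cmd :=
  .while (.lt 6 13)
    (.seq (.sub 16 13 5) <| .seq (.rload 2 2 16) <| .seq (.radd 2 1 2) <|
      .seq (.load 14 (dstA d) 16) <| .seq (.ite (.rlt 2 0) nop (emit d 11 14 2))
      (.load 13 nx 16))

/-- An edge of class 1 meets all edges at its head. An edge of class 2 is redirected to the new copy
and meets only the low edges at its head. -/
def pairBody (d : Bool) : Cmd :=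
  .seq (.load 11 (srcA d) 10) <| .seq (.load 12 (dstA d) 10) <| .seq (.rload 1 2 10) <|
  .seq (.load 15 12 10) <| .ite (.eq 15 5)
    (.seq (.load 13 13 12) (scan d 14))
    (.ite (.eq 15 6) nop
      (.seq (.load 14 0 12) <| .seq (.rload 2 (potA d) 12) <| .seq (.rsub 2 1 2) <|
        .seq (.rload 3 (shiftA d) 14) <| .seq (.radd 2 2 3) <| .seq (.load 13 11 14) <|
        .seq (.add 13 13 9) <| .seq (emit d 11 13 2) <| .seq (.load 13 15 12) (scan d 16)))

/-- One direction: `d = false` treats paths whose first edge is imaginary, `d = true` those whose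
second edge is. -/
def phase (d : Bool) : Cmd :=
  .seq (.add 9 7 (cond d 5 6)) <| .seq (loop 10 7 clearBody) <| .seq (loop 10 8 (countBody d)) <|
  .seq (loop 10 2 (classBody d)) <| .seq (loop 10 2 (linkBody d)) <|
  .seq (loop 10 2 (shiftBody d)) <| .seq (loop 10 2 (lowBody d)) (loop 10 2 (pairBody d))

/-- Output the shifts of the new copies. -/
def finishBody : Cmd :=
  .seq (.load 11 0 10) <| .ite (.eq 11 10)
    (.seq (.load 12 11 10) <| .seq (.rload 1 8 10) <| .seq (.rstore 3 12 1) <|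
      .seq (.add 12 12 5) <| .seq (.rload 1 9 10) <| .seq (.rsub 1 0 1) (.rstore 3 12 1))
    nop

def program : Cmd :=
  .seq setup <| .seq (loop 10 1 numberBody) <| .seq (phase false) <| .seq (phase true)
    (loop 10 1 finishBody)


/-! ### Correctness and running time of the loops -/

/-- The memory contents a phase works on, in the direction of the phase. -/
structure Inst where
  m : ℕ
  M : ℕ
  off : ℕ
  src : ℕ → ℕ
  dst : ℕ → ℕ
  base : ℕ → ℕ
  idx : ℕ → ℕ
  cnt : ℕ → ℕ
  wt : ℕ → ℝ
  P : ℕ → ℝ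

namespace Inst
variable (G : Inst)

/-- The class of an edge: `0` not imaginary, `1` treated directly, `2` led to a copy. -/
noncomputable def cls (i : ℕ) : ℕ :=
  if G.wt i < 0 then
    if G.dst i < G.m then
      if G.src i < G.m then 0
      else if G.cnt (G.src i - G.m) * G.cnt (G.src i - G.m) * G.cnt (G.src i - G.m) < G.m * G.m
        then 2 else 1
    else 1
  else 0

/-- The number of the new copy of `v`. -/
def copy (v : ℕ) : ℕ := G.idx (G.base v) + G.off

/-- The memory `s` holds the data. -/
structure Holds (d : Bool) (s : State) : Prop where
  nv1 : s.nv 1 = G.m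
  nv2 : s.nv 2 = G.M
  nv5 : s.nv 5 = 1
  nv6 : s.nv 6 = 0
  nv7 : s.nv 7 = 2 * G.m
  nv8 : s.nv 8 = G.m * G.m
  nv9 : s.nv 9 = G.off
  rv0 : s.rv 0 = 0
  src : s.na (srcA d) = G.src
  dst : s.na (dstA d) = G.dst
  base : s.na 0 = G.base
  idx : s.na 11 = G.idx
  cnt : s.na 10 = G.cnt
  wt : s.ra 2 = G.wt
  P : s.ra (potA d) = G.P

/-- The data are in range, and no overflows occur. -/
structure InRange (w : ℕ) : Prop where
  dst_lt : ∀ i < G.M, G.dst i < 2 * G.m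
  base_lt : ∀ v < G.m, G.base v < G.m
  M_lt : G.M + 1 < 2 ^ w
  three_lt : 3 < 2 ^ w
  cnt_lt : ∀ i < G.M, G.m ≤ G.src i → G.cnt (G.src i - G.m) * G.cnt (G.src i - G.m) *
    G.cnt (G.src i - G.m) < 2 ^ w
  copy_lt : ∀ v < G.m, G.copy v < 2 ^ w

end Inst

/-- Programs that respect the data of a phase. -/
structure Quiet (p : Cmd) : Prop where
  nv : ∀ x, p.modN x → x = 3 ∨ x = 4 ∨ 10 ≤ x
  rv : ∀ x, p.modR x → x ≠ 0
  na : ∀ a, p.modNA a → a = 7 ∨ a = 8 ∨ 12 ≤ a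
  ra : ∀ a, p.modRA a → a = 4 ∨ a = 8 ∨ a = 9

/-- The data of a phase live in cells with small numbers that the loops do not write, so the
numerical condition `Quiet` on the footprint suffices. -/
theorem Inst.Holds.frame {G : Inst} {d : Bool} {p : Cmd} {s s' : State} (h : G.Holds d s)
    (hf : Frame p s s') (hp : Quiet p) : G.Holds d s' := by
  have e1 : ∀ x, x ≠ 3 → x ≠ 4 → x < 10 → s'.nv x = s.nv x := fun x h1 h2 h3 =>
    hf.nv x fun hx => by have := hp.nv x hx; omega
  have e2 : ∀ a, a < 12 → a ≠ 7 → a ≠ 8 → s'.na a = s.na a := fun x h1 h2 h3 =>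
    hf.na x fun hx => by have := hp.na x hx; omega
  have e3 : ∀ a, a ≠ 4 → a ≠ 8 → a ≠ 9 → s'.ra a = s.ra a := fun x h1 h2 h3 =>
    hf.ra x fun hx => by have := hp.ra x hx; omega
  have e4 : s'.rv 0 = s.rv 0 := hf.rv 0 fun hx => hp.rv 0 hx rfl
  have e5 : srcA d < 6 ∧ dstA d < 6 ∧ potA d ≠ 4 ∧ potA d ≠ 8 ∧ potA d ≠ 9 := by
    cases d <;> decide
  obtain ⟨e5, e6, e7, e8, e9⟩ := e5
  constructor
  · rw [e1 _ (by decide) (by decide) (by decide), h.nv1]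
  · rw [e1 _ (by decide) (by decide) (by decide), h.nv2]
  · rw [e1 _ (by decide) (by decide) (by decide), h.nv5]
  · rw [e1 _ (by decide) (by decide) (by decide), h.nv6]
  · rw [e1 _ (by decide) (by decide) (by decide), h.nv7]
  · rw [e1 _ (by decide) (by decide) (by decide), h.nv8]
  · rw [e1 _ (by decide) (by decide) (by decide), h.nv9]
  · rw [e4, h.rv0]
  · rw [e2 _ (by omega) (by omega) (by omega), h.src]
  · rw [e2 _ (by omega) (by omega) (by omega), h.dst]
  · rw [e2 _ (by decide) (by decide) (by decide), h.base]
  · rw [e2 _ (by decide) (by decide) (by decide), h.idx]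
  · rw [e2 _ (by decide) (by decide) (by decide), h.cnt]
  · rw [e3 _ (by decide) (by decide) (by decide), h.wt]
  · rw [e3 _ e7 e8 e9, h.P]

theorem quiet_class (d : Bool) : Quiet (loop 10 2 (classBody d)) := by
  constructor <;> intro x hx <;>
    simp [loop, classBody, nop, Cmd.modN, Cmd.modR, Cmd.modNA, Cmd.modRA] at hx <;> omega

theorem quiet_link (d : Bool) : Quiet (loop 10 2 (linkBody d)) := by
  constructor <;> intro x hx <;>
    simp [loop, linkBody, Cmd.modN, Cmd.modR, Cmd.modNA, Cmd.modRA] at hx <;> omega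

theorem quiet_shift (d : Bool) : Quiet (loop 10 2 (shiftBody d)) := by
  cases d <;> constructor <;> intro x hx <;>
    simp [loop, shiftBody, nop, shiftA, Cmd.modN, Cmd.modR, Cmd.modNA, Cmd.modRA] at hx <;> omega

theorem quiet_low (d : Bool) : Quiet (loop 10 2 (lowBody d)) := by
  cases d <;> constructor <;> intro x hx <;>
    simp [loop, lowBody, emit, nop, shiftA, Cmd.modN, Cmd.modR, Cmd.modNA, Cmd.modRA] at hx <;> omega

theorem quiet_pair (d : Bool) : Quiet (loop 10 2 (pairBody d)) := by
  cases d <;> constructor <;> intro x hx <;>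
    simp [loop, pairBody, scan, emit, nop, Cmd.modN, Cmd.modR, Cmd.modNA, Cmd.modRA] at hx <;>
    omega


namespace Inst
variable (G : Inst) (D : ℕ → ℝ)

/-- The weight of the edge at the new copy that corresponds to the edge `j`. -/
noncomputable def copyWt (j : ℕ) : ℝ := G.wt j + G.P (G.src j) - D (G.base (G.src j))

/-- The edge `j` has no counterpart at the new copy. -/
def IsLow (j : ℕ) : Prop := G.src j < G.m ∧ G.copyWt D j < 0

/-- The edges output for `j` by `lowBody`. -/
def lowEdges (j : ℕ) : Set (ℕ × ℕ × ℝ) :=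
  {e | (G.cls j = 0 ∧ e = (G.src j, G.dst j, G.wt j)) ∨
    (G.src j < G.m ∧ 0 ≤ G.copyWt D j ∧ e = (G.copy (G.src j), G.dst j, G.copyWt D j))}

/-- The indices of the edges that `pairBody` combines with the edge `i`. -/
noncomputable def partners (i : ℕ) : List ℕ :=
  if G.cls i = 1 then sel (fun j => G.src j = G.dst i ∧ True) G.M
  else if G.cls i = 2 then sel (fun j => G.src j = G.dst i ∧ G.IsLow D j) G.M
  else []

/-- The edges output for `i` by `pairBody`. -/
def pairEdges (i : ℕ) : Set (ℕ × ℕ × ℝ) :=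
  {e | (G.cls i = 2 ∧
      e = (G.src i, G.copy (G.dst i), G.wt i - G.P (G.dst i) + D (G.base (G.dst i)))) ∨
    ∃ j ∈ G.partners D i, 0 ≤ G.wt i + G.wt j ∧ e = (G.src i, G.dst j, G.wt i + G.wt j)}

/-- `D` is the largest value of `P v - wt i`, over the edges `i` of class `2` to a vertex `v`, in every
group of copies to which there is such an edge. -/
def IsShift : Prop :=
  ∀ i < G.M, G.cls i = 2 → G.P (G.dst i) - G.wt i ≤ D (G.base (G.dst i)) ∧
    ∃ i' < G.M, G.cls i' = 2 ∧ G.base (G.dst i') = G.base (G.dst i) ∧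
      D (G.base (G.dst i)) = G.P (G.dst i') - G.wt i'

variable {G D}

theorem cls_lt (i : ℕ) : G.cls i < 3 := by
  unfold cls
  split_ifs <;> omega

theorem dst_lt_of_cls {i : ℕ} (h : G.cls i = 2) : G.dst i < G.m := by
  unfold cls at h
  split_ifs at h <;> first | assumption | omega

end Inst

/-! ### Correctness and cost of single loop bodies -/

section bodies
variable {w : ℕ} {G : Inst} {d : Bool} {s : State} {k : ℕ}

theorem runs_classBody (hG : G.Holds d s) (hR : G.InRange w) (hk : k < G.M)
    (h10 : s.nv 10 = k) :
    Runs w (classBody d) s fun s' t => t ≤ 15 ∧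
      s'.na 12 = Function.update (s.na 12) k (G.cls k) := by
  unfold classBody
  have h0 : 2 % 2 ^ w = 2 := Nat.mod_eq_of_lt (by have := hR.three_lt; omega)
  have h1 : 1 % 2 ^ w = 1 := Nat.mod_eq_of_lt (by have := hR.three_lt; omega)
  have hc := hR.cnt_lt k hk
  by_cases h2 : G.wt k < 0
  · by_cases h3 : G.dst k < G.m
    · by_cases h4 : G.src k < G.m
      · simp [h10, hG.nv1, hG.src, hG.dst, hG.wt, hG.rv0,
          Inst.cls, h2, h3, h4]
      · have h5 := hc (by omega)
        by_cases h7 : G.cnt (G.src k - G.m) * G.cnt (G.src k - G.m) * G.cnt (G.src k - G.m)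
            < G.m * G.m <;>
        simp [h10, hG.nv1, hG.nv8, hG.src, hG.dst, hG.wt, hG.rv0,
          hG.cnt, Inst.cls, h0, h1, h2, h3, h4, h7, Nat.mod_eq_of_lt h5]
    · simp [h10, hG.nv1, hG.src, hG.dst, hG.wt, hG.rv0,
          Inst.cls, h1, h2, h3]
  · simp [h10, hG.nv1, hG.src, hG.dst, hG.wt, hG.rv0,
          Inst.cls, h2]

theorem runs_linkBody (hG : G.Holds d s) (hR : G.InRange w) (hk : k < G.M) (h10 : s.nv 10 = k) :
    Runs w (linkBody d) s fun s' t => t ≤ 5 ∧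
      s'.na 14 = Function.update (s.na 14) k (s.na 13 (G.src k)) ∧
      s'.na 13 = Function.update (s.na 13) (G.src k) (k + 1) := by
  unfold linkBody
  have h1 : (k + 1) % 2 ^ w = k + 1 := Nat.mod_eq_of_lt (by have := hR.M_lt; omega)
  simp [h10, hG.src, hG.nv5, h1]

/-- The running maximum starts from arbitrary memory. Array 17 tells whether a first value has been
stored, after which `max` applies. -/
theorem runs_shiftBody (hG : G.Holds d s) (hR : G.InRange w) (h10 : s.nv 10 = k)
    (hc : s.na 12 k = G.cls k) :
    Runs w (shiftBody d) s fun s' t => t ≤ 13 ∧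
      (G.cls k ≠ 2 → s'.na 17 = s.na 17 ∧ s'.ra (shiftA d) = s.ra (shiftA d)) ∧
      (G.cls k = 2 → s'.na 17 = Function.update (s.na 17) (G.base (G.dst k)) 
          (if s.na 17 (G.base (G.dst k)) = 0 then 1 else s.na 17 (G.base (G.dst k))) ∧
        s'.ra (shiftA d) = Function.update (s.ra (shiftA d)) (G.base (G.dst k))
          (if s.na 17 (G.base (G.dst k)) = 0 then G.P (G.dst k) - G.wt k
            else max (s.ra (shiftA d) (G.base (G.dst k))) (G.P (G.dst k) - G.wt k))) := by
  unfold shiftBody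
  have h0 : 2 % 2 ^ w = 2 := Nat.mod_eq_of_lt (by have := hR.three_lt; omega)
  by_cases h2 : G.cls k = 2
  · by_cases h3 : s.na 17 (G.base (G.dst k)) = 0
    · simp [h10, hG.dst, hG.wt, hG.base, hG.P, hG.nv5, hG.nv6, hc, h0, h2, h3]
    · by_cases h4 : s.ra (shiftA d) (G.base (G.dst k)) < G.P (G.dst k) - G.wt k
      · simp [h10, hG.dst, hG.wt, hG.base, hG.P, hG.nv5, hG.nv6, hc, h0, h2, h3, h4,
          max_eq_right h4.le]
        intro h
        linarith
      · simp [h10, hG.dst, hG.wt, hG.base, hG.P, hG.nv5, hG.nv6, hc, h0, h2, h3, h4,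
          max_eq_left (not_lt.mp h4)]
  · simp [h10, hc, h0, h2]

-- At most two edges are emitted, the edge itself and its counterpart at the new copy, so the output
-- counter needs room for 2. A low edge has no counterpart and is put at the head of the low list of
-- its tail instead.
set_option maxHeartbeats 1000000 in
theorem runs_lowBody {D : ℕ → ℝ} (hG : G.Holds d s) (hR : G.InRange w) (hk : k < G.M)
    (h10 : s.nv 10 = k) (hc : s.na 12 k = G.cls k) (hD : s.ra (shiftA d) = D)
    (h4 : s.nv 4 + 2 < 2 ^ w) :
    Runs w (lowBody d) s fun s' t => t ≤ 22 ∧ s'.nv 4 ≤ s.nv 4 + 2 ∧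
      s'.out = s.out ∪ orient d '' G.lowEdges D k ∧
      (¬ G.IsLow D k → s'.na 15 = s.na 15 ∧ s'.na 16 = s.na 16) ∧
      (G.IsLow D k → s'.na 16 = Function.update (s.na 16) k (s.na 15 (G.src k)) ∧
        s'.na 15 = Function.update (s.na 15) (G.src k) (k + 1)) := by
  unfold lowBody
  have h1 : (k + 1) % 2 ^ w = k + 1 := Nat.mod_eq_of_lt (by have := hR.M_lt; omega)
  have h4' : s.nv 4 + 1 < 2 ^ w := by omega
  have h4'' : s.nv 4 + 1 + 1 < 2 ^ w := by omega
  by_cases h2 : G.src k < G.m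
  · have h5 : (G.idx (G.base (G.src k)) + G.off) % 2 ^ w = G.copy (G.src k) :=
      Nat.mod_eq_of_lt (hR.copy_lt _ h2)
    have e : G.wt k + G.P (G.src k) - D (G.base (G.src k)) = G.copyWt D k := rfl
    rcases lt_or_ge (G.copyWt D k) 0 with h3 | h3
    · by_cases h0 : G.cls k = 0
      · have e0 : G.lowEdges D k = {(G.src k, G.dst k, G.wt k)} := by
          ext f; simp [Inst.lowEdges, h0, h2, not_le.mpr h3]
        simp [runs_emit, State.emit_na, State.emit_ra, h10, hG.src, hG.dst, hG.wt,
          hG.base, hG.P, hG.nv1, hG.nv5, hG.nv6, hG.rv0, hc, hD, h1, h2, e, h3, h0,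
          h4', Inst.IsLow, e0]
      · have e0 : G.lowEdges D k = ∅ := by
          ext f; simp [Inst.lowEdges, h0, h2, not_le.mpr h3]
        simp [h10, hG.src, hG.dst, hG.wt,
          hG.base, hG.P, hG.nv1, hG.nv5, hG.nv6, hG.rv0, hc, hD, h1, h2, e, h3, h0,
          Inst.IsLow, e0]
    · by_cases h0 : G.cls k = 0
      · have e0 : G.lowEdges D k = {(G.copy (G.src k), G.dst k, G.copyWt D k),
            (G.src k, G.dst k, G.wt k)} := by
          ext f; simp [Inst.lowEdges, h0, h2, h3, or_comm]
        simp [runs_emit, State.emit_na, State.emit_ra, h10, hG.src, hG.dst, hG.wt,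
          hG.base, hG.P, hG.nv1, hG.nv5, hG.nv6, hG.nv9, hG.rv0, hG.idx, hc, hD, h2, e, not_lt.mpr h3,
          h3, h0, h4', h4'', h5, Inst.IsLow, e0, Set.image_insert_eq, Set.union_insert]
      · have e0 : G.lowEdges D k = {(G.copy (G.src k), G.dst k, G.copyWt D k)} := by
          ext f; simp [Inst.lowEdges, h0, h2, h3]
        simp [runs_emit, State.emit_na, State.emit_ra, h10, hG.src, hG.dst, hG.wt,
          hG.base, hG.P, hG.nv1, hG.nv5, hG.nv6, hG.nv9, hG.rv0, hG.idx, hc, hD, h2, e, not_lt.mpr h3,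
          h3, h0, h4', h5, Inst.IsLow, e0]
  · by_cases h0 : G.cls k = 0
    · have e0 : G.lowEdges D k = {(G.src k, G.dst k, G.wt k)} := by
        ext f; simp [Inst.lowEdges, h0, h2]
      simp [runs_emit, State.emit_na, State.emit_ra, h10, hG.src, hG.dst, hG.wt,
        hG.nv1, hG.nv5, hG.nv6, hc, h2, h0, h4', e0, Inst.IsLow]
    · have e0 : G.lowEdges D k = ∅ := by
        ext f; simp [Inst.lowEdges, h0, h2]
      simp [h10, hG.src, hG.dst, hG.wt,
        hG.nv1, hG.nv5, hG.nv6, hc, h2, h0, e0, Inst.IsLow]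

end bodies

section bodies
variable {w : ℕ} {G : Inst} {d : Bool} {s : State} {k : ℕ}

/-- The shortcuts of an edge from `a` of weight `x` with the edges in the list `l`. -/
def Inst.shortcuts (G : Inst) (a : ℕ) (x : ℝ) (l : List ℕ) : Set (ℕ × ℕ × ℝ) :=
  {e | ∃ j ∈ l, 0 ≤ x + G.wt j ∧ e = (a, G.dst j, x + G.wt j)}

/-- Induction along the stored list. Pointers are shifted by one, so 0 marks the end and the test `0
< pointer` ends the loop; a round costs at most 10 steps and its test. Emitting writes only to
arrays 7 and 8, hence not to the links. -/
theorem runs_scan {nx : ℕ} (h12 : 12 ≤ nx) : ∀ (l : List ℕ) {s : State}, s.nv 5 = 1 → s.nv 6 = 0 →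
    s.rv 0 = 0 → s.na (dstA d) = G.dst → s.ra 2 = G.wt → Chain (s.na nx) (s.nv 13) l →
    s.nv 4 + l.length < 2 ^ w →
    Runs w (scan d nx) s fun s' t => t ≤ 1 + 11 * l.length ∧ s'.nv 4 ≤ s.nv 4 + l.length ∧
      s'.out = s.out ∪ orient d '' G.shortcuts (s.nv 11) (s.rv 1) l
  | [], s, h5, h6, h0, hd, hw, hc, h4 => by
    refine ⟨s, 1, .while_false ?_, by simp, by simp, by simp [Inst.shortcuts]⟩
    simp [h6, show s.nv 13 = 0 from hc]
  | j :: l, s, h5, h6, h0, hd, hw, hc, h4 => by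
    obtain ⟨h13, hc⟩ := hc
    have h7 : nx ≠ 7 := by omega
    have h8 : nx ≠ 8 := by omega
    rw [List.length_cons] at h4 ⊢
    have h4' : s.nv 4 + 1 < 2 ^ w := by omega
    have hb : Runs w (.seq (.sub 16 13 5) <| .seq (.rload 2 2 16) <| .seq (.radd 2 1 2) <|
        .seq (.load 14 (dstA d) 16) <| .seq (.ite (.rlt 2 0) nop (emit d 11 14 2))
        (.load 13 nx 16)) s fun s' t => t ≤ 10 ∧ s'.nv 4 ≤ s.nv 4 + 1 ∧ s'.nv 5 = 1 ∧ s'.nv 6 = 0 ∧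
          s'.rv 0 = 0 ∧ s'.na (dstA d) = G.dst ∧ s'.ra 2 = G.wt ∧ s'.na nx = s.na nx ∧
          s'.nv 13 = s.na nx j ∧ s'.nv 11 = s.nv 11 ∧ s'.rv 1 = s.rv 1 ∧
          s'.out = s.out ∪ orient d '' G.shortcuts (s.nv 11) (s.rv 1) [j] := by
      rcases lt_or_ge (s.rv 1 + G.wt j) 0 with h3 | h3
      · have e0 : G.shortcuts (s.nv 11) (s.rv 1) [j] = ∅ := by
          ext f; simp [Inst.shortcuts, not_le.mpr h3]
        simp [h13, h5, h6, hd, hw, h0, h3, e0]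
      · have e0 : G.shortcuts (s.nv 11) (s.rv 1) [j] =
            {(s.nv 11, G.dst j, s.rv 1 + G.wt j)} := by
          ext f; simp [Inst.shortcuts, h3]
        simp [h13, h5, h6, hd, hw, h0, not_lt.mpr h3, e0, runs_emit, h4', State.emit_na,
          State.emit_ra, h7, h8]
    obtain ⟨s₁, t₁, he₁, ht₁, k4, k5, k6, k0, kd, kw, kn, k13, k11, k1, ko⟩ := hb
    obtain ⟨s₂, t₂, he₂, ht₂, m4, mo⟩ := runs_scan h12 l k5 k6 k0 kd kw (by rwa [kn, k13])
      (by omega)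
    refine ⟨s₂, _, .while_true ?_ he₁ he₂, by omega, by omega, ?_⟩
    · simp [h6, h13]
    · rw [mo, ko, k11, k1, Set.union_assoc, ← Set.image_union]
      congr 2
      ext f
      simp [Inst.shortcuts]

theorem pairEdges_eq (D : ℕ → ℝ) (k : ℕ) : G.pairEdges D k =
    {e | G.cls k = 2 ∧
      e = (G.src k, G.copy (G.dst k), G.wt k - G.P (G.dst k) + D (G.base (G.dst k)))} ∪
    G.shortcuts (G.src k) (G.wt k) (G.partners D k) := rfl

/-- The only edge emitted besides the shortcuts is the redirected one, and there are at most `G.M`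
partners; hence the room for `G.M + 1` edges. -/
theorem runs_pairBody {D : ℕ → ℝ} (hG : G.Holds d s) (hR : G.InRange w) (hk : k < G.M)
    (h10 : s.nv 10 = k) (hc : s.na 12 k = G.cls k) (hD : s.ra (shiftA d) = D)
    (h4 : s.nv 4 + (G.M + 1) < 2 ^ w)
    (hl : ∀ v < 2 * G.m, Chain (s.na 14) (s.na 13 v) (sel (fun j => G.src j = v ∧ True) G.M))
    (hll : ∀ v < G.m, Chain (s.na 16) (s.na 15 v) (sel (fun j => G.src j = v ∧ G.IsLow D j) G.M)) :
    Runs w (pairBody d) s fun s' t => t ≤ 20 + 11 * (G.partners D k).length ∧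
      s'.nv 4 ≤ s.nv 4 + (G.M + 1) ∧
      s'.out = s.out ∪ orient d '' G.pairEdges D k := by
  have h4' : s.nv 4 + 1 < 2 ^ w := by omega
  rw [pairEdges_eq]
  unfold pairBody
  have hlen : (G.partners D k).length ≤ G.M := by
    unfold Inst.partners
    split_ifs <;> simp [length_sel_le]
  by_cases h1 : G.cls k = 1
  · have hp : G.partners D k = sel (fun j => G.src j = G.dst k ∧ True) G.M := by
      simp [Inst.partners, h1]
    simp only [runs_seq, runs_load, runs_rload, runs_ite, Cond.Holds]
    simp [h10, hG.src, hG.dst, hG.wt, hG.nv5, hc, h1]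
    refine (runs_scan (G := G) (by decide) (G.partners D k) (by simp [hG.nv5]) (by simp [hG.nv6])
      (by simp [hG.rv0]) (by simp [hG.dst]) (by simp [hG.wt]) ?_ (by simp; omega)).mono ?_
    · simpa [hp] using hl _ (hR.dst_lt k hk)
    · rintro s' t - ⟨ht, h, ho⟩
      refine ⟨by omega, by simp at h; omega, by simpa using ho⟩
  by_cases h0 : G.cls k = 0
  · have hp : G.partners D k = [] := by
      simp [Inst.partners, h0]
    simp [h10, hG.src, hG.dst, hG.wt, hG.nv5, hG.nv6, hc, h0, hp, Inst.shortcuts]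
  have h2 : G.cls k = 2 := by
    have := G.cls_lt k
    omega
  have hp : G.partners D k = sel (fun j => G.src j = G.dst k ∧ G.IsLow D j) G.M := by
    simp [Inst.partners, h2]
  have hd := G.dst_lt_of_cls h2
  have h5 : (G.idx (G.base (G.dst k)) + G.off) % 2 ^ w = G.copy (G.dst k) :=
    Nat.mod_eq_of_lt (hR.copy_lt _ hd)
  simp [h10, hG.src, hG.dst, hG.wt, hG.base, hG.idx, hG.P, hG.nv5, hG.nv6, hG.nv9, hc, h2, hD,
    runs_emit, h4', State.emit_na, h5]
  refine (runs_scan (G := G) (by decide) (G.partners D k) (by simp [hG.nv5]) (by simp [hG.nv6])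
    (by simp [hG.rv0]) (by simp [hG.dst, State.emit_na]) (by simp [hG.wt, State.emit_ra]) ?_
    (by simp; omega)).mono ?_
  · simpa [hp, State.emit_na] using hll _ hd
  · rintro s' t - ⟨ht, h, ho⟩
    refine ⟨by omega, by simp at h; omega, ?_⟩
    simp only [State.setN_nv, State.emit_nv, State.emit_rv, State.setR_rv, State.setN_rv,
      State.setR_nv] at ho
    simp at ho
    rw [ho]
    simp [Set.image_insert_eq, Set.union_insert, Set.insert_union]

theorem runs_clearBody (h6 : s.nv 6 = 0) (h10 : s.nv 10 = k) :
    Runs w clearBody s fun s' t => t ≤ 4 ∧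
      s'.na 10 = Function.update (s.na 10) k 0 ∧ s'.na 13 = Function.update (s.na 13) k 0 ∧
      s'.na 15 = Function.update (s.na 15) k 0 ∧ s'.na 17 = Function.update (s.na 17) k 0 := by
  unfold clearBody
  simp [h6, h10]

theorem runs_countBody (h10 : s.nv 10 = k) :
    Runs w (countBody d) s fun s' t => t ≤ 5 ∧
      s'.na 10 = Function.update (s.na 10) (k / s.nv 1)
        ((s.na 10 (k / s.nv 1) + s.na (matA d) k) % 2 ^ w) := by
  unfold countBody
  simp [h10]

theorem runs_numberBody (h10 : s.nv 10 = k) (h0 : s.rv 0 = 0) (h5 : s.nv 5 = 1)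
    (h3 : s.nv 3 + 2 < 2 ^ w) :
    Runs w numberBody s fun s' t => t ≤ 10 ∧
      s'.ra 7 = Function.update (s.ra 7) k (- s.ra 0 k) ∧
      (s.na 0 k ≠ k → s'.nv 3 = s.nv 3 ∧ s'.na 6 = s.na 6 ∧ s'.na 11 = s.na 11) ∧
      (s.na 0 k = k → s'.nv 3 = s.nv 3 + 2 ∧
        s'.na 6 = Function.update (Function.update (s.na 6) (s.nv 3) k) (s.nv 3 + 1) k ∧
        s'.na 11 = Function.update (s.na 11) k (s.nv 3)) := by
  have h1 : (s.nv 3 + 1) % 2 ^ w = s.nv 3 + 1 := Nat.mod_eq_of_lt (by omega)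
  have h2 : (s.nv 3 + 1 + 1) % 2 ^ w = s.nv 3 + 1 + 1 := Nat.mod_eq_of_lt (by omega)
  unfold numberBody
  by_cases hb : s.na 0 k = k <;> simp [h10, h0, h5, hb, h1, h2]

theorem runs_finishBody (h10 : s.nv 10 = k) (h0 : s.rv 0 = 0) (h5 : s.nv 5 = 1)
    (h3 : s.na 0 k = k → s.na 11 k + 1 < 2 ^ w) :
    Runs w finishBody s fun s' t => t ≤ 10 ∧
      (s.na 0 k ≠ k → s'.ra 3 = s.ra 3) ∧
      (s.na 0 k = k → s'.ra 3 = Function.update (Function.update (s.ra 3) (s.na 11 k) (s.ra 8 k))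
        (s.na 11 k + 1) (- s.ra 9 k)) := by
  unfold finishBody
  by_cases hb : s.na 0 k = k
  · have h1 : (s.na 11 k + 1) % 2 ^ w = s.na 11 k + 1 := Nat.mod_eq_of_lt (h3 hb)
    simp [h10, h0, h5, hb, h1]
  · simp [h10, hb]

theorem runs_setup (h1 : 2 * s.nv 1 < 2 ^ w) (h2 : s.nv 1 * s.nv 1 < 2 ^ w) (h3 : 3 < 2 ^ w) :
    Runs w setup s fun s' t => t ≤ 7 ∧ s'.nv 5 = 1 ∧ s'.nv 6 = 0 ∧ s'.nv 4 = 0 ∧ s'.nv 3 = 0 ∧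
      s'.nv 7 = 2 * s.nv 1 ∧ s'.nv 8 = s.nv 1 * s.nv 1 ∧ s'.rv 0 = 0 := by
  unfold setup
  have h4 : 1 % 2 ^ w = 1 := Nat.mod_eq_of_lt (by omega)
  simp [Nat.mod_eq_of_lt h2, h4, ← two_mul, Nat.mod_eq_of_lt h1]

end bodies

/-- All edges output in one phase, in the direction of the phase. -/
def Inst.newEdges (G : Inst) (D : ℕ → ℝ) : Set (ℕ × ℕ × ℝ) :=
  {e | ∃ j < G.M, e ∈ G.lowEdges D j ∨ e ∈ G.pairEdges D j}

/-! ### The loops of a phase -/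

section loops
variable {w : ℕ} {G : Inst} {d : Bool} {s : State}

theorem runs_classLoop (hG : G.Holds d s) (hR : G.InRange w) :
    Runs w (loop 10 2 (classBody d)) s fun s' t => t ≤ 2 + G.M * 17 ∧
      ∀ i < G.M, s'.na 12 i = G.cls i := by
  refine (runs_loop (fun k s' => ∀ i < k, s'.na 12 i = G.cls i) (fun _ => 15) hG.nv2
    (by have := hR.M_lt; omega) hG.nv5 (by decide) (by decide) (by simp [classBody, nop, Cmd.modN])
    (by simp [classBody, nop, Cmd.modN]) (by simp [classBody, nop, Cmd.modN]) (by simp) ?_).mono ?_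
  · intro k hk s₁ hf h10 hI
    refine (runs_classBody (hG.frame hf (quiet_class d)) hR hk h10).mono ?_
    rintro s₂ t - ⟨ht, h⟩
    refine ⟨ht, fun i hi => ?_⟩
    rw [State.setN_na, h]
    by_cases e : i = k
    · rw [e, Function.update_self]
    · rw [Function.update_of_ne e, hI i (by omega)]
  · rintro s' t - ⟨ht, h⟩
    exact ⟨by simpa using ht, h⟩

theorem runs_linkLoop (hG : G.Holds d s) (hR : G.InRange w) (h0 : ∀ v < 2 * G.m, s.na 13 v = 0) :
    Runs w (loop 10 2 (linkBody d)) s fun s' t => t ≤ 2 + G.M * 7 ∧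
      ∀ v < 2 * G.m, Chain (s'.na 14) (s'.na 13 v) (sel (fun j => G.src j = v ∧ True) G.M) := by
  refine (runs_loop (fun k s' => ∀ v < 2 * G.m, Chain (s'.na 14) (s'.na 13 v)
      (sel (fun j => G.src j = v ∧ True) k)) (fun _ => 5) hG.nv2
    (by have := hR.M_lt; omega) hG.nv5 (by decide) (by decide) (by simp [linkBody, Cmd.modN])
    (by simp [linkBody, Cmd.modN]) (by simp [linkBody, Cmd.modN]) h0 ?_).mono ?_
  · intro k hk s₁ hf h10 hI
    refine (runs_linkBody (hG.frame hf (quiet_link d)) hR hk h10).mono ?_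
    rintro s₂ t - ⟨ht, h14, h13⟩
    refine ⟨ht, ?_⟩
    rw [State.setN_na, h13, h14]
    exact Chain.link trivial hI
  · rintro s' t - ⟨ht, h⟩
    exact ⟨by simpa using ht, h⟩

theorem runs_shiftLoop (hG : G.Holds d s) (hR : G.InRange w) (hc : ∀ i < G.M, s.na 12 i = G.cls i)
    (h0 : ∀ v < G.m, s.na 17 v = 0) :
    Runs w (loop 10 2 (shiftBody d)) s fun s' t => t ≤ 2 + G.M * 15 ∧
      G.IsShift (s'.ra (shiftA d)) := by
  -- The invariant has three parts: an unflagged group has received no edge of class 2, a flagged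
  -- group stores a value attained by such an edge, and the stored values dominate those of all
  -- edges seen. Groups that are never flagged keep an arbitrary value; `IsShift` makes no claim
  -- about them.
  refine (runs_loop (fun k s' => (∀ v < G.m, s'.na 17 v = 0 → ∀ i < k, G.cls i = 2 →
      G.base (G.dst i) ≠ v) ∧ (∀ v < G.m, s'.na 17 v ≠ 0 → ∃ i < k, G.cls i = 2 ∧
        G.base (G.dst i) = v ∧ s'.ra (shiftA d) v = G.P (G.dst i) - G.wt i) ∧
      ∀ i < k, G.cls i = 2 → G.P (G.dst i) - G.wt i ≤ s'.ra (shiftA d) (G.base (G.dst i)))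
    (fun _ => 13) hG.nv2
    (by have := hR.M_lt; omega) hG.nv5 (by decide) (by decide) (by simp [shiftBody, nop, Cmd.modN])
    (by simp [shiftBody, nop, Cmd.modN]) (by simp [shiftBody, nop, Cmd.modN]) ?_ ?_).mono ?_
  · exact ⟨by simp, fun v hv h => absurd (h0 v hv) h, by simp⟩
  · rintro k hk s₁ hf h10 ⟨hI1, hI2, hI3⟩
    have hc₁ : s₁.na 12 k = G.cls k := by
      rw [hf.na 12 (by simp [loop, shiftBody, nop, Cmd.modNA]), hc k hk]
    refine (runs_shiftBody (hG.frame hf (quiet_shift d)) hR h10 hc₁).mono ?_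
    rintro s₂ t - ⟨ht, h1, h2⟩
    refine ⟨ht, ?_⟩
    simp only [State.setN_na, State.setN_ra]
    by_cases hk2 : G.cls k = 2
    · obtain ⟨e1, e2⟩ := h2 hk2
      rw [e1, e2]
      refine ⟨fun v hv h i hi hi2 e => ?_, fun v hv h => ?_, fun i hi hi2 => ?_⟩
      · by_cases hv' : v = G.base (G.dst k)
        · rw [hv', Function.update_self] at h
          split_ifs at h
          omega
        · rw [Function.update_of_ne hv'] at h
          refine hI1 v hv h i ?_ hi2 e
          rcases Nat.lt_succ_iff_lt_or_eq.mp hi with h3 | rfl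
          · exact h3
          · exact absurd e.symm hv'
      · by_cases hv' : v = G.base (G.dst k)
        · subst hv'
          rw [Function.update_self]
          split_ifs with h3
          · exact ⟨k, by omega, hk2, rfl, rfl⟩
          · rcases max_cases (s₁.ra (shiftA d) (G.base (G.dst k))) (G.P (G.dst k) - G.wt k) with
              ⟨e, -⟩ | ⟨e, -⟩
            · obtain ⟨i, hi, hi2, h4, h5⟩ := hI2 _ hv h3
              exact ⟨i, by omega, hi2, h4, e.trans h5⟩
            · exact ⟨k, by omega, hk2, rfl, e⟩
        · rw [Function.update_of_ne hv'] at h ⊢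
          obtain ⟨i, hi, h4⟩ := hI2 _ hv h
          exact ⟨i, by omega, h4⟩
      · by_cases hv' : G.base (G.dst i) = G.base (G.dst k)
        · rw [hv', Function.update_self]
          have hb : G.base (G.dst k) < G.m := hR.base_lt _ (G.dst_lt_of_cls hk2)
          rcases Nat.lt_succ_iff_lt_or_eq.mp hi with h3 | rfl
          · split_ifs with h4
            · exact absurd hv' (hI1 _ hb h4 i h3 hi2)
            · exact (hv' ▸ hI3 i h3 hi2).trans (le_max_left _ _)
          · split_ifs with h4
            · exact le_rfl
            · exact le_max_right _ _
        · rw [Function.update_of_ne hv']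
          rcases Nat.lt_succ_iff_lt_or_eq.mp hi with h3 | rfl
          · exact hI3 i h3 hi2
          · exact absurd rfl hv'
    · obtain ⟨e1, e2⟩ := h1 hk2
      rw [e1, e2]
      refine ⟨fun v hv h i hi hi2 e => ?_, fun v hv h => ?_, fun i hi hi2 => ?_⟩
      · rcases Nat.lt_succ_iff_lt_or_eq.mp hi with h3 | rfl
        · exact hI1 v hv h i h3 hi2 e
        · exact hk2 hi2
      · obtain ⟨i, hi, h4⟩ := hI2 _ hv h
        exact ⟨i, by omega, h4⟩
      · rcases Nat.lt_succ_iff_lt_or_eq.mp hi with h3 | rfl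
        · exact hI3 i h3 hi2
        · exact absurd hi2 hk2
  · rintro s' t - ⟨ht, h1, h2, h3⟩
    refine ⟨by simpa using ht, fun i hi hi2 => ⟨h3 i hi hi2, ?_⟩⟩
    exact h2 _ (hR.base_lt _ (G.dst_lt_of_cls hi2)) fun h => h1 _
      (hR.base_lt _ (G.dst_lt_of_cls hi2)) h i hi hi2 rfl

theorem runs_lowLoop {D : ℕ → ℝ} (hG : G.Holds d s) (hR : G.InRange w)
    (hc : ∀ i < G.M, s.na 12 i = G.cls i) (hD : s.ra (shiftA d) = D)
    (h0 : ∀ v < G.m, s.na 15 v = 0) (h4 : s.nv 4 + G.M * 2 < 2 ^ w) :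
    Runs w (loop 10 2 (lowBody d)) s fun s' t => t ≤ 2 + G.M * 24 ∧
      s'.nv 4 ≤ s.nv 4 + G.M * 2 ∧
      s'.out = s.out ∪ orient d '' {e | ∃ j < G.M, e ∈ G.lowEdges D j} ∧
      ∀ v < G.m, Chain (s'.na 16) (s'.na 15 v) (sel (fun j => G.src j = v ∧ G.IsLow D j) G.M) := by
  refine (runs_loop (fun k s' => s'.nv 4 ≤ s.nv 4 + k * 2 ∧
      s'.out = s.out ∪ orient d '' {e | ∃ j < k, e ∈ G.lowEdges D j} ∧
      ∀ v < G.m, Chain (s'.na 16) (s'.na 15 v) (sel (fun j => G.src j = v ∧ G.IsLow D j) k))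
    (fun _ => 22) hG.nv2
    (by have := hR.M_lt; omega) hG.nv5 (by decide) (by decide)
    (by simp [lowBody, emit, nop, Cmd.modN])
    (by simp [lowBody, emit, nop, Cmd.modN]) (by simp [lowBody, emit, nop, Cmd.modN]) ?_ ?_).mono ?_
  · exact ⟨by simp, by simp, h0⟩
  · rintro k hk s₁ hf h10 ⟨hI1, hI2, hI3⟩
    have hc₁ : s₁.na 12 k = G.cls k := by
      rw [hf.na 12 (by cases d <;> simp [loop, lowBody, emit, nop, Cmd.modNA]), hc k hk]
    have hD₁ : s₁.ra (shiftA d) = D := by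
      rw [hf.ra _ (by simp [loop, lowBody, emit, nop, Cmd.modRA]), hD]
    refine (runs_lowBody (hG.frame hf (quiet_low d)) hR hk h10 hc₁ hD₁ (by omega)).mono ?_
    rintro s₂ t - ⟨ht, h1, h2, h3, h4⟩
    refine ⟨ht, by simp; omega, ?_, ?_⟩
    · rw [State.out_setN _ (by decide), h2, hI2, Set.union_assoc, ← Set.image_union]
      congr 2
      ext f
      simp only [Set.mem_union, Set.mem_ofPred_eq, Nat.lt_succ_iff_lt_or_eq, or_and_right,
        exists_or, exists_eq_left]
    · simp only [State.setN_na]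
      by_cases hl : G.IsLow D k
      · obtain ⟨e1, e2⟩ := h4 hl
        rw [e1, e2]
        exact Chain.link hl hI3
      · obtain ⟨e1, e2⟩ := h3 hl
        rw [e1, e2]
        exact Chain.skip hl hI3
  · rintro s' t - ⟨ht, h⟩
    exact ⟨by simpa using ht, h⟩

theorem runs_pairLoop {D : ℕ → ℝ} (hG : G.Holds d s) (hR : G.InRange w)
    (hc : ∀ i < G.M, s.na 12 i = G.cls i) (hD : s.ra (shiftA d) = D)
    (h4 : s.nv 4 + G.M * (G.M + 1) < 2 ^ w)
    (hl : ∀ v < 2 * G.m, Chain (s.na 14) (s.na 13 v) (sel (fun j => G.src j = v ∧ True) G.M))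
    (hll : ∀ v < G.m, Chain (s.na 16) (s.na 15 v) (sel (fun j => G.src j = v ∧ G.IsLow D j) G.M)) :
    Runs w (loop 10 2 (pairBody d)) s fun s' t =>
      t ≤ 2 + ∑ k ∈ Finset.range G.M, (22 + 11 * (G.partners D k).length) ∧
      s'.nv 4 ≤ s.nv 4 + G.M * (G.M + 1) ∧
      s'.out = s.out ∪ orient d '' {e | ∃ j < G.M, e ∈ G.pairEdges D j} := by
  refine (runs_loop (fun k s' => s'.nv 4 ≤ s.nv 4 + k * (G.M + 1) ∧
      s'.out = s.out ∪ orient d '' {e | ∃ j < k, e ∈ G.pairEdges D j})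
    (fun k => 20 + 11 * (G.partners D k).length) hG.nv2
    (by have := hR.M_lt; omega) hG.nv5 (by decide) (by decide)
    (by simp [pairBody, scan, emit, nop, Cmd.modN])
    (by simp [pairBody, scan, emit, nop, Cmd.modN])
    (by simp [pairBody, scan, emit, nop, Cmd.modN]) ?_ ?_).mono ?_
  · exact ⟨by simp, by simp⟩
  · rintro k hk s₁ hf h10 ⟨hI1, hI2⟩
    have hna : ∀ a, 12 ≤ a → s₁.na a = s.na a := fun a ha => hf.na a (by
      cases d <;> simp [loop, pairBody, scan, emit, nop, Cmd.modNA] <;> omega)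
    have hD₁ : s₁.ra (shiftA d) = D := by
      rw [hf.ra _ (by simp [loop, pairBody, scan, emit, nop, Cmd.modRA]), hD]
    have hb : s₁.nv 4 + (G.M + 1) < 2 ^ w := by
      have : (k + 1) * (G.M + 1) ≤ G.M * (G.M + 1) := Nat.mul_le_mul_right _ hk
      rw [Nat.succ_mul] at this
      omega
    refine (runs_pairBody (hG.frame hf (quiet_pair d)) hR hk h10
      (by rw [hna 12 le_rfl, hc k hk]) hD₁ hb
      (by rwa [hna 13 (by decide), hna 14 (by decide)])
      (by rwa [hna 15 (by decide), hna 16 (by decide)])).mono ?_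
    rintro s₂ t - ⟨ht, h1, h2⟩
    refine ⟨ht, ?_, ?_⟩
    · rw [Nat.succ_mul]
      simp
      omega
    · rw [State.out_setN _ (by decide), h2, hI2, Set.union_assoc, ← Set.image_union]
      congr 2
      ext f
      simp only [Set.mem_union, Set.mem_ofPred_eq, Nat.lt_succ_iff_lt_or_eq, or_and_right,
        exists_or, exists_eq_left]
  · rintro s' t - ⟨ht, h⟩
    refine ⟨ht.trans_eq ?_, h⟩
    congr 1
    exact Finset.sum_congr rfl fun k _ => by omega

theorem runs_clearLoop {K : ℕ} (h7 : s.nv 7 = K) (hK : K < 2 ^ w) (h5 : s.nv 5 = 1)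
    (h6 : s.nv 6 = 0) :
    Runs w (loop 10 7 clearBody) s fun s' t => t ≤ 2 + K * 6 ∧
      ∀ v < K, s'.na 10 v = 0 ∧ s'.na 13 v = 0 ∧ s'.na 15 v = 0 ∧ s'.na 17 v = 0 := by
  refine (runs_loop (fun k s' => ∀ v < k, s'.na 10 v = 0 ∧ s'.na 13 v = 0 ∧ s'.na 15 v = 0 ∧
    s'.na 17 v = 0) (fun _ => 4) h7 hK h5 (by decide) (by decide) (by simp [clearBody, Cmd.modN])
    (by simp [clearBody, Cmd.modN]) (by simp [clearBody, Cmd.modN]) (by simp) ?_).mono ?_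
  · intro k hk s₁ hf h10 hI
    refine (runs_clearBody (by rw [hf.nv 6 (by simp [loop, clearBody, Cmd.modN]), h6]) h10).mono ?_
    rintro s₂ t - ⟨ht, h1, h2, h3, h4⟩
    refine ⟨ht, fun i hi => ?_⟩
    rw [State.setN_na, h1, h2, h3, h4]
    by_cases e : i = k
    · simp [e]
    · simp only [Function.update_of_ne e]
      exact hI i (by omega)
  · rintro s' t - ⟨ht, h⟩
    exact ⟨by simpa using ht, h⟩

/-- The loop passes through the whole matrix, including the rows of vertices that are not negative,
where the input may contain any words. The claim is therefore made row by row, for rows with entries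
at most 1; the other sums may wrap around harmlessly. -/
theorem runs_countLoop {m : ℕ} (h1 : s.nv 1 = m) (h8 : s.nv 8 = m * m) (hm : m * m < 2 ^ w)
    (h5 : s.nv 5 = 1) (h0 : ∀ v < m, s.na 10 v = 0) :
    Runs w (loop 10 8 (countBody d)) s fun s' t => t ≤ 2 + m * m * 7 ∧
      ∀ r < m, (∀ v < m, s.na (matA d) (r * m + v) ≤ 1) →
        s'.na 10 r = ∑ v ∈ Finset.range m, s.na (matA d) (r * m + v) := by
  refine (runs_loop (fun k s' => ∀ r < m, (∀ v < m, s.na (matA d) (r * m + v) ≤ 1) →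
      s'.na 10 r = ∑ p ∈ Finset.range k, if p / m = r then s.na (matA d) p else 0)
    (fun _ => 5) h8 hm h5 (by decide) (by decide) (by simp [countBody, Cmd.modN])
    (by simp [countBody, Cmd.modN]) (by simp [countBody, Cmd.modN]) ?_ ?_).mono ?_
  · intro r hr _
    simp [h0 r hr]
  · intro k hk s₁ hf h10 hI
    have hmpos : 0 < m := Nat.pos_of_ne_zero fun h => by simp [h] at hk
    have e1 : s₁.nv 1 = m := by rw [hf.nv 1 (by simp [loop, countBody, Cmd.modN]), h1]
    have e2 : s₁.na (matA d) = s.na (matA d) :=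
      hf.na _ (by simp [loop, countBody, Cmd.modNA])
    refine (runs_countBody h10).mono ?_
    rintro s₂ t - ⟨ht, h⟩
    refine ⟨ht, fun r hr hr1 => ?_⟩
    rw [State.setN_na, h, e1, e2, Finset.sum_range_succ]
    by_cases e : k / m = r
    · have hle : ∀ p, p / m = r → s.na (matA d) p ≤ 1 := fun p hp => by
        have := hr1 (p % m) (Nat.mod_lt _ hmpos)
        rwa [← hp, Nat.div_add_mod'] at this
      subst e
      rw [Function.update_self, hI _ hr hr1, if_pos rfl, Nat.mod_eq_of_lt]
      -- A partial row sum after `k` cells is at most `k`, so adding one more entry stays at most `m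
      -- * m` and does not overflow.
      have h2 : ∑ p ∈ Finset.range k, (if p / m = k / m then s.na (matA d) p else 0) ≤
          ∑ p ∈ Finset.range k, 1 := by
        refine Finset.sum_le_sum fun p _ => ?_
        split_ifs with h3
        · exact hle p h3
        · exact Nat.zero_le _
      have h3 := hle k rfl
      simp at h2
      omega
    · rw [Function.update_of_ne (Ne.symm e), hI _ hr hr1, if_neg e, add_zero]
  · rintro s' t - ⟨ht, h⟩
    refine ⟨by simpa using ht, fun r hr hr1 => ?_⟩
    rw [h r hr hr1, ← Finset.sum_filter]
    symm
    -- The cells p with p / m = r are exactly r * m + v with v < m.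
    refine Finset.sum_nbij (fun v => r * m + v) ?_ ?_ ?_ ?_
    · intro v hv
      rw [Finset.mem_range] at hv
      rw [Finset.mem_filter, Finset.mem_range]
      refine ⟨?_, ?_⟩
      · have : (r + 1) * m ≤ m * m := Nat.mul_le_mul_right _ hr
        rw [Nat.succ_mul] at this
        omega
      · rw [mul_comm, Nat.mul_add_div (by omega), Nat.div_eq_of_lt hv, add_zero]
    · intro a _ b _ hab
      simpa using hab
    · intro p hp
      simp only [Finset.coe_filter, Finset.mem_range, Set.mem_ofPred_eq] at hp
      refine ⟨p % m, ?_, ?_⟩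
      · simp only [Finset.coe_range, Set.mem_Iio]
        exact Nat.mod_lt _ (by omega)
      · show r * m + p % m = p
        rw [← hp.2, Nat.div_add_mod']
    · intro _ _
      rfl

end loops

/-- What the program needs to know about its input. -/
structure Ready (w m M : ℕ) (s : State) : Prop where
  nv1 : s.nv 1 = m
  nv2 : s.nv 2 = M
  src_lt : ∀ i < M, s.na 4 i < 2 * m
  dst_lt : ∀ i < M, s.na 5 i < 2 * m
  base_lt : ∀ v < m, s.na 0 v < m
  base_base : ∀ v < m, s.na 0 (s.na 0 v) = s.na 0 v
  mat_le : ∀ d, ∀ i < M, m ≤ s.na (srcA d) i →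
    ∀ v < m, s.na (matA d) ((s.na (srcA d) i - m) * m + v) ≤ 1
  lin_lt : 4 * m + 4 < 2 ^ w
  cube_lt : m * m * m < 2 ^ w
  out_lt : 2 * (M * 2 + M * (M + 1)) + 2 < 2 ^ w

/-! ### One phase -/

section program
variable {w m M : ℕ} {d : Bool} {s : State}

/-- The data of a phase. -/
def inst (m M off : ℕ) (d : Bool) (s : State) (cnt : ℕ → ℕ) : Inst where
  m := m
  M := M
  off := off
  src := s.na (srcA d)
  dst := s.na (dstA d)
  base := s.na 0
  idx := s.na 11
  cnt := cnt
  wt := s.ra 2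
  P := s.ra (potA d)

/-- The counts are existentially quantified since they are only determined at Steiner vertices that
are tails of edges. The shifts `D` are whatever the phase leaves in its shift array; all that
matters of them is `IsShift`. The bound `M * 2 + M * (M + 1)` on the emitted edges is crude and
serves only to exclude overflow. -/
theorem runs_phase (hs : Ready w m M s) (h5 : s.nv 5 = 1) (h6 : s.nv 6 = 0)
    (h7 : s.nv 7 = 2 * m) (h8 : s.nv 8 = m * m) (h0 : s.rv 0 = 0)
    (hidx : ∀ v < m, s.na 11 (s.na 0 v) + 1 < 2 * m)
    (h4 : s.nv 4 + (M * 2 + M * (M + 1)) < 2 ^ w) :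
    Runs w (phase d) s fun s' t => ∃ cnt : ℕ → ℕ,
      (∀ i < M, m ≤ s.na (srcA d) i → cnt (s.na (srcA d) i - m) =
        ∑ v ∈ Finset.range m, s.na (matA d) ((s.na (srcA d) i - m) * m + v)) ∧
      (inst m M (2 * m + d.toNat) d s cnt).IsShift (s'.ra (shiftA d)) ∧
      s'.nv 4 ≤ s.nv 4 + (M * 2 + M * (M + 1)) ∧
      s'.out = s.out ∪
        orient d '' (inst m M (2 * m + d.toNat) d s cnt).newEdges (s'.ra (shiftA d)) ∧
      t ≤ 20 + 12 * m + 7 * (m * m) + 85 * M + 11 * ∑ k ∈ Finset.range M,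
        ((inst m M (2 * m + d.toNat) d s cnt).partners (s'.ra (shiftA d)) k).length := by
  have hlin := hs.lin_lt
  have hm2 : m * m < 2 ^ w := by
    rcases Nat.eq_zero_or_pos m with rfl | hm
    · simp
    · exact (Nat.le_mul_of_pos_right (m * m) hm).trans_lt hs.cube_lt
  unfold phase
  simp only [runs_seq, runs_add]
  have hoff : (s.nv 7 + s.nv (cond d 5 6)) % 2 ^ w = 2 * m + d.toNat := by
    cases d <;> simp [h5, h6, h7] <;> rw [Nat.mod_eq_of_lt] <;> omega
  rw [hoff]
  set s₁ := s.setN 9 (2 * m + d.toNat) with hs₁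
  refine (runs_clearLoop (K := 2 * m) (s := s₁) (by simp [s₁, h7]) (by omega) (by simp [s₁, h5])
    (by simp [s₁, h6])).mono ?_
  rintro s₂ t₂ e₂ ⟨ht₂, hz⟩
  have f₂ := e₂.frame
  have n₂ : ∀ x < 10, s₂.nv x = s₁.nv x := fun x hx =>
    f₂.nv x (by simp [loop, clearBody, Cmd.modN]; omega)
  have a₂ : ∀ x < 12, x ≠ 10 → s₂.na x = s₁.na x := fun x hx hx' =>
    f₂.na x (by simp [loop, clearBody, Cmd.modNA]; omega)
  have r₂ : ∀ x, s₂.ra x = s₁.ra x := fun x => f₂.ra x (by simp [loop, clearBody, Cmd.modRA])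
  have v₂ : s₂.rv 0 = s₁.rv 0 := f₂.rv 0 (by simp [loop, clearBody, Cmd.modR])
  have hmat : matA d < 4 := by cases d <;> decide
  have hsrc : srcA d < 6 := by cases d <;> decide
  have hdst : dstA d < 6 := by cases d <;> decide
  refine (runs_countLoop (m := m) (s := s₂) (by simp [n₂, s₁, hs.nv1]) (by simp [n₂, s₁, h8]) hm2
    (by simp [n₂, s₁, h5]) fun v hv => (hz v (by omega)).1).mono ?_
  rintro s₃ t₃ e₃ ⟨ht₃, hcnt⟩
  have f₃ := e₃.frame
  have n₃ : ∀ x < 10, s₃.nv x = s₂.nv x := fun x hx =>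
    f₃.nv x (by simp [loop, countBody, Cmd.modN]; omega)
  have a₃ : ∀ x, x ≠ 10 → s₃.na x = s₂.na x := fun x hx =>
    f₃.na x (by simp [loop, countBody, Cmd.modNA]; omega)
  have r₃ : ∀ x, s₃.ra x = s₂.ra x := fun x => f₃.ra x (by simp [loop, countBody, Cmd.modRA])
  have v₃ : s₃.rv 0 = s₂.rv 0 := f₃.rv 0 (by simp [loop, countBody, Cmd.modR])
  -- The counts are read after the counting loop, everything else from the initial memory, where it
  -- is the same.
  set G := inst m M (2 * m + d.toNat) d s (s₃.na 10) with hGdef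
  have hcnt' : ∀ i < M, m ≤ s.na (srcA d) i → s₃.na 10 (s.na (srcA d) i - m) =
        ∑ v ∈ Finset.range m, s.na (matA d) ((s.na (srcA d) i - m) * m + v) := by
    intro i hi hmi
    have hlt : s.na (srcA d) i < 2 * m := by
      cases d
      · exact hs.src_lt i hi
      · exact hs.dst_lt i hi
    have hmat' : s₂.na (matA d) = s.na (matA d) := by
      rw [a₂ _ (by omega) (by omega)]; rfl
    have := hcnt (s.na (srcA d) i - m) (by omega)
    rw [hmat'] at this
    exact this (hs.mat_le d i hi hmi)
  have hG : G.Holds d s₃ := by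
    constructor
    · simp [n₃, n₂, s₁, hs.nv1, G, inst]
    · simp [n₃, n₂, s₁, hs.nv2, G, inst]
    · simp [n₃, n₂, s₁, h5]
    · simp [n₃, n₂, s₁, h6]
    · simp [n₃, n₂, s₁, h7, G, inst]
    · simp [n₃, n₂, s₁, h8, G, inst]
    · simp [n₃, n₂, s₁, G, inst]
    · simp [v₃, v₂, s₁, h0]
    · rw [a₃ _ (by omega), a₂ _ (by omega) (by omega)]; rfl
    · rw [a₃ _ (by omega), a₂ _ (by omega) (by omega)]; rfl
    · rw [a₃ _ (by omega), a₂ _ (by omega) (by omega)]; rfl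
    · rw [a₃ _ (by omega), a₂ _ (by omega) (by omega)]; rfl
    · rfl
    · rw [r₃, r₂]; rfl
    · rw [r₃, r₂]; rfl
  have hR : G.InRange w := by
    constructor
    · intro i hi
      cases d
      · exact hs.dst_lt i hi
      · exact hs.src_lt i hi
    · exact hs.base_lt
    · have := hs.out_lt
      show M + 1 < 2 ^ w
      rw [Nat.mul_succ] at this
      omega
    · omega
    · intro i hi hmi
      have hle : s₃.na 10 (s.na (srcA d) i - m) ≤ m := by
        rw [hcnt' i hi hmi]
        have := Finset.sum_le_sum fun v hv => hs.mat_le d i hi hmi v (Finset.mem_range.mp hv)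
        simpa using this
      exact (Nat.mul_le_mul (Nat.mul_le_mul hle hle) hle).trans_lt hs.cube_lt
    · intro v hv
      have := hidx v hv
      have h1 : d.toNat ≤ 1 := by cases d <;> decide
      show s.na 11 (s.na 0 v) + (2 * m + d.toNat) < 2 ^ w
      omega
  have z₃ : ∀ x, x ≠ 10 → s₃.na x = s₂.na x := a₃
  -- classes
  refine (runs_classLoop hG hR).mono ?_
  rintro s₄ t₄ e₄ ⟨ht₄, hc₄⟩
  have f₄ := e₄.frame
  have hG₄ := hG.frame f₄ (quiet_class d)
  have a₄ : ∀ x, x ≠ 12 → s₄.na x = s₃.na x := fun x hx =>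
    f₄.na x (by simp [loop, classBody, nop, Cmd.modNA]; omega)
  -- lists
  refine (runs_linkLoop hG₄ hR (by
    intro v hv
    rw [a₄ _ (by decide), a₃ _ (by decide)]
    exact (hz v hv).2.1)).mono ?_
  rintro s₅ t₅ e₅ ⟨ht₅, hl₅⟩
  have f₅ := e₅.frame
  have hG₅ := hG₄.frame f₅ (quiet_link d)
  have a₅ : ∀ x, x ≠ 13 → x ≠ 14 → s₅.na x = s₄.na x := fun x hx hx' =>
    f₅.na x (by simp [loop, linkBody, Cmd.modNA]; omega)
  -- shifts
  refine (runs_shiftLoop hG₅ hR (by rwa [a₅ 12 (by decide) (by decide)]) (by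
    intro v hv
    have hv' : v < m := hv
    rw [a₅ _ (by decide) (by decide), a₄ _ (by decide), a₃ _ (by decide)]
    exact (hz v (by omega)).2.2.2)).mono ?_
  rintro s₆ t₆ e₆ ⟨ht₆, hD⟩
  have f₆ := e₆.frame
  have hG₆ := hG₅.frame f₆ (quiet_shift d)
  have a₆ : ∀ x, x ≠ 17 → s₆.na x = s₅.na x := fun x hx =>
    f₆.na x (by simp [loop, shiftBody, nop, Cmd.modNA]; omega)
  have hc₆ : ∀ i < G.M, s₆.na 12 i = G.cls i := by
    rwa [a₆ _ (by decide), a₅ _ (by decide) (by decide)]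
  have c₆ : s₆.nv 4 = s.nv 4 := by
    rw [f₆.nv 4 (by simp [loop, shiftBody, nop, Cmd.modN]),
      f₅.nv 4 (by simp [loop, linkBody, Cmd.modN]),
      f₄.nv 4 (by simp [loop, classBody, nop, Cmd.modN]), n₃ _ (by decide), n₂ _ (by decide)]
    simp [s₁]
  have o₆ : s₆.out = s.out := by
    have h1 : s₆.na 7 = s.na 7 := by
      rw [a₆ _ (by decide), a₅ _ (by decide) (by decide), a₄ _ (by decide), a₃ _ (by decide),
        a₂ _ (by decide) (by decide)]; rfl
    have h2 : s₆.na 8 = s.na 8 := by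
      rw [a₆ _ (by decide), a₅ _ (by decide) (by decide), a₄ _ (by decide), a₃ _ (by decide),
        a₂ _ (by decide) (by decide)]; rfl
    have h3 : s₆.ra 4 = s.ra 4 := by
      rw [f₆.ra 4 (by simp [loop, shiftBody, nop, Cmd.modRA]),
        f₅.ra 4 (by simp [loop, linkBody, Cmd.modRA]),
        f₄.ra 4 (by simp [loop, classBody, nop, Cmd.modRA]), r₃, r₂]; rfl
    simp only [State.out, c₆, h1, h2, h3]
  -- edges of the new copies
  refine (runs_lowLoop hG₆ hR hc₆ rfl (by
    intro v hv
    have hv' : v < m := hv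
    rw [a₆ _ (by decide), a₅ _ (by decide) (by decide), a₄ _ (by decide), a₃ _ (by decide)]
    exact (hz v (by omega)).2.2.1) (by
    rw [c₆]
    show s.nv 4 + M * 2 < _
    omega)).mono ?_
  rintro s₇ t₇ e₇ ⟨ht₇, h4₇, o₇, hll⟩
  have f₇ := e₇.frame
  have hG₇ := hG₆.frame f₇ (quiet_low d)
  have a₇ : ∀ x, 12 ≤ x → x ≠ 15 → x ≠ 16 → s₇.na x = s₆.na x := fun x hx hx' hx'' =>
    f₇.na x (by cases d <;> simp [loop, lowBody, emit, nop, Cmd.modNA] <;> omega)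
  have D₇ : s₇.ra (shiftA d) = s₆.ra (shiftA d) :=
    f₇.ra _ (by simp [loop, lowBody, emit, nop, Cmd.modRA])
  -- shortcuts
  refine (runs_pairLoop hG₇ hR (D := s₆.ra (shiftA d))
    (by rwa [a₇ 12 (by decide) (by decide) (by decide)]) D₇ (by
      have : G.M = M := rfl
      rw [this] at h4₇ ⊢
      omega) (by
      rw [a₇ 13 (by decide) (by decide) (by decide), a₇ 14 (by decide) (by decide) (by decide),
        a₆ _ (by decide), a₆ _ (by decide)]
      exact hl₅) hll).mono ?_
  rintro s₈ t₈ e₈ ⟨ht₈, h4₈, o₈⟩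
  have D₈ : s₈.ra (shiftA d) = s₆.ra (shiftA d) := by
    rw [e₈.frame.ra _ (by simp [loop, pairBody, scan, emit, nop, Cmd.modRA]), D₇]
  have eM : G.M = M := rfl
  rw [eM] at ht₄ ht₅ ht₆ ht₇ h4₇ h4₈ ht₈
  refine ⟨s₃.na 10, hcnt', ?_, by omega, ?_, ?_⟩
  · rw [D₈]
    exact hD
  · rw [o₈, o₇, o₆, D₈, Set.union_assoc, ← Set.image_union]
    congr 2
    ext f
    simp only [Set.mem_union, Set.mem_ofPred_eq, Inst.newEdges, ← exists_or, ← and_or_left]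
    rfl
  · rw [D₈]
    rw [Finset.sum_add_distrib, ← Finset.mul_sum] at ht₈
    simp only [Finset.sum_const, Finset.card_range, smul_eq_mul] at ht₈
    generalize ∑ k ∈ Finset.range M, (G.partners (s₆.ra (shiftA d)) k).length = z at *
    omega

end program

/-! ### Numbering of the copies, their final shifts, and the whole program -/

section program
variable {w m M : ℕ} {s : State}

/-- Every base vertex has been given two numbers `idx v` and `idx v + 1` below `q`. -/
structure Numbered (m q : ℕ) (base idx newBase : ℕ → ℕ) : Prop where
  mem : ∀ v < m, base v = v → idx v + 1 < q ∧ newBase (idx v) = v ∧ newBase (idx v + 1) = v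
  exists_eq : ∀ j < q, ∃ v < m, base v = v ∧ (j = idx v ∨ j = idx v + 1)

theorem runs_numberLoop (h1 : s.nv 1 = m) (hm : 2 * m + 2 < 2 ^ w) (h5 : s.nv 5 = 1)
    (h0 : s.rv 0 = 0) (h3 : s.nv 3 = 0) :
    Runs w (loop 10 1 numberBody) s fun s' t => t ≤ 2 + m * 12 ∧
      Numbered m (s'.nv 3) (s.na 0) (s'.na 11) (s'.na 6) ∧ s'.nv 3 ≤ 2 * m ∧
      ∀ v < m, s'.ra 7 v = - s.ra 0 v := by
  refine (runs_loop (fun k s' => s'.nv 3 ≤ 2 * k ∧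
      Numbered k (s'.nv 3) (s.na 0) (s'.na 11) (s'.na 6) ∧ ∀ v < k, s'.ra 7 v = - s.ra 0 v)
    (fun _ => 10) h1 (by omega) h5 (by decide) (by decide) (by simp [numberBody, nop, Cmd.modN])
    (by simp [numberBody, nop, Cmd.modN]) (by simp [numberBody, nop, Cmd.modN]) ?_ ?_).mono ?_
  · exact ⟨by simp [h3], ⟨by simp, by simp [h3]⟩, by simp⟩
  · rintro k hk s₁ hf h10 ⟨hI1, hI2, hI3⟩
    have e0 : s₁.na 0 = s.na 0 := hf.na 0 (by simp [loop, numberBody, nop, Cmd.modNA])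
    have r0 : s₁.ra 0 = s.ra 0 := hf.ra 0 (by simp [loop, numberBody, nop, Cmd.modRA])
    refine (runs_numberBody h10
      (by rw [hf.rv 0 (by simp [loop, numberBody, nop, Cmd.modR]), h0])
      (by rw [hf.nv 5 (by simp [loop, numberBody, nop, Cmd.modN]), h5]) (by omega)).mono ?_
    rintro s₂ t - ⟨ht, h7, hn, hb⟩
    rw [e0] at hn hb
    refine ⟨ht, ?_⟩
    simp only [State.setN_na, State.setN_ra, State.setN_nv, show (3 : ℕ) ≠ 10 by decide, if_false]
    have hneg : ∀ v < k + 1, s₂.ra 7 v = - s.ra 0 v := by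
      intro v hv
      rw [h7, r0]
      by_cases e : v = k
      · rw [e, Function.update_self]
      · rw [Function.update_of_ne e, hI3 v (by omega)]
    by_cases hk' : s.na 0 k = k
    · obtain ⟨e3, e6, e11⟩ := hb hk'
      rw [e3, e6, e11]
      refine ⟨by omega, ⟨fun v hv hvb => ?_, fun j hj => ?_⟩, hneg⟩
      · by_cases e : v = k
        · subst e
          simp
        · rw [Function.update_of_ne e]
          obtain ⟨m1, m2, m3⟩ := hI2.mem v (by omega) hvb
          refine ⟨by omega, ?_, ?_⟩
          · rwa [Function.update_of_ne (by omega), Function.update_of_ne (by omega)]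
          · rwa [Function.update_of_ne (by omega), Function.update_of_ne (by omega)]
      · by_cases hj' : j < s₁.nv 3
        · obtain ⟨v, hv, hvb, h⟩ := hI2.exists_eq j hj'
          refine ⟨v, by omega, hvb, ?_⟩
          rwa [Function.update_of_ne (by omega)]
        · refine ⟨k, by omega, hk', ?_⟩
          rw [Function.update_self]
          omega
    · obtain ⟨e3, e6, e11⟩ := hn hk'
      rw [e3, e6, e11]
      refine ⟨by omega, ⟨fun v hv hvb => ?_, fun j hj => ?_⟩, hneg⟩
      · refine hI2.mem v ?_ hvb
        rcases Nat.lt_succ_iff_lt_or_eq.mp hv with h | rfl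
        · exact h
        · exact absurd hvb hk'
      · obtain ⟨v, hv, h⟩ := hI2.exists_eq j hj
        exact ⟨v, by omega, h⟩
  · rintro s' t - ⟨ht, h1, h2, h3⟩
    exact ⟨by simpa using ht, h2, h1, h3⟩

theorem runs_finishLoop {q : ℕ} (h1 : s.nv 1 = m) (hm : m < 2 ^ w) (hq : q < 2 ^ w)
    (h5 : s.nv 5 = 1) (h0 : s.rv 0 = 0) (hn : Numbered m q (s.na 0) (s.na 11) (s.na 6)) :
    Runs w (loop 10 1 finishBody) s fun s' t => t ≤ 2 + m * 12 ∧
      ∀ v < m, s.na 0 v = v → s'.ra 3 (s.na 11 v) = s.ra 8 v ∧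
        s'.ra 3 (s.na 11 v + 1) = - s.ra 9 v := by
  refine (runs_loop (fun k s' => ∀ v < k, s.na 0 v = v → s'.ra 3 (s.na 11 v) = s.ra 8 v ∧
        s'.ra 3 (s.na 11 v + 1) = - s.ra 9 v)
    (fun _ => 10) h1 (by omega) h5 (by decide) (by decide) (by simp [finishBody, nop, Cmd.modN])
    (by simp [finishBody, nop, Cmd.modN]) (by simp [finishBody, nop, Cmd.modN]) (by simp) ?_).mono ?_
  · rintro k hk s₁ hf h10 hI
    have e0 : s₁.na = s.na := by
      funext a
      exact hf.na a (by simp [loop, finishBody, nop, Cmd.modNA])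
    have r0 : ∀ a, a ≠ 3 → s₁.ra a = s.ra a := fun a ha =>
      hf.ra a (by simpa [loop, finishBody, nop, Cmd.modRA] using ha)
    refine (runs_finishBody h10
      (by rw [hf.rv 0 (by simp [loop, finishBody, nop, Cmd.modR]), h0])
      (by rw [hf.nv 5 (by simp [loop, finishBody, nop, Cmd.modN]), h5]) (by
        rw [e0]
        intro h
        exact (hn.mem k hk h).1.trans hq)).mono ?_
    rintro s₂ t - ⟨ht, hb, hb'⟩
    rw [e0, r0 8 (by decide), r0 9 (by decide)] at hb'
    rw [e0] at hb
    refine ⟨ht, fun v hv hvb => ?_⟩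
    rw [State.setN_ra]
    rcases Nat.lt_succ_iff_lt_or_eq.mp hv with h | rfl
    · by_cases hkb : s.na 0 k = k
      · obtain ⟨-, m2, m3⟩ := hn.mem k hk hkb
        obtain ⟨-, m2', m3'⟩ := hn.mem v (by omega) hvb
        -- Array 6 recovers a base vertex from either of its numbers, so distinct base vertices have
        -- disjoint pairs of numbers and the new writes spare the earlier ones.
        have d1 : s.na 11 v ≠ s.na 11 k := fun h' => by rw [h', m2] at m2'; omega
        have d2 : s.na 11 v ≠ s.na 11 k + 1 := fun h' => by rw [h', m3] at m2'; omega
        have d3 : s.na 11 v + 1 ≠ s.na 11 k := fun h' => by rw [h', m2] at m3'; omega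
        have d4 : s.na 11 v + 1 ≠ s.na 11 k + 1 := by omega
        rw [hb' hkb, Function.update_of_ne d2, Function.update_of_ne d1, Function.update_of_ne d4,
          Function.update_of_ne d3]
        exact hI v h hvb
      · rw [hb hkb]
        exact hI v h hvb
    · rw [hb' hvb, Function.update_self, Function.update_of_ne (by omega), Function.update_self]
      exact ⟨rfl, rfl⟩
  · rintro s' t - ⟨ht, h⟩
    exact ⟨by simpa using ht, h⟩

/-- The words and arrays that the phases leave unchanged. -/
theorem frame_phase {d : Bool} {s s' : State} (h : Frame (phase d) s s') :
    (∀ x < 9, x ≠ 4 → s'.nv x = s.nv x) ∧ s'.rv 0 = s.rv 0 ∧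
      (∀ a, a ≠ 7 → a ≠ 8 → a ≠ 10 → a < 12 → s'.na a = s.na a) ∧
      (∀ a, a ≠ 4 → a ≠ shiftA d → s'.ra a = s.ra a) := by
  refine ⟨fun x hx hx' => h.nv x ?_, h.rv 0 ?_, fun a h1 h2 h3 h4 => h.na a ?_,
    fun a h1 h2 => h.ra a ?_⟩
  · simp [phase, loop, clearBody, countBody, classBody, linkBody, shiftBody, lowBody, pairBody, scan,
      emit, nop, Cmd.modN]
    omega
  · simp [phase, loop, clearBody, countBody, classBody, linkBody, shiftBody, lowBody, pairBody, scan,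
      emit, nop, Cmd.modR]
  · cases d <;> simp [phase, loop, clearBody, countBody, classBody, linkBody, shiftBody, lowBody,
      pairBody, scan, emit, nop, Cmd.modNA] <;> omega
  · simp [phase, loop, clearBody, countBody, classBody, linkBody, shiftBody, lowBody, pairBody, scan,
      emit, nop, Cmd.modRA, h1, h2]

/-- Correctness of the counts of a phase. -/
def CountsOf (m M : ℕ) (d : Bool) (s : State) (cnt : ℕ → ℕ) : Prop :=
  ∀ i < M, m ≤ s.na (srcA d) i → cnt (s.na (srcA d) i - m) =
    ∑ v ∈ Finset.range m, s.na (matA d) ((s.na (srcA d) i - m) * m + v)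

/-- The data of both phases, in terms of the input, the numbering and the counts. -/
def instOf (m M : ℕ) (s : State) (idx : ℕ → ℕ) (cnt : Bool → ℕ → ℕ) (P : ℕ → ℝ) (d : Bool) :
    Inst where
  m := m
  M := M
  off := 2 * m + d.toNat
  src := s.na (srcA d)
  dst := s.na (dstA d)
  base := s.na 0
  idx := idx
  cnt := cnt d
  wt := s.ra 2
  P := cond d P (s.ra 0)

/-- Both phases are described by the same input, numbering and negated shifts, which neither phase
alters. In the second phase all shifts are negated, so the shift written for its copy is `- D true`.
-/
theorem runs_program (hs : Ready w m M s) :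
    Runs w program s fun s' t => ∃ (idx : ℕ → ℕ) (cnt : Bool → ℕ → ℕ) (P : ℕ → ℝ)
      (D : Bool → ℕ → ℝ), (∀ v < m, P v = - s.ra 0 v) ∧
      (∀ d, CountsOf m M d s (cnt d)) ∧
      (∀ d, (instOf m M s idx cnt P d).IsShift (D d)) ∧
      Numbered m (s'.nv 3) (s.na 0) idx (s'.na 6) ∧
      (∀ v < m, s.na 0 v = v → s'.ra 3 (idx v) = D false v ∧ s'.ra 3 (idx v + 1) = - D true v) ∧
      s'.out = orient false '' (instOf m M s idx cnt P false).newEdges (D false) ∪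
        orient true '' (instOf m M s idx cnt P true).newEdges (D true) ∧
      t ≤ 60 + 50 * m + 20 * (m * m) + 200 * M +
        11 * ∑ k ∈ Finset.range M, ((instOf m M s idx cnt P false).partners (D false) k).length +
        11 * ∑ k ∈ Finset.range M, ((instOf m M s idx cnt P true).partners (D true) k).length := by
  have hlin := hs.lin_lt
  have hout := hs.out_lt
  have hm2 : m * m < 2 ^ w := by
    rcases Nat.eq_zero_or_pos m with rfl | hm
    · simp
    · exact (Nat.le_mul_of_pos_right (m * m) hm).trans_lt hs.cube_lt
  unfold program
  rw [runs_seq]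
  refine (runs_setup (by rw [hs.nv1]; omega) (by rw [hs.nv1]; exact hm2) (by omega)).mono ?_
  rintro s₁ t₁ e₁ ⟨ht₁, h5, h6, h4, h3, h7, h8, h0⟩
  have f₁ := e₁.frame
  have n₁ : ∀ x < 3, s₁.nv x = s.nv x := fun x hx => f₁.nv x (by simp [setup, Cmd.modN]; omega)
  have a₁ : s₁.na = s.na := by
    funext a; exact f₁.na a (by simp [setup, Cmd.modNA])
  have r₁ : s₁.ra = s.ra := by
    funext a; exact f₁.ra a (by simp [setup, Cmd.modRA])
  rw [hs.nv1] at h7 h8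
  rw [runs_seq]
  refine (runs_numberLoop (m := m) (by rw [n₁ _ (by decide), hs.nv1]) (by omega) h5 h0 h3).mono ?_
  rintro s₂ t₂ e₂ ⟨ht₂, hN, hq, hneg⟩
  have f₂ := e₂.frame
  rw [a₁] at hN
  rw [r₁] at hneg
  have n₂ : ∀ x < 10, x ≠ 3 → s₂.nv x = s₁.nv x := fun x hx hx' =>
    f₂.nv x (by simp [loop, numberBody, nop, Cmd.modN]; omega)
  have a₂ : ∀ a, a ≠ 6 → a ≠ 11 → s₂.na a = s.na a := fun a ha ha' => by
    rw [← a₁]; exact f₂.na a (by simp [loop, numberBody, nop, Cmd.modNA]; omega)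
  have r₂ : ∀ a, a ≠ 7 → s₂.ra a = s.ra a := fun a ha => by
    rw [← r₁]; exact f₂.ra a (by simp [loop, numberBody, nop, Cmd.modRA]; omega)
  have v₂ : s₂.rv 0 = 0 := by
    rw [f₂.rv 0 (by simp [loop, numberBody, nop, Cmd.modR]), h0]
  have ready : ∀ s' : State, (∀ x < 3, s'.nv x = s.nv x) → (∀ a < 6, s'.na a = s.na a) →
      Ready w m M s' := by
    intro s' hnv hna
    refine ⟨by rw [hnv _ (by decide), hs.nv1], by rw [hnv _ (by decide), hs.nv2],
      by rw [hna _ (by decide)]; exact hs.src_lt, by rw [hna _ (by decide)]; exact hs.dst_lt,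
      by rw [hna _ (by decide)]; exact hs.base_lt, by rw [hna _ (by decide)]; exact hs.base_base,
      ?_, hlin, hs.cube_lt, hout⟩
    intro d
    rw [hna (srcA d) (by cases d <;> decide), hna (matA d) (by cases d <;> decide)]
    exact hs.mat_le d
  have hidx : ∀ v < m, s₂.na 11 (s.na 0 v) + 1 < 2 * m := fun v hv =>
    (hN.mem _ (hs.base_lt v hv) (hs.base_base v hv)).1.trans_le hq
  have c₂ : s₂.nv 4 = 0 := by rw [n₂ _ (by decide) (by decide), h4]
  have hr₂ := ready s₂ (fun x hx => by rw [n₂ x (by omega) (by omega), n₁ x hx])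
    fun a ha => a₂ a (by omega) (by omega)
  rw [runs_seq]
  refine (runs_phase (d := false) hr₂ (by rw [n₂ _ (by decide) (by decide), h5])
    (by rw [n₂ _ (by decide) (by decide), h6]) (by rw [n₂ _ (by decide) (by decide), h7])
    (by rw [n₂ _ (by decide) (by decide), h8]) v₂
    (by rwa [a₂ 0 (by decide) (by decide)]) (by omega)).mono ?_
  rintro s₃ t₃ e₃ ⟨cO, hcO, hDO, h4₃, o₃, ht₃⟩
  obtain ⟨n₃, v₃, a₃, r₃⟩ := frame_phase e₃.frame
  have hr₃ := ready s₃
    (fun x hx => by rw [n₃ x (by omega) (by omega), n₂ x (by omega) (by omega), n₁ x hx])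
    fun a ha => by
      rw [a₃ a (by omega) (by omega) (by omega) (by omega), a₂ a (by omega) (by omega)]
  have b₃ : s₃.na 0 = s.na 0 := by
    rw [a₃ _ (by decide) (by decide) (by decide) (by decide), a₂ _ (by decide) (by decide)]
  have i₃ : s₃.na 11 = s₂.na 11 := a₃ _ (by decide) (by decide) (by decide) (by decide)
  rw [runs_seq]
  refine (runs_phase (d := true) hr₃
    (by rw [n₃ _ (by decide) (by decide), n₂ _ (by decide) (by decide), h5])
    (by rw [n₃ _ (by decide) (by decide), n₂ _ (by decide) (by decide), h6])
    (by rw [n₃ _ (by decide) (by decide), n₂ _ (by decide) (by decide), h7])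
    (by rw [n₃ _ (by decide) (by decide), n₂ _ (by decide) (by decide), h8]) (by rw [v₃, v₂])
    (by rwa [b₃, i₃]) (by omega)).mono ?_
  rintro s₄ t₄ e₄ ⟨cI, hcI, hDI, h4₄, o₄, ht₄⟩
  obtain ⟨n₄, v₄, a₄, r₄⟩ := frame_phase e₄.frame
  have b₄ : s₄.na 0 = s.na 0 := by
    rw [a₄ _ (by decide) (by decide) (by decide) (by decide), b₃]
  have i₄ : s₄.na 11 = s₂.na 11 := by
    rw [a₄ _ (by decide) (by decide) (by decide) (by decide), i₃]
  have k₄ : s₄.na 6 = s₂.na 6 := by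
    rw [a₄ _ (by decide) (by decide) (by decide) (by decide),
      a₃ _ (by decide) (by decide) (by decide) (by decide)]
  have q₄ : s₄.nv 3 = s₂.nv 3 := by
    rw [n₄ _ (by decide) (by decide), n₃ _ (by decide) (by decide)]
  refine (runs_finishLoop (m := m) (q := s₂.nv 3)
    (by rw [n₄ _ (by decide) (by decide), hr₃.nv1]) (by omega) (by omega)
    (by rw [n₄ _ (by decide) (by decide), n₃ _ (by decide) (by decide),
      n₂ _ (by decide) (by decide), h5]) (by rw [v₄, v₃, v₂]) (by rwa [b₄, i₄, k₄])).mono ?_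
  rintro s₅ t₅ e₅ ⟨ht₅, hfin⟩
  have f₅ := e₅.frame
  have a₅ : s₅.na = s₄.na := by
    funext a; exact f₅.na a (by simp [loop, finishBody, nop, Cmd.modNA])
  have n₅ : ∀ x < 10, s₅.nv x = s₄.nv x := fun x hx =>
    f₅.nv x (by simp [loop, finishBody, nop, Cmd.modN]; omega)
  have r₅ : s₅.ra 4 = s₄.ra 4 := f₅.ra 4 (by simp [loop, finishBody, nop, Cmd.modRA])
  have o₅ : s₅.out = s₄.out := by
    simp only [State.out, a₅, r₅, n₅ 4 (by decide)]
  have o₂ : s₂.out = ∅ := by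
    simp [State.out, c₂]
  let cnt : Bool → ℕ → ℕ := fun d => cond d cI cO
  -- The data found in memory at the start of each phase are rewritten in terms of the initial
  -- input; the same is done for the second phase in `gI`.
  have gO : inst m M (2 * m + false.toNat) false s₂ cO =
      instOf m M s (s₂.na 11) cnt (s₂.ra 7) false := by
    simp only [inst, instOf, srcA, dstA, potA, cond_false, cnt]
    rw [a₂ _ (by decide) (by decide), a₂ _ (by decide) (by decide), a₂ _ (by decide) (by decide),
      r₂ _ (by decide), r₂ _ (by decide)]
  have gI : inst m M (2 * m + true.toNat) true s₃ cI =
      instOf m M s (s₂.na 11) cnt (s₂.ra 7) true := by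
    simp only [inst, instOf, srcA, dstA, potA, cond_true, cnt]
    rw [b₃, i₃, a₃ 5 (by decide) (by decide) (by decide) (by decide),
      a₃ 4 (by decide) (by decide) (by decide) (by decide), r₃ 2 (by decide) (by decide),
      r₃ 7 (by decide) (by decide), a₂ _ (by decide) (by decide), a₂ _ (by decide) (by decide),
      r₂ _ (by decide)]
  rw [gO] at hDO o₃ ht₃
  rw [gI] at hDI o₄ ht₄
  have D8 : s₄.ra 8 = s₃.ra 8 := r₄ 8 (by decide) (by decide)
  refine ⟨s₂.na 11, cnt, s₂.ra 7, fun d => cond d (s₄.ra 9) (s₃.ra 8), hneg, ?_, ?_, ?_, ?_, ?_, ?_⟩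
  · rintro (_ | _)
    · intro i hi
      have := hcO i hi
      rwa [a₂ _ (by decide) (by decide), a₂ _ (by decide) (by decide)] at this
    · intro i hi
      have := hcI i hi
      rwa [a₃ _ (by decide) (by decide) (by decide) (by decide),
        a₃ _ (by decide) (by decide) (by decide) (by decide), a₂ _ (by decide) (by decide),
        a₂ _ (by decide) (by decide)] at this
  · rintro (_ | _)
    · exact hDO
    · exact hDI
  · rwa [n₅ _ (by decide), q₄, a₅, k₄]
  · rw [b₄, i₄, D8] at hfin
    exact hfin
  · rw [o₅, o₄, o₃, o₂, Set.empty_union]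
    rfl
  · have e1 : s₃.ra 8 = cond false (s₄.ra 9) (s₃.ra 8) := rfl
    change t₃ ≤ _ + 11 * ∑ k ∈ Finset.range M, ((instOf m M s (s₂.na 11) cnt (s₂.ra 7)
      false).partners (s₃.ra 8) k).length at ht₃
    change t₄ ≤ _ + 11 * ∑ k ∈ Finset.range M, ((instOf m M s (s₂.na 11) cnt (s₂.ra 7)
      true).partners (s₄.ra 9) k).length at ht₄
    show _ ≤ _ + 11 * ∑ k ∈ Finset.range M, ((instOf m M s (s₂.na 11) cnt (s₂.ra 7)
      false).partners (s₃.ra 8) k).length + 11 * ∑ k ∈ Finset.range M, ((instOf m M s (s₂.na 11)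
      cnt (s₂.ra 7) true).partners (s₄.ra 9) k).length
    omega

end program

/-! ### Walks and distances -/

section walks
variable {V : Type} {E : MGraph V}

theorem Walk.append {s t u : V} {x y : ℝ} {k l : ℕ} (h : Walk E s t x k) (h' : Walk E t u y l) :
    Walk E s u (x + y) (k + l) := by
  induction h with
  | nil => simpa using h'
  | cons he _ ih =>
    rw [add_assoc, add_assoc]
    exact .cons he (ih h')

theorem Walk.single {u v : V} {w : ℝ} {b : Bool} (h : E u v w b) : Walk E u v w b.toNat := by
  simpa using Walk.cons h (.nil v)

/-- Corrections by a potential telescope along a walk. The marks may change: in one graph they are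
frozen, in the other they follow the sign of the weight. -/
theorem Walk.map {W : Type} {F : MGraph W} {f : V → W} (g : V → ℝ)
    (h : ∀ u v w b, E u v w b → ∃ b', F (f u) (f v) (w + g u - g v) b') {s t : V} {x : ℝ} {k : ℕ}
    (hw : Walk E s t x k) : ∃ k', Walk F (f s) (f t) (x + g s - g t) k' := by
  induction hw with
  | nil v => exact ⟨0, by simpa using Walk.nil (f v)⟩
  | @cons u v t w x b k he _ ih =>
    obtain ⟨k', hk⟩ := ih
    obtain ⟨b', hb⟩ := h _ _ _ _ he
    refine ⟨b'.toNat + k', ?_⟩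
    have := Walk.cons hb hk
    rwa [show w + g u - g v + (x + g v - g t) = w + x + g u - g t by ring] at this

theorem Walk.mono {F : MGraph V} (h : ∀ u v w b, E u v w b → F u v w b) {s t : V} {x : ℝ} {k : ℕ}
    (hw : Walk E s t x k) : Walk F s t x k := by
  induction hw with
  | nil v => exact .nil v
  | cons he _ ih => exact .cons (h _ _ _ _ he) ih

/-- The infimum need not be attained and could be -∞, so distances are handled through approximating
walks; this avoids any assumption on negative cycles. -/
theorem dist_le_iff {s t : V} {y : ℝ} :
    dist E s t ≤ (y : EReal) ↔ ∀ ε > 0, ∃ x k, Walk E s t x k ∧ x < y + ε := by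
  constructor
  · intro h ε hε
    have h1 : dist E s t < ((y + ε : ℝ) : EReal) :=
      h.trans_lt (by exact_mod_cast lt_add_of_pos_right y hε)
    simp only [dist, iInf_lt_iff] at h1
    obtain ⟨x, k, hw, hx⟩ := h1
    exact ⟨x, k, hw, by exact_mod_cast hx⟩
  · intro h
    refine EReal.le_of_forall_lt_iff_le.mp fun z hz => ?_
    have hz' : y < z := by exact_mod_cast hz
    obtain ⟨x, k, hw, hx⟩ := h (z - y) (by linarith)
    refine (iInf_le_of_le x <| iInf_le_of_le k <| iInf_le_of_le hw le_rfl).trans ?_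
    exact_mod_cast (show x ≤ z by linarith)

theorem Walk.dist_le {s t : V} {x : ℝ} {k : ℕ} (h : Walk E s t x k) : dist E s t ≤ (x : EReal) :=
  iInf_le_of_le x <| iInf_le_of_le k <| iInf_le_of_le h le_rfl

theorem dist_le_trans {s t u : V} {x y z : ℝ} (h : dist E s t ≤ (x : EReal))
    (h' : dist E t u ≤ (y : EReal)) (hz : z = x + y) : dist E s u ≤ (z : EReal) := by
  rw [dist_le_iff] at *
  intro ε hε
  obtain ⟨x', k, hw, hx⟩ := h (ε / 2) (by linarith)
  obtain ⟨y', l, hw', hy⟩ := h' (ε / 2) (by linarith)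
  exact ⟨_, _, hw.append hw', by linarith⟩

theorem hopDist_le {h k : ℕ} {s t : V} {x : ℝ} (hw : Walk E s t x k) (hk : k ≤ h) :
    hopDist E h s t ≤ (x : EReal) :=
  iInf_le_of_le x <| iInf_le_of_le k <| iInf_le_of_le ⟨hw, hk⟩ le_rfl

theorem exists_walk_of_hopDist_lt {h : ℕ} {s t : V} {y : EReal} (hy : hopDist E h s t < y) :
    ∃ (x : ℝ) (k : ℕ), Walk E s t x k ∧ k ≤ h ∧ (x : EReal) < y := by
  simp only [hopDist, iInf_lt_iff] at hy
  obtain ⟨x, k, ⟨hw, hk⟩, hx⟩ := hy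
  exact ⟨x, k, hw, hk, hx⟩

end walks

namespace Stage
variable {m : ℕ} {S : Stage m}

/-! ### The graph `Γ` -/

theorem Γ_unique {u v : Fin m} {w w' : ℝ} {b b' : Bool} (h : S.Γ u v w b) (h' : S.Γ u v w' b') :
    w = w' ∧ b = b' := by
  obtain ⟨w₀, h1, h2, h3⟩ := h
  obtain ⟨w₁, h1', h2', h3'⟩ := h'
  obtain rfl : w₀ = w₁ := Option.some.inj (h1.symm.trans h1')
  exact ⟨h2.trans h2'.symm, Bool.eq_iff_iff.mpr (h3.trans h3'.symm)⟩

theorem Valid.Γ_nonneg (hS : S.Valid) {u v : Fin m} {w : ℝ} (h : S.Γ u v w false) : 0 ≤ w :=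
  hS.pot_valid u v w (.inl h)

theorem mem_N_of_Γ {u v : Fin m} {w : ℝ} (h : S.Γ u v w true) : u ∈ S.N := by
  obtain ⟨w₀, h1, -, h3⟩ := h
  exact ⟨v, w₀, h1, h3.mp rfl⟩

theorem exists_Γ_of_mem_N {u : Fin m} (h : u ∈ S.N) : ∃ v w, S.Γ u v w true := by
  obtain ⟨v, w₀, h1, h2⟩ := h
  exact ⟨v, _, w₀, h1, rfl, by simp [h2]⟩

theorem Valid.Γ_neg_unique (hS : S.Valid) {u v u' v' : Fin m} {w w' : ℝ} (h : S.Γ u v w true)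
    (h' : S.Γ u' v' w' true) (he : u = u' ∨ v = v') : u = u' ∧ v = v' ∧ w = w' := by
  have h0 := h
  have h0' := h'
  obtain ⟨w₀, h1, h2, h3⟩ := h
  obtain ⟨w₁, h1', h2', h3'⟩ := h'
  obtain ⟨rfl, rfl⟩ := hS.one_neg _ _ _ _ _ _ h1 (h3.mp rfl) h1' (h3'.mp rfl) (by tauto)
  exact ⟨rfl, rfl, (Γ_unique h0 h0').1⟩

theorem Valid.Γ_neg_base (hS : S.Valid) {u v : Fin m} {w : ℝ} (h : S.Γ u v w true) :
    S.base u = u ∧ S.base v = v := by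
  obtain ⟨w₀, h1, -, h3⟩ := h
  exact hS.neg_base u v w₀ h1 (h3.mp rfl)

theorem Valid.base_of_mem_N (hS : S.Valid) {r : Fin m} (hr : r ∈ S.N) : S.base r = r := by
  obtain ⟨v, w, h⟩ := exists_Γ_of_mem_N hr
  exact (hS.Γ_neg_base h).1

theorem Valid.Γ_of_neg (hS : S.Valid) {r r' v : Fin m} {w x : ℝ} {b : Bool} (h : S.Γ r r' w true)
    (h' : S.Γ r v x b) : v = r' := by
  obtain ⟨w₀, h1, -, h3⟩ := h
  obtain ⟨w₁, h1', -, -⟩ := h'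
  exact hS.neg_single r r' w₀ v w₁ h1 (h3.mp rfl) h1'

theorem Valid.shiftΓ_base (hS : S.Valid) {v : Fin m} (h : S.base v = v) : S.shiftΓ v = 0 := by
  have := hS.shift_base v
  rw [h] at this
  simp [shiftΓ, h, this]

theorem Γ_sub_H {s t : Fin m} {x : ℝ} {k : ℕ} (h : Walk S.Γ s t x k) : Walk S.H s t x k :=
  h.mono fun _ _ _ _ h => .inl h

/-- In `H` one can move to any other copy of a vertex, by at most one negative edge. -/
theorem exists_walk_copy {u v : Fin m} (h : S.base u = S.base v) :
    ∃ k ≤ 1, Walk S.H u v (S.shiftΓ v - S.shiftΓ u) k := by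
  classical
  refine ⟨(decide (S.shift v - S.shift u < 0)).toNat, Bool.toNat_le _, Walk.single (.inr ⟨h, ?_, ?_⟩)⟩
  · simp only [shiftΓ, h]
    ring
  · simp

/-- Only negative edges decrease the weight, each by at most the sum `c` of all absolute weights.
Hence hop distances in Γ are never -∞, and `toReal` is faithful to every hop distance that is not
+∞. -/
theorem exists_lower_bound (hS : S.Valid) :
    ∃ c : ℝ, 0 ≤ c ∧ ∀ s t x k, Walk S.Γ s t x k → -(c * k) ≤ x := by
  refine ⟨∑ u, ∑ v, |(S.wt u v).getD 0 + S.pot u - S.pot v|,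
    Finset.sum_nonneg fun _ _ => Finset.sum_nonneg fun _ _ => abs_nonneg _, ?_⟩
  set c := ∑ u, ∑ v, |(S.wt u v).getD 0 + S.pot u - S.pot v|
  intro s t x k h
  induction h with
  | nil => simp
  | @cons u v t w x b k he _ ih =>
    cases b
    · have := hS.Γ_nonneg he
      simp only [Bool.toNat_false, zero_add]
      linarith
    · obtain ⟨w₀, h1, rfl, -⟩ := he
      have h2 : |w₀ + S.pot u - S.pot v| ≤ c := by
        have h3 : |w₀ + S.pot u - S.pot v| = |(S.wt u v).getD 0 + S.pot u - S.pot v| := by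
          simp [h1]
        rw [h3]
        refine le_trans ?_ (Finset.single_le_sum (f := fun u => ∑ v, |(S.wt u v).getD 0 + S.pot u - S.pot v|)
          (fun _ _ => Finset.sum_nonneg fun _ _ => abs_nonneg _) (Finset.mem_univ u))
        exact Finset.single_le_sum (f := fun v => |(S.wt u v).getD 0 + S.pot u - S.pot v|)
          (fun _ _ => abs_nonneg _) (Finset.mem_univ v)
      have := neg_abs_le (w₀ + S.pot u - S.pot v)
      simp only [Bool.toNat_true]
      push_cast
      linarith

theorem Valid.hopDist_ne_bot (hS : S.Valid) (h : ℕ) (s t : Fin m) : hopDist S.Γ h s t ≠ ⊥ := by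
  obtain ⟨c, hc, hb⟩ := exists_lower_bound hS
  have : ((-(c * h) : ℝ) : EReal) ≤ hopDist S.Γ h s t := by
    refine le_iInf fun x => le_iInf fun k => le_iInf fun ⟨hw, hk⟩ => ?_
    have h1 := hb _ _ _ _ hw
    have h2 : c * k ≤ c * h := mul_le_mul_of_nonneg_left (by exact_mod_cast hk) hc
    exact_mod_cast (show -(c * h) ≤ x by linarith)
  exact ne_bot_of_le_ne_bot (EReal.coe_ne_bot _) this

theorem Valid.hopDist_toReal (hS : S.Valid) {h : ℕ} {s t : Fin m} (ht : hopDist S.Γ h s t ≠ ⊤) :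
    ((hopDist S.Γ h s t).toReal : EReal) = hopDist S.Γ h s t :=
  EReal.coe_toReal ht (hS.hopDist_ne_bot h s t)

theorem Valid.exists_walk_lt (hS : S.Valid) {h : ℕ} {s t : Fin m} (ht : hopDist S.Γ h s t ≠ ⊤)
    {y : ℝ} (hy : (hopDist S.Γ h s t).toReal < y) : ∃ x k, Walk S.Γ s t x k ∧ k ≤ h ∧ x < y := by
  have : hopDist S.Γ h s t < (y : EReal) := by
    rw [← hS.hopDist_toReal ht]
    exact_mod_cast hy
  obtain ⟨x, k, hw, hk, hx⟩ := exists_walk_of_hopDist_lt this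
  exact ⟨x, k, hw, hk, by exact_mod_cast hx⟩

theorem Valid.toReal_le (hS : S.Valid) {h k : ℕ} {s t : Fin m} {x : ℝ} (hw : Walk S.Γ s t x k)
    (hk : k ≤ h) : (hopDist S.Γ h s t).toReal ≤ x := by
  have h1 := hopDist_le hw hk
  rw [← hS.hopDist_toReal (ne_top_of_le_ne_top (EReal.coe_ne_top _) h1)] at h1
  exact_mod_cast h1

theorem hopDist_ne_top_of_vOut {r v : Fin m} (h : v ∈ S.vOut r) : hopDist S.Γ 1 r v ≠ ⊤ := by
  have h2 := h.2
  split_ifs at h2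
  · exact h2.ne_top
  · exact ne_top_of_le_ne_top (EReal.coe_ne_top _) h2

theorem hopDist_ne_top_of_vIn {r v : Fin m} (h : v ∈ S.vIn r) : hopDist S.Γ 0 v r ≠ ⊤ := by
  have h2 := h.2
  split_ifs at h2
  · exact ne_top_of_le_ne_top (EReal.coe_ne_top _) h2
  · exact h2.ne_top

/-- The weight of an edge (S2) is approximated by walks in `Γ`. -/
theorem Valid.s2_walk (hS : S.Valid) {r v : Fin m} {w y : ℝ} (h : S.s2 r v w) (hy : w < y) :
    ∃ x k, Walk S.Γ r v x k ∧ k ≤ 1 ∧ x + S.Δ r < y := by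
  obtain ⟨h1, rfl⟩ := h
  have ht : hopDist S.Γ 1 r v ≠ ⊤ := by
    rcases h1 with h1 | ⟨x, hx⟩
    · exact hopDist_ne_top_of_vOut h1
    · exact ne_top_of_le_ne_top (EReal.coe_ne_top _) (hopDist_le (Walk.single hx) le_rfl)
  obtain ⟨x, k, hw, hk, hx⟩ := hS.exists_walk_lt ht (y := y - S.Δ r) (by linarith)
  exact ⟨x, k, hw, hk, by linarith⟩

/-- The weight of an edge (S3) is approximated by walks in `Γ`. -/
theorem Valid.s3_walk (hS : S.Valid) {r v : Fin m} {w y : ℝ} (h : S.s3 v r w) (hy : w < y) :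
    ∃ x, Walk S.Γ v r x 0 ∧ x - S.Δ r < y := by
  obtain ⟨h1, rfl⟩ := h
  have ht : hopDist S.Γ 0 v r ≠ ⊤ := by
    rcases h1 with h1 | rfl
    · exact hopDist_ne_top_of_vIn h1
    · exact ne_top_of_le_ne_top (EReal.coe_ne_top _) (hopDist_le (Walk.nil v) le_rfl)
  obtain ⟨x, k, hw, hk, hx⟩ := hS.exists_walk_lt ht (y := y + S.Δ r) (by linarith)
  obtain rfl : k = 0 := by omega
  exact ⟨x, hw, by linarith⟩

/-- The two walks together form a walk from `r` that uses its own endpoint, and its weight would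
violate the threshold for vertices outside the search set. -/
theorem Searched.mem_sOut (hS : S.Searched) {r v t : Fin m} (hr : r ∈ S.N) {x y : ℝ} {k l : ℕ}
    (h : Walk S.H r v x k) (h' : Walk S.H v t y l) (hk : k + l ≤ 2) (hx : x + y < - S.Δ r) :
    t ∈ S.sOut r := by
  by_contra ht
  have := hS.out_not_mem r hr t ht (x + y) ⟨t, _, _, 0, 0, h.append h', .nil t, by omega, by ring⟩
  linarith

theorem Searched.mem_sIn (hS : S.Searched) {r v s : Fin m} (hr : r ∈ S.N) {x y : ℝ} {k l : ℕ}
    (h : Walk S.H s v x k) (h' : Walk S.H v r y l) (hk : k + l ≤ 1) (hx : x + y < S.Δ r) :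
    s ∈ S.sIn r := by
  by_contra ht
  have := hS.in_not_mem r hr s ht (x + y) ⟨s, 0, 0, _, _, .nil s, h.append h', by omega, by ring⟩
  linarith

/-! ### The invariant on edges of `G'_{τ+1}` -/

/-- The base vertex of a vertex of `G'_{τ+1}`. -/
def base₀ : S.SV → S.SV
  | .inl v => .inl (S.base v)
  | .inr r => .inr r

/-- The shift of a vertex of `G'_{τ+1}`. -/
def shift₀ : S.SV → ℝ
  | .inl v => S.shiftΓ v
  | .inr _ => 0

theorem aug_dist_le {a b : S.SV} {w : ℝ} (h : S.aug a b w) :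
    dist (mark S.aug) a b ≤ (w : EReal) := by
  classical
  exact (Walk.single (b := decide (w < 0)) ⟨h, by simp⟩).dist_le

/-- The invariant of G_τ is witnessed by walks between base vertices. In Γ their weights change by
the potentials of these base vertices, which is what the modified shifts account for. -/
theorem Valid.Γ_dist_le (hS : S.Valid) {u v : Fin m} {w : ℝ} {b : Bool} (h : S.Γ u v w b) :
    dist (mark S.aug) (.inl (S.base u)) (.inl (S.base v)) ≤
      ((w - S.shiftΓ v + S.shiftΓ u : ℝ) : EReal) := by
  classical
  obtain ⟨w₀, h1, rfl, -⟩ := h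
  have h2 := dist_le_iff.mp (hS.edge_ge u v w₀ h1)
  refine dist_le_iff.mpr fun ε hε => ?_
  obtain ⟨x, k, hw, hx⟩ := h2 ε hε
  obtain ⟨k', hk'⟩ := hw.map (F := mark S.aug) (f := Sum.inl) S.pot (by
    rintro a c y b ⟨hy, -⟩
    exact ⟨decide (y + S.pot a - S.pot c < 0),
      .inl ⟨decide (y < 0), y, hy, rfl, by simp⟩, by simp⟩)
  refine ⟨_, _, hk', ?_⟩
  simp only [shiftΓ]
  linarith

theorem Valid.walk_dist_le (hS : S.Valid) {u v : Fin m} {x : ℝ} {k : ℕ} (h : Walk S.Γ u v x k) :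
    dist (mark S.aug) (.inl (S.base u)) (.inl (S.base v)) ≤
      ((x - S.shiftΓ v + S.shiftΓ u : ℝ) : EReal) := by
  induction h with
  | nil v => simpa using (Walk.nil (E := mark S.aug) (.inl (S.base v))).dist_le
  | cons he _ ih => exact dist_le_trans (hS.Γ_dist_le he) ih (by ring)

/-- Edges between base vertices bound the distance by themselves. For a Steiner edge at a proper
copy, a walk approximating its weight is projected to base vertices and completed by one of the
edges (r̃,r') and (r,r̃), which are always present. -/
theorem Valid.aug_ge (hS : S.Valid) {a b : S.SV} {w : ℝ} (h : S.aug a b w) :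
    dist (mark S.aug) (base₀ a) (base₀ b) ≤ ((w - shift₀ b + shift₀ a : ℝ) : EReal) := by
  have h0 := h
  match a, b, h with
  | .inl u, .inl v, h =>
    have key : S.base u = u → S.base v = v → dist (mark S.aug) (.inl (S.base u)) (.inl (S.base v)) ≤
        ((w - S.shiftΓ v + S.shiftΓ u : ℝ) : EReal) := by
      intro hu hv
      rw [hS.shiftΓ_base hu, hS.shiftΓ_base hv, hu, hv, sub_zero, add_zero]
      exact aug_dist_le h0
    rcases h with ⟨b, h⟩ | ⟨hu, v', -, x, hx, -⟩ | ⟨r, u', -, x, y, hx, hy, -⟩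
    · exact hS.Γ_dist_le h
    · exact key (hS.base_of_mem_N hu) (hS.Γ_neg_base hx).2
    · exact key (hS.Γ_neg_base hx).1 (hS.Γ_neg_base hy).2
  | .inr r, .inl v, h =>
    by_cases hv : S.base v = v
    · simp only [base₀, shift₀, hv, hS.shiftΓ_base hv, sub_zero, add_zero]
      exact aug_dist_le h0
    · obtain ⟨r', x₀, hr'⟩ := exists_Γ_of_mem_N r.2
      have hb := (hS.Γ_neg_base hr').2
      have e1 : dist (mark S.aug) (.inr r) (.inl r') ≤ ((x₀ + S.Δ r : ℝ) : EReal) := by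
        refine (aug_dist_le (S := S) (a := .inr r) (b := .inl r') ⟨.inr ⟨_, hr'⟩, rfl⟩).trans ?_
        have := hS.toReal_le (Walk.single hr') (h := 1) le_rfl
        exact_mod_cast add_le_add_left this _
      refine dist_le_iff.mpr fun ε hε => ?_
      obtain ⟨x, k, hw, hk, hx⟩ := hS.s2_walk h (y := w + ε / 2) (by linarith)
      cases hw with
      | nil => exact absurd (hS.base_of_mem_N r.2) hv
      | @cons _ v₁ _ w₁ x₁ b₁ k₁ he hw =>
        -- Since (r,r') is the only edge out of r, the walk starts with it. The rest of the walk
        -- starts at the base vertex r' and can be preceded by (r̃,r').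
        obtain rfl := hS.Γ_of_neg hr' he
        obtain ⟨rfl, -⟩ := Γ_unique hr' he
        have e2 := hS.walk_dist_le hw
        rw [hb, hS.shiftΓ_base hb] at e2
        obtain ⟨y, l, hy, hlt⟩ := dist_le_iff.mp (dist_le_trans e1 e2 rfl) (ε / 2) (by linarith)
        refine ⟨y, l, hy, ?_⟩
        simp only [shift₀]
        linarith
  | .inl v, .inr r, h =>
    have hb := hS.base_of_mem_N r.2
    have e1 : dist (mark S.aug) (.inl r) (.inr r) ≤ ((- S.Δ r : ℝ) : EReal) := by
      refine (aug_dist_le (S := S) (a := .inl r) (b := .inr r) ⟨.inr rfl, rfl⟩).trans ?_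
      have := hS.toReal_le (Walk.nil (E := S.Γ) r) (h := 0) le_rfl
      exact_mod_cast (show _ - S.Δ r ≤ - S.Δ r by linarith)
    refine dist_le_iff.mpr fun ε hε => ?_
    obtain ⟨x, hw, hx⟩ := hS.s3_walk h (y := w + ε / 2) (by linarith)
    have e2 := hS.walk_dist_le hw
    rw [hb, hS.shiftΓ_base hb] at e2
    obtain ⟨y, l, hy, hlt⟩ := dist_le_iff.mp (dist_le_trans e2 e1 rfl) (ε / 2) (by linarith)
    refine ⟨y, l, hy, ?_⟩
    simp only [shift₀]
    linarith


/-! ### The edges of the output graph -/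

/-- The edges of `G'_{τ+1}`, reversed if `d = true`. -/
def augD (S : Stage m) : Bool → S.SV → S.SV → ℝ → Prop
  | false, a, b, w => S.aug a b w
  | true, a, b, w => S.aug b a w

/-- The shifts of `Γ`, negated if `d = true`. -/
def shiftD (S : Stage m) : Bool → Fin m → ℝ
  | false, v => S.shiftΓ v
  | true, v => - S.shiftΓ v

/-- The search sets of the first (`d = false`) and the second (`d = true`) phase. -/
def search (S : Stage m) : Bool → Fin m → Finset (Fin m)
  | false, r => S.sOut r
  | true, r => S.sIn r

/-- The weight `w` belongs to an imaginary edge, if it is that of an edge between `a` and `b`. -/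
def ImagD (a b : S.SV) (w : ℝ) : Prop := w < 0 ∧ (a.isRight = true ∨ b.isRight = true)

/-- `G` holds the edges of `G'_{τ+1}`, in direction `d`, and the sizes of the search sets. -/
structure Codes (S : Stage m) (d : Bool) (G : Inst) : Prop where
  m_eq : G.m = m
  decode : ∀ i < G.M, ∃ a b, G.src i = S.code a ∧ G.dst i = S.code b ∧ S.augD d a b (G.wt i)
  encode : ∀ a b x, S.augD d a b x → ∃ i < G.M, G.src i = S.code a ∧ G.dst i = S.code b ∧ G.wt i = x
  inj : ∀ i < G.M, ∀ j < G.M, G.src i = G.src j → G.dst i = G.dst j → G.wt i = G.wt j → i = j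
  base_eq : ∀ v : Fin m, G.base v = S.base v
  P_eq : ∀ v : Fin m, G.P v = S.shiftD d v
  cnt_eq : ∀ r : {r : Fin m // r ∈ S.N}, (∃ i < G.M, G.src i = S.code (.inr r)) →
    G.cnt r.1 = (S.search d r.1).card

theorem code_lt (a : S.SV) : S.code a < 2 * m := by
  rcases a with v | r
  · have := v.2
    show (v : ℕ) < 2 * m
    omega
  · have := r.1.2
    show m + (r.1 : ℕ) < 2 * m
    omega

theorem code_injective : Function.Injective S.code := by
  rintro (u | r) (v | r') h
  · have h : (u : ℕ) = v := h
    rw [Fin.ext h]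
  · have h : (u : ℕ) = m + r'.1 := h
    have := u.2
    omega
  · have h : m + (r.1 : ℕ) = v := h
    have := v.2
    omega
  · have h : m + (r.1 : ℕ) = m + r'.1 := h
    rw [Subtype.ext (Fin.ext (Nat.add_left_cancel h))]

theorem codeOut_injective (q : ℕ) : Function.Injective (S.codeOut q) := by
  rintro (a | i) (b | j) h
  · have h : S.code a = S.code b := h
    rw [code_injective h]
  · have h : S.code a = 2 * m + j := h
    have := code_lt a
    omega
  · have h : 2 * m + (i : ℕ) = S.code b := h
    have := code_lt b
    omega
  · have h : 2 * m + (i : ℕ) = 2 * m + j := h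
    rw [Fin.ext (Nat.add_left_cancel h)]

theorem code_lt_iff (a : S.SV) : S.code a < m ↔ a.isRight = false := by
  rcases a with v | r
  · simp [code]
  · simp [code]

theorem augD_false {a b : S.SV} {w : ℝ} : S.augD false a b w = S.aug a b w := rfl

theorem augD_true {a b : S.SV} {w : ℝ} : S.augD true a b w = S.aug b a w := rfl

theorem augD_right_right (d : Bool) (r r' : {r : Fin m // r ∈ S.N}) (w : ℝ) :
    ¬ S.augD d (.inr r) (.inr r') w := by
  cases d <;> exact id

/-- The edges that a phase outputs: `copy v` is the new copy of the base vertex of `v`, and `D v` is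
its shift in the direction of the phase. -/
inductive NewEdge (S : Stage m) (d : Bool) {q : ℕ} (copy : Fin m → Fin q) (D : Fin m → ℝ) :
    S.SV ⊕ Fin q → S.SV ⊕ Fin q → ℝ → Prop
  | keep {a b : S.SV} {x : ℝ} (h : S.augD d a b x) (hi : ¬ ImagD a b x) :
      NewEdge S d copy D (.inl a) (.inl b) x
  | fromCopy {v : Fin m} {c : S.SV} {x : ℝ} (h : S.augD d (.inl v) c x)
      (h0 : 0 ≤ x + S.shiftD d v - D v) :
      NewEdge S d copy D (.inr (copy v)) (.inl c) (x + S.shiftD d v - D v)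
  | toCopy {r : {r : Fin m // r ∈ S.N}} {v : Fin m} {x : ℝ} (h : S.augD d (.inr r) (.inl v) x)
      (h0 : 0 ≤ x - S.shiftD d v + D v) :
      NewEdge S d copy D (.inl (.inr r)) (.inr (copy v)) (x - S.shiftD d v + D v)
  | pair {a b c : S.SV} {x y : ℝ} (h : S.augD d a b x) (h' : S.augD d b c y) (h0 : 0 ≤ x + y) :
      NewEdge S d copy D (.inl a) (.inl c) (x + y)

/-! ### From the emitted triples of numbers to edges of the output graph -/

section phase
variable {d : Bool} {G : Inst} {D : ℕ → ℝ} {q : ℕ} {copy : Fin m → Fin q}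

theorem Codes.cls_eq_zero_iff (hG : S.Codes d G) {i : ℕ} {a b : S.SV} (ha : G.src i = S.code a)
    (hb : G.dst i = S.code b) : G.cls i = 0 ↔ ¬ ImagD a b (G.wt i) := by
  have h1 := code_lt_iff a
  have h2 := code_lt_iff b
  unfold Inst.cls ImagD
  simp only [ha, hb, hG.m_eq, h1, h2]
  by_cases h3 : G.wt i < 0
  · cases h4 : a.isRight <;> cases h5 : b.isRight <;> simp [h3] <;> (split_ifs <;> simp)
  · simp [h3]

/-- Only imaginary edges from a Steiner vertex with a small search set to an ordinary vertex are
redirected. -/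
theorem Codes.cls_ne_two (hG : S.Codes d G) {i : ℕ} {a b : S.SV} (ha : G.src i = S.code a)
    (hb : G.dst i = S.code b) (h : G.cls i = 2) : a.isRight = true ∧ b.isRight = false ∧
      G.wt i < 0 ∧ G.cnt (G.src i - m) * G.cnt (G.src i - m) * G.cnt (G.src i - m) < m * m := by
  have h1 := code_lt_iff a
  have h2 := code_lt_iff b
  unfold Inst.cls at h
  simp only [hb, hG.m_eq, h2] at h
  rw [← Bool.not_eq_false, ← h1, ← ha]
  split_ifs at h with h3 h4 h5 h6 <;> first | omega | exact ⟨h5, h4, h3, h6⟩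

/-- That `D` dominates is needed only for the edges into the new copies, which are emitted without a
test of their sign. -/
theorem Codes.newEdge_of_mem (hG : S.Codes d G)
    (hcopy : ∀ v : Fin m, G.copy v = 2 * m + copy v) (hshift : G.IsShift D) {e : ℕ × ℕ × ℝ}
    (he : e ∈ G.newEdges D) : ∃ a b x, NewEdge S d copy (fun v => D (S.base v)) a b x ∧
      e = (S.codeOut q a, S.codeOut q b, x) := by
  obtain ⟨j, hj, h⟩ := he
  obtain ⟨a, b, ha, hb, hab⟩ := hG.decode j hj
  rcases h with (⟨h, rfl⟩ | ⟨h, h0, rfl⟩) | (⟨h, rfl⟩ | ⟨i, hi, h0, rfl⟩)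
  · exact ⟨.inl a, .inl b, _, .keep hab ((hG.cls_eq_zero_iff ha hb).mp h), by
      rw [ha, hb]; rfl⟩
  · rw [ha, hG.m_eq, code_lt_iff] at h
    rcases a with v | r
    · have e1 : G.src j = v := ha
      rw [Inst.copyWt, e1, hG.P_eq, hG.base_eq] at h0 ⊢
      exact ⟨_, _, _, .fromCopy hab h0, by rw [hb, hcopy]; rfl⟩
    · simp at h
  · have h0 := (hshift j hj h).1
    obtain ⟨h1, h2, -, -⟩ := hG.cls_ne_two ha hb h
    rcases a with v | r
    · simp at h1
    rcases b with v | r'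
    · have e1 : G.dst j = v := hb
      rw [e1, hG.P_eq, hG.base_eq] at h0 ⊢
      exact ⟨_, _, _, .toCopy hab (by linarith), by rw [ha, hcopy]; rfl⟩
    · simp at h2
  · have hi' : i < G.M ∧ G.src i = G.dst j := by
      unfold Inst.partners at hi
      split_ifs at hi
      · exact ⟨(mem_sel.mp hi).1, (mem_sel.mp hi).2.1⟩
      · exact ⟨(mem_sel.mp hi).1, (mem_sel.mp hi).2.1⟩
      · simp at hi
    obtain ⟨b', c, hb', hc, hbc⟩ := hG.decode i hi'.1
    obtain rfl : b = b' := code_injective (by rw [← hb, ← hb', hi'.2])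
    exact ⟨.inl a, .inl c, _, .pair hab hbc h0, by rw [ha, hc]; rfl⟩

theorem Codes.keep_mem (hG : S.Codes d G) {a b : S.SV} {x : ℝ} (h : S.augD d a b x)
    (hi : ¬ ImagD a b x) : (S.code a, S.code b, x) ∈ G.newEdges D := by
  obtain ⟨i, hiM, ha, hb, rfl⟩ := hG.encode a b x h
  exact ⟨i, hiM, .inl (.inl ⟨(hG.cls_eq_zero_iff ha hb).mpr hi, by rw [ha, hb]⟩)⟩

/-- Paths whose first edge is imaginary are shortcut. -/
theorem Codes.shortcut_mem (hG : S.Codes d G) (hshift : G.IsShift D) {a b c : S.SV} {x y : ℝ}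
    (h : S.augD d a b x) (hi : ImagD a b x) (h' : S.augD d b c y) (h0 : 0 ≤ x + y) :
    (S.code a, S.code c, x + y) ∈ G.newEdges D ∨ ∃ v : Fin m, ∃ z₁ z₂, 0 ≤ z₁ ∧ 0 ≤ z₂ ∧
      z₁ + z₂ = x + y ∧ (S.code a, G.copy v, z₁) ∈ G.newEdges D ∧
      (G.copy v, S.code c, z₂) ∈ G.newEdges D := by
  obtain ⟨i, hiM, ha, hb, rfl⟩ := hG.encode a b x h
  obtain ⟨j, hjM, hb', hc, rfl⟩ := hG.encode b c y h'
  have h2 : G.cls i ≠ 0 := fun h0 => (hG.cls_eq_zero_iff ha hb).mp h0 hi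
  have hpart : j ∈ G.partners D i → (S.code a, S.code c, G.wt i + G.wt j) ∈ G.newEdges D := fun hp =>
    ⟨i, hiM, .inr (.inr ⟨j, hp, h0, by rw [ha, hc]⟩)⟩
  by_cases h1 : G.cls i = 1
  · left
    apply hpart
    rw [Inst.partners, if_pos h1, mem_sel]
    exact ⟨hjM, hb'.trans hb.symm, trivial⟩
  have h3 : G.cls i = 2 := by
    have := G.cls_lt i
    omega
  by_cases hl : G.IsLow D j
  · left
    apply hpart
    rw [Inst.partners, if_neg h1, if_pos h3, mem_sel]
    exact ⟨hjM, hb'.trans hb.symm, hl⟩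
  · right
    obtain ⟨-, h4, -, -⟩ := hG.cls_ne_two ha hb h3
    rcases b with v | r
    · have hs := (hshift i hiM h3).1
      have e1 : G.dst i = v := hb
      have e2 : G.src j = v := hb'
      have hv : G.src j < G.m := by
        rw [e2, hG.m_eq]
        exact v.2
      have h5 : 0 ≤ G.copyWt D j := not_lt.mp fun h => hl ⟨hv, h⟩
      -- The head of `i` and the tail of `j` are both `v`, so the terms in `P` and `D` cancel in the
      -- sum of the two weights.
      refine ⟨v, G.wt i - G.P (G.dst i) + D (G.base (G.dst i)), _, ?_, h5, ?_, ⟨i, hiM, .inr (.inl ⟨h3, ?_⟩)⟩,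
        ⟨j, hjM, .inl (.inr ⟨hv, h5, ?_⟩)⟩⟩
      · linarith
      · rw [Inst.copyWt, e1, e2]
        ring
      · rw [e1, ha]
      · rw [e2, hc]
    · simp at h4

end phase

/-! ### The output graph -/

section good
variable {q : ℕ} {base' : Fin q → Fin m} {shift' : Fin q → ℝ} {copy : Bool → Fin m → Fin q}
  {D : Bool → Fin m → ℝ}

/-- The invariant on edges, for an edge from `a` to `b` (`d = false`) or from `b` to `a`. -/
def InvD (O : S.Out) : Bool → S.SV ⊕ Fin O.q → S.SV ⊕ Fin O.q → ℝ → Prop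
  | false, a, b, w => dist (mark S.aug) (O.baseOf a) (O.baseOf b) ≤
      ((w - O.shiftOf b + O.shiftOf a : ℝ) : EReal)
  | true, a, b, w => dist (mark S.aug) (O.baseOf b) (O.baseOf a) ≤
      ((w - O.shiftOf a + O.shiftOf b : ℝ) : EReal)

theorem Out.baseOf_inl (O : S.Out) (a : S.SV) : O.baseOf (.inl a) = base₀ a := by
  rcases a with v | r <;> rfl

theorem Out.shiftOf_inl (O : S.Out) (a : S.SV) : O.shiftOf (.inl a) = shift₀ a := by
  rcases a with v | r <;> rfl

/-- Moving an end of an edge to the new copy leaves its base vertex unchanged and replaces the old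
shift by the new one in the weight, so the invariant is carried over whatever `D` is. For combined
edges it is the triangle inequality, with the middle shift cancelling. -/
theorem NewEdge.inv (hS : S.Valid) (O : S.Out) {d : Bool} {copy : Fin m → Fin O.q} {D : Fin m → ℝ}
    (hb : ∀ v, O.newBase (copy v) = S.base v)
    (hD : ∀ v, O.newShift (copy v) = cond d (- D v) (D v)) {a b : S.SV ⊕ Fin O.q} {w : ℝ}
    (h : NewEdge S d copy D a b w) : InvD O d a b w := by
  have hb' : ∀ v, O.baseOf (.inr (copy v)) = .inl (S.base v) := fun v => by
    rw [← hb v]; rfl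
  have hD' : ∀ v, O.shiftOf (.inr (copy v)) = cond d (- D v) (D v) := hD
  cases h with
  | keep h hi =>
    cases d
    · have := hS.aug_ge h
      simpa only [InvD, Out.baseOf_inl, Out.shiftOf_inl] using this
    · have := hS.aug_ge h
      simpa only [InvD, Out.baseOf_inl, Out.shiftOf_inl] using this
  | fromCopy h h0 =>
    cases d
    · rw [augD_false] at h
      have h2 := hS.aug_ge h
      simp only [base₀, shift₀] at h2
      simp only [InvD, hb', hD', Out.baseOf_inl, Out.shiftOf_inl, shiftD, cond_false, base₀, shift₀]
      refine h2.trans (le_of_eq ?_)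
      congr 1
      ring
    · rw [augD_true] at h
      have h2 := hS.aug_ge h
      simp only [base₀, shift₀] at h2
      simp only [InvD, hb', hD', Out.baseOf_inl, Out.shiftOf_inl, shiftD, cond_true, base₀, shift₀]
      refine h2.trans (le_of_eq ?_)
      congr 1
      ring
  | toCopy h h0 =>
    cases d
    · rw [augD_false] at h
      have h2 := hS.aug_ge h
      simp only [base₀, shift₀] at h2
      simp only [InvD, hb', hD', Out.baseOf_inl, Out.shiftOf_inl, shiftD, cond_false, base₀, shift₀]
      refine h2.trans (le_of_eq ?_)
      congr 1
      ring
    · rw [augD_true] at h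
      have h2 := hS.aug_ge h
      simp only [base₀, shift₀] at h2
      simp only [InvD, hb', hD', Out.baseOf_inl, Out.shiftOf_inl, shiftD, cond_true, base₀, shift₀]
      refine h2.trans (le_of_eq ?_)
      congr 1
      ring
  | pair h h' h0 =>
    cases d
    · simp only [InvD, Out.baseOf_inl, Out.shiftOf_inl]
      exact dist_le_trans (hS.aug_ge h) (hS.aug_ge h') (by ring)
    · simp only [InvD, Out.baseOf_inl, Out.shiftOf_inl]
      exact dist_le_trans (hS.aug_ge h') (hS.aug_ge h) (by ring)

theorem NewEdge.neg {q : ℕ} {d : Bool} {copy : Fin m → Fin q} {D : Fin m → ℝ} {a b : S.SV ⊕ Fin q}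
    {w : ℝ} (h : NewEdge S d copy D a b w) (hw : w < 0) :
    ∃ a' b', a = .inl a' ∧ b = .inl b' ∧ S.augD d a' b' w ∧ ¬ ImagD a' b' w := by
  cases h with
  | keep h hi => exact ⟨_, _, rfl, rfl, h, hi⟩
  | fromCopy h h0 => exact absurd hw (not_lt.mpr h0)
  | toCopy h h0 => exact absurd hw (not_lt.mpr h0)
  | pair h h' h0 => exact absurd hw (not_lt.mpr h0)

theorem ImagD.symm {a b : S.SV} {w : ℝ} (h : ImagD a b w) : ImagD b a w := ⟨h.1, h.2.symm⟩

theorem walk_of_mem {O : S.Out} {a b c : S.SV ⊕ Fin O.q} {x y z : ℝ} (h : O.E a b x)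
    (h' : O.E b c y) (hx : 0 ≤ x) (hy : 0 ≤ y) (hz : x + y = z) : Walk (mark O.E) a c z 0 := by
  subst hz
  simpa using Walk.cons (b := false) (E := mark O.E) ⟨h, by simp [hx]⟩
    (Walk.single (b := false) ⟨h', by simp [hy]⟩)

/-- All properties of the output follow from the set of emitted edges. The first phase shortcuts
paths whose first edge is imaginary, the second those whose second edge is. Each phase owns one copy
of a base vertex, hence at most two. The edges of G'_{τ+1} that are not imaginary are kept already
by the first phase, and every other emitted edge carries a proof of non-negativity. -/
theorem good_of_newEdges (hS : S.Valid) (O : S.Out) (G : Bool → Inst) (D : Bool → ℕ → ℝ)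
    (copy : Bool → Fin m → Fin O.q) (out : Set (ℕ × ℕ × ℝ)) (hG : ∀ d, S.Codes d (G d))
    (hshift : ∀ d, (G d).IsShift (D d))
    (hcopy : ∀ d, ∀ v : Fin m, (G d).copy v = 2 * m + copy d v)
    (hbase : ∀ d v, O.newBase (copy d v) = S.base v)
    (hD : ∀ d v, O.newShift (copy d v) = cond d (- D d (S.base v)) (D d (S.base v)))
    (hsurj : ∀ j, ∃ d v, S.base v = v ∧ j = copy d v)
    (hout : out = orient false '' (G false).newEdges (D false) ∪
      orient true '' (G true).newEdges (D true))
    (hE : ∀ a b x, O.E a b x ↔ (S.codeOut O.q a, S.codeOut O.q b, x) ∈ out) :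
    O.Good ∧ ∀ e ∈ out, ∃ a b, e.1 = S.codeOut O.q a ∧ e.2.1 = S.codeOut O.q b := by
  have hnew : ∀ d, ∀ e ∈ (G d).newEdges (D d), ∃ a b x,
      NewEdge S d (copy d) (fun v => D d (S.base v)) a b x ∧
        e = (S.codeOut O.q a, S.codeOut O.q b, x) := fun d e he =>
    (hG d).newEdge_of_mem (hcopy d) (hshift d) he
  have hmem : ∀ a b x, O.E a b x → NewEdge S false (copy false) (fun v => D false (S.base v)) a b x ∨
      NewEdge S true (copy true) (fun v => D true (S.base v)) b a x := by
    intro a b x h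
    rw [hE, hout] at h
    rcases h with ⟨e, he, h⟩ | ⟨e, he, h⟩
    · left
      obtain ⟨a', b', x', hn, rfl⟩ := hnew _ _ he
      simp only [orient, Prod.mk.injEq] at h
      obtain ⟨h1, h2, rfl⟩ := h
      rwa [← codeOut_injective _ h1, ← codeOut_injective _ h2]
    · right
      obtain ⟨a', b', x', hn, rfl⟩ := hnew _ _ he
      simp only [orient, Prod.mk.injEq] at h
      obtain ⟨h1, h2, rfl⟩ := h
      rwa [← codeOut_injective _ h1, ← codeOut_injective _ h2]
  have hkeep : ∀ a b w, S.aug a b w → ¬ S.imaginary a b w → O.E (.inl a) (.inl b) w := by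
    intro a b w h hi
    rw [hE, hout]
    exact .inl ⟨_, (hG false).keep_mem h fun h' => hi ⟨h, h'⟩, rfl⟩
  refine ⟨⟨?_, ?_, ?_, ?_, ?_, ?_, hkeep, ?_⟩, ?_⟩
  · rintro a b c x y ⟨h, h', hi, h0⟩
    have one : O.E (.inl a) (.inl c) (x + y) → Walk (mark O.E) (.inl a) (.inl c) (x + y) 0 := by
      intro he
      simpa using Walk.single (b := false) (E := mark O.E) ⟨he, by simp [h0]⟩
    rcases hi with hi | hi
    · have h1 : S.augD false a b x := h
      have h2 : S.augD false b c y := h'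
      rcases (hG false).shortcut_mem (hshift false) h1 hi.2 h2 h0 with h3 | ⟨v, z₁, z₂, p1, p2, p3, h3, h4⟩
      · exact one ((hE _ _ _).mpr (hout ▸ .inl ⟨_, h3, rfl⟩))
      · refine walk_of_mem (b := .inr (copy false v)) ((hE _ _ _).mpr (hout ▸ .inl ⟨_, h3, ?_⟩))
          ((hE _ _ _).mpr (hout ▸ .inl ⟨_, h4, ?_⟩)) p1 p2 p3
        · rw [hcopy]; rfl
        · rw [hcopy]; rfl
    · have h1 : S.augD true b a x := h
      have h2 : S.augD true c b y := h'
      rcases (hG true).shortcut_mem (hshift true) h2 (ImagD.symm hi.2) h1 (by linarith) with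
        h3 | ⟨v, z₁, z₂, p1, p2, p3, h3, h4⟩
      · refine one ((hE _ _ _).mpr (hout ▸ .inr ⟨_, h3, ?_⟩))
        rw [add_comm x y]; rfl
      · refine walk_of_mem (b := .inr (copy true v)) ((hE _ _ _).mpr (hout ▸ .inr ⟨_, h4, ?_⟩))
          ((hE _ _ _).mpr (hout ▸ .inr ⟨_, h3, ?_⟩)) p2 p1 (by linarith)
        · rw [hcopy]; rfl
        · rw [hcopy]; rfl
  · intro j
    obtain ⟨d, v, -, rfl⟩ := hsurj j
    rw [hbase, hS.base_base]
  · intro v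
    have hsub : {j | O.newBase j = v} ⊆ {copy false v, copy true v} := by
      intro j hj
      obtain ⟨d, u, hu, rfl⟩ := hsurj j
      have h1 : O.newBase (copy d u) = v := hj
      rw [hbase, hu] at h1
      subst h1
      cases d <;> simp
    refine (Set.ncard_le_ncard hsub (Set.toFinite _)).trans ?_
    exact (Set.ncard_insert_le _ _).trans (by simp)
  · intro a b w h
    rcases hmem a b w h with h | h
    · exact h.inv hS O (hbase false) (hD false)
    · exact h.inv hS O (hbase true) (hD true)
  · intro r v w h
    exact hkeep _ _ _ (.inr (.inl h)) fun h' => by simpa using h'.2.2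
  · intro u v w h
    exact hkeep _ _ _ (.inr (.inr h)) fun h' => by simpa using h'.2.2
  · intro a b w h hw
    rcases hmem a b w h with h | h
    · obtain ⟨a', b', rfl, rfl, h1, h2⟩ := h.neg hw
      exact ⟨a', b', rfl, rfl, h1, fun h => h2 h.2⟩
    · obtain ⟨b', a', rfl, rfl, h1, h2⟩ := h.neg hw
      exact ⟨a', b', rfl, rfl, h1, fun h => h2 (ImagD.symm h.2)⟩
  · intro e he
    rw [hout] at he
    rcases he with ⟨e, he, rfl⟩ | ⟨e, he, rfl⟩
    · obtain ⟨a', b', x', hn, rfl⟩ := hnew _ _ he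
      exact ⟨a', b', rfl, rfl⟩
    · obtain ⟨a', b', x', hn, rfl⟩ := hnew _ _ he
      exact ⟨b', a', rfl, rfl⟩

end good

end Stage

/-! ### Counting -/

section counting
variable {m : ℕ}

/-- Families of sets such that few `r` have `u ∈ B r` and `v ∈ A r`, and `A r`, `B r` have almost the
same size. -/
structure Spread (A B : Fin m → Finset (Fin m)) (β : ℝ) : Prop where
  one_le : 1 ≤ β
  pair : ∀ u v, ((Finset.univ.filter fun r => u ∈ B r ∧ v ∈ A r).card : ℝ) ≤ β
  le_left : ∀ r, (A r).card ≤ (B r).card + 1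
  le_right : ∀ r, (B r).card ≤ (A r).card + 1

variable {A B : Fin m → Finset (Fin m)} {β : ℝ}

theorem Spread.symm (h : Spread A B β) : Spread B A β :=
  ⟨h.one_le, fun u v => by simpa only [and_comm] using h.pair v u, h.le_right, h.le_left⟩

theorem sum_filter_mem_card (C : Fin m → Finset (Fin m)) (p : Fin m → Prop) [DecidablePred p] :
    ∑ r with p r, ((C r).card : ℝ) = ∑ u, ((Finset.univ.filter fun r => u ∈ C r ∧ p r).card : ℝ) := by
  have h1 : ∀ r, ((C r).card : ℝ) = ∑ u, if u ∈ C r then 1 else 0 := fun r => by simp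
  have h2 : ∀ u, ((Finset.univ.filter fun r => u ∈ C r ∧ p r).card : ℝ) =
      ∑ r with p r, if u ∈ C r then 1 else 0 := fun u => by
    rw [Finset.sum_boole, Finset.filter_filter]
    simp only [and_comm]
  simp only [h1, h2]
  exact Finset.sum_comm

/-- The number of `r` with `v ∈ A r`. -/
def load (A : Fin m → Finset (Fin m)) (v : Fin m) : ℕ := (Finset.univ.filter fun r => v ∈ A r).card

theorem load_le (A : Fin m → Finset (Fin m)) (v : Fin m) : load A v ≤ m :=
  (Finset.card_filter_le _ _).trans (by simp)

theorem sum_sum_mem (A : Fin m → Finset (Fin m)) (f : Fin m → ℝ) :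
    ∑ r, ∑ v ∈ A r, f v = ∑ v, load A v * f v := by
  have : ∀ v, (load A v : ℝ) * f v = ∑ r, if v ∈ A r then f v else 0 := fun v => by
    rw [← Finset.sum_filter, Finset.sum_const, nsmul_eq_mul, load]
  simp only [this]
  rw [Finset.sum_comm]
  refine Finset.sum_congr rfl fun r _ => ?_
  rw [← Finset.sum_filter]
  simp

theorem sum_card_eq (A : Fin m → Finset (Fin m)) :
    ∑ r, ((A r).card : ℝ) = ∑ v, (load A v : ℝ) := by
  have := sum_sum_mem A fun _ => 1
  simpa using this

/-- With |B_r| in place of |A_r| the sum counts pairs (r,u) with u ∈ B_r and v ∈ A_r, at most β for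
each u. Passing to |A_r| ≤ |B_r| + 1 adds at most one for each of the at most m indices. -/
theorem Spread.sum_of_mem (h : Spread A B β) (v : Fin m) :
    ∑ r with v ∈ A r, ((A r).card : ℝ) ≤ 2 * (m * β) := by
  have h1 : ∑ r with v ∈ A r, ((B r).card : ℝ) ≤ m * β := by
    rw [sum_filter_mem_card]
    refine (Finset.sum_le_sum fun u _ => h.pair u v).trans_eq (by simp)
  have h2 : ∑ r with v ∈ A r, ((A r).card : ℝ) ≤ ∑ r with v ∈ A r, (((B r).card : ℝ) + 1) :=
    Finset.sum_le_sum fun r _ => by exact_mod_cast h.le_left r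
  have h3 : (load A v : ℝ) ≤ m := by exact_mod_cast load_le A v
  have h4 : (m : ℝ) ≤ m * β := le_mul_of_one_le_right (Nat.cast_nonneg _) h.one_le
  rw [Finset.sum_add_distrib, Finset.sum_const, nsmul_eq_mul, mul_one] at h2
  have h5 : ((Finset.univ.filter fun r => v ∈ A r).card : ℝ) = load A v := rfl
  linarith

/-- Triples (r,u,v) with u ∈ B_r and v ∈ A_r are counted by their pair (u,v), at most β for each of
the m² pairs. -/
theorem Spread.sum_mul (h : Spread A B β) :
    ∑ r, ((B r).card : ℝ) * ((A r).card + 1) ≤ 3 * ((m : ℝ) ^ 2 * β) := by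
  have h0 : ∀ r, ((B r).card : ℝ) * ((A r).card + 1) = ∑ u ∈ B r, (((A r).card : ℝ) + 1) :=
    fun r => by rw [Finset.sum_const, nsmul_eq_mul]
  have h1 : ∑ r, ((B r).card : ℝ) * ((A r).card + 1) =
      ∑ u, ∑ r with u ∈ B r, (((A r).card : ℝ) + 1) := by
    simp only [h0, Finset.sum_filter]
    rw [Finset.sum_comm]
    refine Finset.sum_congr rfl fun r _ => ?_
    rw [← Finset.sum_filter]
    simp
  rw [h1]
  have h2 : ∀ u, ∑ r with u ∈ B r, (((A r).card : ℝ) + 1) ≤ 3 * (m * β) := fun u => by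
    have h3 : ∑ r with u ∈ B r, ((A r).card : ℝ) ≤ m * β := by
      rw [sum_filter_mem_card]
      refine (Finset.sum_le_sum fun v _ => ?_).trans_eq
        (show ∑ v : Fin m, β = m * β by simp)
      simpa only [and_comm] using h.pair u v
    have h4 : (load B u : ℝ) ≤ m := by exact_mod_cast load_le B u
    have h5 : (m : ℝ) ≤ m * β := le_mul_of_one_le_right (Nat.cast_nonneg _) h.one_le
    rw [Finset.sum_add_distrib, Finset.sum_const, nsmul_eq_mul, mul_one]
    have h6 : ((Finset.univ.filter fun r => u ∈ B r).card : ℝ) = load B u := rfl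
    have h7 : 0 ≤ (m : ℝ) * β := by linarith [Nat.cast_nonneg (α := ℝ) m]
    linarith
  refine (Finset.sum_le_sum fun u _ => h2 u).trans_eq ?_
  simp
  ring

theorem Spread.sum_sq (h : Spread A B β) : ∑ r, ((A r).card : ℝ) ^ 2 ≤ 3 * ((m : ℝ) ^ 2 * β) := by
  refine le_trans (Finset.sum_le_sum fun r _ => ?_) h.symm.sum_mul
  have h1 : ((A r).card : ℝ) ≤ (B r).card + 1 := by exact_mod_cast h.le_left r
  rw [sq]
  exact mul_le_mul_of_nonneg_left h1 (Nat.cast_nonneg _)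

/-- Pairs of sets through matched vertices: `g` maps `V` injectively. -/
theorem Spread.sum_load_mul_load (h : Spread A B β) (V : Finset (Fin m)) (g : Fin m → Fin m)
    (hg : Set.InjOn g V) : ∑ v ∈ V, (load A v : ℝ) * load B (g v) ≤ 4 * ((m : ℝ) ^ 2 * β) := by
  -- A pair (r,s) is given the weight |A_r| / |B_s|. Then the sum over r is bounded for each vertex
  -- by `sum_of_mem`, and only the inverses of |B_s| remain to be summed.
  have key : ∀ {A B : Fin m → Finset (Fin m)} (h : Spread A B β) (V : Finset (Fin m))
      (f g : Fin m → Fin m), Set.InjOn g V →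
      ∑ v ∈ V, ∑ r with f v ∈ A r, ∑ s with g v ∈ B s, ((A r).card : ℝ) / (B s).card ≤
        2 * ((m : ℝ) ^ 2 * β) := by
    intro A B h V f g hg
    have hmβ : 0 ≤ 2 * ((m : ℝ) * β) := by
      have := h.one_le
      positivity
    have h1 : ∀ v ∈ V, ∑ r with f v ∈ A r, ∑ s with g v ∈ B s, ((A r).card : ℝ) / (B s).card ≤
        2 * (m * β) * ∑ s with g v ∈ B s, ((B s).card : ℝ)⁻¹ := by
      intro v _
      have : ∑ r with f v ∈ A r, ∑ s with g v ∈ B s, ((A r).card : ℝ) / (B s).card =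
          (∑ r with f v ∈ A r, ((A r).card : ℝ)) * ∑ s with g v ∈ B s, ((B s).card : ℝ)⁻¹ := by
        rw [Finset.sum_mul_sum]
        rfl
      rw [this]
      exact mul_le_mul_of_nonneg_right (h.sum_of_mem _)
        (Finset.sum_nonneg fun _ _ => inv_nonneg.mpr (Nat.cast_nonneg _))
    refine (Finset.sum_le_sum h1).trans ?_
    rw [← Finset.mul_sum]
    -- By injectivity of `g` each vertex is met at most once, so each s contributes at most |B_s|
    -- times the inverse of |B_s|, that is 1, or 0 if the set is empty.
    have h2 : ∑ v ∈ V, ∑ s with g v ∈ B s, ((B s).card : ℝ)⁻¹ ≤ m := by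
      rw [← Finset.sum_image (f := fun u => ∑ s with u ∈ B s, ((B s).card : ℝ)⁻¹) hg]
      refine (Finset.sum_le_univ_sum_of_nonneg fun u =>
        Finset.sum_nonneg fun _ _ => inv_nonneg.mpr (Nat.cast_nonneg _)).trans ?_
      simp only [Finset.sum_filter]
      rw [Finset.sum_comm]
      refine (Finset.sum_le_sum (g := fun _ => (1 : ℝ)) fun s _ => ?_).trans_eq (by simp)
      rw [← Finset.sum_filter]
      simp only [Finset.filter_univ_mem, Finset.sum_const, nsmul_eq_mul]
      exact mul_inv_le_one
    refine (mul_le_mul_of_nonneg_left h2 hmβ).trans_eq (by ring)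
  -- A number or its inverse is at least 1, so every pair (r,s) is paid for by one of the two
  -- weights.
  have h1 : ∀ v ∈ V, (load A v : ℝ) * load B (g v) ≤
      (∑ r with v ∈ A r, ∑ s with g v ∈ B s, ((A r).card : ℝ) / (B s).card) +
        ∑ s with g v ∈ B s, ∑ r with v ∈ A r, ((B s).card : ℝ) / (A r).card := by
    intro v _
    rw [Finset.sum_comm (s := Finset.univ.filter fun s => g v ∈ B s), ← Finset.sum_add_distrib]
    simp only [← Finset.sum_add_distrib]
    have h2 : (load A v : ℝ) * load B (g v) = ∑ r with v ∈ A r, ∑ s with g v ∈ B s, (1 : ℝ) := by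
      simp [load]
    rw [h2]
    refine Finset.sum_le_sum fun r hr => Finset.sum_le_sum fun s hs => ?_
    have hr' : (0 : ℝ) < (A r).card := by
      exact_mod_cast Finset.card_pos.mpr ⟨v, (Finset.mem_filter.mp hr).2⟩
    have hs' : (0 : ℝ) < (B s).card := by
      exact_mod_cast Finset.card_pos.mpr ⟨g v, (Finset.mem_filter.mp hs).2⟩
    rcases le_total ((A r).card : ℝ) (B s).card with h3 | h3
    · have h4 := (one_le_div hr').mpr h3
      have h5 : (0 : ℝ) ≤ (A r).card / (B s).card := by positivity
      linarith
    · have h4 := (one_le_div hs').mpr h3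
      have h5 : (0 : ℝ) ≤ (B s).card / (A r).card := by positivity
      linarith
  refine (Finset.sum_le_sum h1).trans ?_
  rw [Finset.sum_add_distrib]
  have h2 := key h V id g hg
  have h3 := key h.symm V g id (Set.injOn_id _)
  simp only [id] at h2 h3
  linarith

variable {z : ℝ}

/-- Every a ≥ 0 satisfies a ≤ a²/z + z. The first terms sum to 3z⁵β by the bound on squares, the
second to m·z = z⁴. -/
theorem Spread.sum_card (h : Spread A B β) (hz : 1 ≤ z) (hm : (m : ℝ) = z ^ 3) :
    ∑ r, ((A r).card : ℝ) ≤ 4 * (z ^ 5 * β) := by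
  have hz0 : 0 < z := by linarith
  have h1 : ∀ r, ((A r).card : ℝ) ≤ ((A r).card : ℝ) ^ 2 / z + z := fun r => by
    rcases le_total ((A r).card : ℝ) z with h2 | h2
    · have : 0 ≤ ((A r).card : ℝ) ^ 2 / z := by positivity
      linarith
    · have : ((A r).card : ℝ) ≤ ((A r).card : ℝ) ^ 2 / z := by
        rw [le_div_iff₀ hz0, sq]
        exact mul_le_mul_of_nonneg_left h2 (Nat.cast_nonneg _)
      linarith
  refine (Finset.sum_le_sum fun r _ => h1 r).trans ?_
  rw [Finset.sum_add_distrib, ← Finset.sum_div]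
  have h2 : (∑ r, ((A r).card : ℝ) ^ 2) / z ≤ 3 * (z ^ 5 * β) := by
    rw [div_le_iff₀ hz0]
    refine h.sum_sq.trans_eq ?_
    rw [hm]
    ring
  have h3 : ∑ _r : Fin m, z = z ^ 4 := by
    simp [hm]
    ring
  have h4 : z ^ 4 ≤ z ^ 5 * β := by
    have : z ^ 4 * 1 ≤ z ^ 4 * (z * β) := mul_le_mul_of_nonneg_left
      (by nlinarith [h.one_le]) (by positivity)
    nlinarith
  linarith

/-- Sets attached to matched vertices: `f` maps `V` injectively. -/
theorem Spread.sum_load_mul_card (h : Spread A B β) (hz : 1 ≤ z) (hm : (m : ℝ) = z ^ 3)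
    (V : Finset (Fin m)) (f : Fin m → Fin m) (hf : Set.InjOn f V) :
    ∑ v ∈ V, (load A v : ℝ) * (A (f v)).card ≤ 7 * (z ^ 7 * β) := by
  have hz0 : 0 < z := by linarith
  -- The threshold is z²: below it the set size is replaced by z², above it the load is at most m =
  -- z³ and z²·|A| ≤ |A|².
  have h1 : ∀ v ∈ V, (load A v : ℝ) * (A (f v)).card ≤
      z ^ 2 * load A v + z * ((A (f v)).card : ℝ) ^ 2 := fun v _ => by
    have h0 : (load A v : ℝ) ≤ z ^ 3 := by
      rw [← hm]
      exact_mod_cast load_le A v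
    rcases le_total ((A (f v)).card : ℝ) (z ^ 2) with h2 | h2
    · have h3 := mul_le_mul_of_nonneg_left h2 (Nat.cast_nonneg (α := ℝ) (load A v))
      have h4 : 0 ≤ z * ((A (f v)).card : ℝ) ^ 2 := by positivity
      linarith
    · have h3 := mul_le_mul_of_nonneg_right h0 (Nat.cast_nonneg (α := ℝ) (A (f v)).card)
      have h4 : z * (z ^ 2 * ((A (f v)).card : ℝ)) ≤ z * ((A (f v)).card : ℝ) ^ 2 := by
        rw [sq ((A (f v)).card : ℝ)]
        exact mul_le_mul_of_nonneg_left (mul_le_mul_of_nonneg_right h2 (Nat.cast_nonneg _)) hz0.le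
      have h5 : 0 ≤ z ^ 2 * (load A v : ℝ) := by positivity
      nlinarith
  refine (Finset.sum_le_sum h1).trans ?_
  rw [Finset.sum_add_distrib, ← Finset.mul_sum, ← Finset.mul_sum]
  have h2 : ∑ v ∈ V, (load A v : ℝ) ≤ 4 * (z ^ 5 * β) :=
    (Finset.sum_le_univ_sum_of_nonneg fun _ => Nat.cast_nonneg _).trans
      ((sum_card_eq A).symm.trans_le (h.sum_card hz hm))
  have h3 : ∑ v ∈ V, ((A (f v)).card : ℝ) ^ 2 ≤ 3 * (z ^ 6 * β) := by
    rw [← Finset.sum_image (f := fun u => ((A u).card : ℝ) ^ 2) hf]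
    refine (Finset.sum_le_univ_sum_of_nonneg fun _ => by positivity).trans (h.sum_sq.trans_eq ?_)
    rw [hm]
    ring
  have h4 := mul_le_mul_of_nonneg_left h2 (show 0 ≤ z ^ 2 by positivity)
  have h5 := mul_le_mul_of_nonneg_left h3 hz0.le
  nlinarith

/-- For sets of size at least z² the factor m = z·z² is at most z·|A_r|, so the bound on squares
applies. -/
theorem Spread.sum_big (h : Spread A B β) (hz : 1 ≤ z) (hm : (m : ℝ) = z ^ 3) :
    ∑ r with z ^ 2 ≤ ((A r).card : ℝ), ((A r).card : ℝ) * m ≤ 3 * (z ^ 7 * β) := by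
  have hz0 : 0 < z := by linarith
  have h1 : ∀ r ∈ Finset.univ.filter (fun r => z ^ 2 ≤ ((A r).card : ℝ)),
      ((A r).card : ℝ) * m ≤ z * ((A r).card : ℝ) ^ 2 := fun r hr => by
    have h2 := (Finset.mem_filter.mp hr).2
    rw [hm]
    have := mul_le_mul_of_nonneg_left h2 (show 0 ≤ z * ((A r).card : ℝ) by positivity)
    nlinarith
  refine (Finset.sum_le_sum h1).trans ?_
  rw [← Finset.mul_sum]
  have h3 : ∑ r with z ^ 2 ≤ ((A r).card : ℝ), ((A r).card : ℝ) ^ 2 ≤ 3 * (z ^ 6 * β) := by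
    refine (Finset.sum_le_univ_sum_of_nonneg fun _ => by positivity).trans (h.sum_sq.trans_eq ?_)
    rw [hm]
    ring
  have h5 := mul_le_mul_of_nonneg_left h3 hz0.le
  nlinarith

end counting
namespace Stage
variable {m : ℕ} {S : Stage m}

/-! ### The number of pairs of edges inspected -/

open Classical in
/-- The search sets of the negative vertices. -/
noncomputable def reach (S : Stage m) (d : Bool) (r : Fin m) : Finset (Fin m) :=
  if r ∈ S.N then S.search d r else ∅

theorem mem_reach {d : Bool} {r v : Fin m} : v ∈ S.reach d r ↔ r ∈ S.N ∧ v ∈ S.search d r := by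
  unfold reach
  split_ifs with h <;> simp [h]

/-- If u ∈ B_r and v ∈ A_r, for `d = false`, the walk to r through u and the walk from r through v
have negative total weight, one of the two inequalities being strict. Their four pieces have at most
2 negative edges each, so r counts towards the betweenness of (u,v). -/
theorem Searched.spread (h : S.Searched) {n : ℕ} (hlow : S.LowBetweenness n) (d : Bool) :
    Spread (S.reach d) (S.reach !d) ((2 : ℝ) ^ Real.sqrt (Real.logb 2 n)) := by
  suffices hf : Spread (S.reach false) (S.reach true) ((2 : ℝ) ^ Real.sqrt (Real.logb 2 n)) by
    cases d
    · exact hf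
    · exact hf.symm
  refine ⟨Real.one_le_rpow (by norm_num) (Real.sqrt_nonneg _), fun u v => ?_, fun r => ?_,
    fun r => ?_⟩
  · refine le_trans ?_ (hlow u v)
    rw [strongBetweenness, ← Set.ncard_coe_finset]
    refine Nat.cast_le.mpr (Set.ncard_le_ncard ?_ (Set.toFinite _))
    intro r hr
    obtain ⟨hr1, hr2⟩ := (Finset.mem_filter.mp hr).2
    obtain ⟨hN, hu⟩ := mem_reach.mp hr1
    have hv := (mem_reach.mp hr2).2
    obtain ⟨x, ⟨t', x₁, k₁, x₂, k₂, p₁, p₂, hk, rfl⟩, hx⟩ := h.out_mem r hN v hv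
    obtain ⟨y, ⟨s', y₁, l₁, y₂, l₂, q₁, q₂, hl, rfl⟩, hy⟩ := h.in_mem r hN u hu
    refine ⟨hN, s', t', ?_⟩
    have hsum : y₁ + y₂ + x₁ + x₂ < 0 := by
      split_ifs at hx hy <;> linarith
    refine lt_of_le_of_lt (add_le_add (add_le_add (add_le_add (hopDist_le q₁ (by omega))
      (hopDist_le q₂ (by omega))) (hopDist_le p₁ (by omega))) (hopDist_le p₂ (by omega))) ?_
    exact_mod_cast hsum
  · unfold reach
    split_ifs with hr
    · exact (h.card_le r hr).1
    · simp
  · unfold reach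
    split_ifs with hr
    · exact (h.card_le r hr).2
    · simp

/-- `u` is the other end of the negative edge out of (`d = false`) or into (`d = true`) `v`. -/
def Mate (S : Stage m) : Bool → Fin m → Fin m → Prop
  | false, v, u => ∃ x, S.Γ v u x true
  | true, v, u => ∃ x, S.Γ u v x true

theorem Valid.mate_unique (hS : S.Valid) {d : Bool} {v u u' : Fin m} (h : S.Mate d v u)
    (h' : S.Mate d v u') : u = u' := by
  cases d <;> obtain ⟨x, hx⟩ := h <;> obtain ⟨y, hy⟩ := h'
  · exact (hS.Γ_neg_unique hx hy (.inl rfl)).2.1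
  · exact (hS.Γ_neg_unique hx hy (.inr rfl)).1

theorem Valid.mate_injective (hS : S.Valid) {d : Bool} {v v' u : Fin m} (h : S.Mate d v u)
    (h' : S.Mate d v' u) : v = v' := by
  cases d <;> obtain ⟨x, hx⟩ := h <;> obtain ⟨y, hy⟩ := h'
  · exact (hS.Γ_neg_unique hx hy (.inr rfl)).1
  · exact (hS.Γ_neg_unique hx hy (.inl rfl)).2.1

open Classical in
/-- The other end of the negative edge at `v`. -/
noncomputable def mate (S : Stage m) (d : Bool) (v : Fin m) : Fin m :=
  if h : ∃ u, S.Mate d v u then h.choose else v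

open Classical in
/-- The vertices with a negative edge out of them (`d = false`) or into them (`d = true`). -/
noncomputable def mated (S : Stage m) (d : Bool) : Finset (Fin m) :=
  Finset.univ.filter fun v => ∃ u, S.Mate d v u

/-- The tail of the negative edge at `v`. -/
noncomputable def tail (S : Stage m) (d : Bool) (v : Fin m) : Fin m := cond d (S.mate d v) v

theorem mem_mated {d : Bool} {v : Fin m} : v ∈ S.mated d ↔ ∃ u, S.Mate d v u := by
  simp [mated]

theorem mate_of_mem {d : Bool} {v : Fin m} (h : v ∈ S.mated d) : S.Mate d v (S.mate d v) := by
  have h := mem_mated.mp h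
  rw [mate, dif_pos h]
  exact h.choose_spec

theorem Valid.mate_eq (hS : S.Valid) {d : Bool} {v u : Fin m} (h : S.Mate d v u) :
    S.mate d v = u :=
  hS.mate_unique (mate_of_mem (mem_mated.mpr ⟨u, h⟩)) h

theorem Valid.injOn_mate (hS : S.Valid) (d : Bool) : Set.InjOn (S.mate d) (S.mated d) :=
  fun _ hv _ hv' h => hS.mate_injective (mate_of_mem hv) (h ▸ mate_of_mem hv')

theorem Valid.injOn_tail (hS : S.Valid) (d : Bool) : Set.InjOn (S.tail d) (S.mated d) := by
  cases d
  · exact Set.injOn_id _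
  · exact hS.injOn_mate true

/-- The edges out of (`d = false`) or into (`d = true`) `v`, by the reason for their presence and a
vertex that determines them. -/
inductive EdgeAt (S : Stage m) : Bool → Fin m → Fin 5 → Fin m → S.SV → ℝ → Prop
  | nonneg_out {v t : Fin m} {x : ℝ} (h : S.Γ v t x false) : EdgeAt S false v 0 t (.inl t) x
  | nonneg_in {v t : Fin m} {x : ℝ} (h : S.Γ t v x false) : EdgeAt S true v 0 t (.inl t) x
  | neg_out {v t : Fin m} {x : ℝ} (h : S.Γ v t x true) : EdgeAt S false v 1 t (.inl t) x
  | neg_in {v t : Fin m} {x : ℝ} (h : S.Γ t v x true) : EdgeAt S true v 1 t (.inl t) x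
  | s4_out {v t u : Fin m} {x : ℝ} (hv : v ∈ S.N) (ht : t ∈ S.vOut v) (h : S.Γ t u x true) :
      EdgeAt S false v 2 t (.inl u) ((hopDist S.Γ 1 v t).toReal + x)
  | s5_in {v t u r : Fin m} {x y : ℝ} (hr : S.Γ r v y true) (ht : t ∈ S.vIn r)
      (h : S.Γ u t x true) :
      EdgeAt S true v 2 t (.inl u) (x + (hopDist S.Γ 0 t r).toReal + y)
  | s5_out {v t r u : Fin m} {x y : ℝ} (hv : S.Γ v u x true) (ht : u ∈ S.vIn t)
      (h : S.Γ t r y true) :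
      EdgeAt S false v 3 t (.inl r) (x + (hopDist S.Γ 0 u t).toReal + y)
  | s4_in {v t u : Fin m} {x : ℝ} (ht : t ∈ S.N) (hu : u ∈ S.vOut t) (h : S.Γ u v x true) :
      EdgeAt S true v 3 t (.inl t) ((hopDist S.Γ 1 t u).toReal + x)
  | s3_out {v : Fin m} {t : {r : Fin m // r ∈ S.N}} {x : ℝ} (h : S.s3 v t x) :
      EdgeAt S false v 4 t (.inr t) x
  | s2_in {v : Fin m} {t : {r : Fin m // r ∈ S.N}} {x : ℝ} (h : S.s2 t v x) :
      EdgeAt S true v 4 t (.inr t) x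

theorem exists_edgeAt {d : Bool} {v : Fin m} {c : S.SV} {x : ℝ} (h : S.augD d (.inl v) c x) :
    ∃ k t, EdgeAt S d v k t c x := by
  cases d
  · rcases c with u | r
    · rcases h with ⟨b, h⟩ | ⟨hv, t, ht, y, hy, rfl⟩ | ⟨r, t, ht, y, z, hy, hz, rfl⟩
      · cases b
        · exact ⟨_, _, .nonneg_out h⟩
        · exact ⟨_, _, .neg_out h⟩
      · exact ⟨_, _, .s4_out hv ht hy⟩
      · exact ⟨_, _, .s5_out hy ht hz⟩
    · exact ⟨_, _, .s3_out h⟩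
  · rcases c with u | r
    · rcases h with ⟨b, h⟩ | ⟨hv, t, ht, y, hy, rfl⟩ | ⟨r, t, ht, y, z, hy, hz, rfl⟩
      · cases b
        · exact ⟨_, _, .nonneg_in h⟩
        · exact ⟨_, _, .neg_in h⟩
      · exact ⟨_, _, .s4_in hv ht hy⟩
      · exact ⟨_, _, .s5_in hz ht hy⟩
    · exact ⟨_, _, .s2_in h⟩

/-- A vertex is incident to at most one negative edge, so a label and one vertex determine an edge
(S4) or (S5) at `v`. Counting edges thereby becomes counting vertices in search sets. -/
theorem EdgeAt.unique (hS : S.Valid) {d : Bool} {v t : Fin m} {k : Fin 5} {c c' : S.SV} {x x' : ℝ}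
    (h : EdgeAt S d v k t c x) (h' : EdgeAt S d v k t c' x') : c = c' ∧ x = x' := by
  cases h with
  | nonneg_out h => cases h' with | nonneg_out h' => exact ⟨rfl, (Γ_unique h h').1⟩
  | nonneg_in h => cases h' with | nonneg_in h' => exact ⟨rfl, (Γ_unique h h').1⟩
  | neg_out h => cases h' with | neg_out h' => exact ⟨rfl, (Γ_unique h h').1⟩
  | neg_in h => cases h' with | neg_in h' => exact ⟨rfl, (Γ_unique h h').1⟩
  | s4_out hv ht h =>
    cases h' with
    | s4_out hv' ht' h' =>
      obtain ⟨-, rfl, rfl⟩ := hS.Γ_neg_unique h h' (.inl rfl)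
      exact ⟨rfl, rfl⟩
  | s5_in hr ht h =>
    cases h' with
    | s5_in hr' ht' h' =>
      obtain ⟨rfl, -, rfl⟩ := hS.Γ_neg_unique h h' (.inr rfl)
      obtain ⟨rfl, -, rfl⟩ := hS.Γ_neg_unique hr hr' (.inr rfl)
      exact ⟨rfl, rfl⟩
  | s5_out hv ht h =>
    cases h' with
    | s5_out hv' ht' h' =>
      obtain ⟨-, rfl, rfl⟩ := hS.Γ_neg_unique h h' (.inl rfl)
      obtain ⟨-, rfl, rfl⟩ := hS.Γ_neg_unique hv hv' (.inl rfl)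
      exact ⟨rfl, rfl⟩
  | s4_in ht hu h =>
    cases h' with
    | s4_in ht' hu' h' =>
      obtain ⟨rfl, -, rfl⟩ := hS.Γ_neg_unique h h' (.inr rfl)
      exact ⟨rfl, rfl⟩
  | @s3_out _ t x h =>
    generalize hk : (t : Fin m) = t' at h'
    cases h' with
    | s3_out h' =>
      obtain rfl := Subtype.ext hk
      exact ⟨rfl, h.2.trans h'.2.symm⟩
  | @s2_in _ t x h =>
    generalize hk : (t : Fin m) = t' at h'
    cases h' with
    | s2_in h' =>
      obtain rfl := Subtype.ext hk
      exact ⟨rfl, h.2.trans h'.2.symm⟩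

/-- The range of the vertex in `EdgeAt`, except for the edges of `Γ` that are not negative. -/
noncomputable def targets (S : Stage m) (d : Bool) (v : Fin m) (U : Finset (Fin m)) :
    Fin 5 → Finset (Fin m)
  | 0 => U
  | 1 => {S.mate d v}
  | 2 => if v ∈ S.mated d then S.reach d (S.tail d v) else ∅
  | 3 => if v ∈ S.mated d then Finset.univ.filter fun r => S.mate d v ∈ S.reach (!d) r else ∅
  | 4 => insert (S.tail d v) (Finset.univ.filter fun r => v ∈ S.reach (!d) r)

theorem EdgeAt.mem_targets (hS : S.Valid) {d : Bool} {v t : Fin m} {k : Fin 5} {c : S.SV} {x : ℝ}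
    {U : Finset (Fin m)} (h : EdgeAt S d v k t c x) (hU : k = 0 → t ∈ U) :
    t ∈ S.targets d v U k := by
  have key : ∀ {d v u}, S.Mate d v u → v ∈ S.mated d ∧ S.mate d v = u := fun h =>
    ⟨mem_mated.mpr ⟨_, h⟩, hS.mate_eq h⟩
  cases h with
  | nonneg_out h => exact hU rfl
  | nonneg_in h => exact hU rfl
  | neg_out h => simp [targets, (key (d := false) ⟨_, h⟩).2]
  | neg_in h => simp [targets, (key (d := true) ⟨_, h⟩).2]
  | s4_out hv ht h =>
    obtain ⟨u, y, hu⟩ := exists_Γ_of_mem_N hv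
    have := key (d := false) ⟨_, hu⟩
    simp only [targets, this.1, if_true]
    exact mem_reach.mpr ⟨hv, ht.1⟩
  | s5_in hr ht h =>
    have := key (d := true) ⟨_, hr⟩
    simp only [targets, this.1, if_true, tail, this.2, cond_true]
    exact mem_reach.mpr ⟨mem_N_of_Γ hr, ht.1⟩
  | s5_out hv ht h =>
    have := key (d := false) ⟨_, hv⟩
    simp only [targets, this.1, if_true, this.2, Finset.mem_filter_univ]
    exact mem_reach.mpr ⟨mem_N_of_Γ h, ht.1⟩
  | s4_in ht hu h =>
    have := key (d := true) ⟨_, h⟩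
    simp only [targets, this.1, if_true, this.2, Finset.mem_filter_univ]
    exact mem_reach.mpr ⟨ht, hu.1⟩
  | @s3_out _ t x h =>
    simp only [targets, Finset.mem_insert, Finset.mem_filter_univ]
    rcases h.1 with h | h
    · exact .inr (mem_reach.mpr ⟨t.2, h.1⟩)
    · exact .inl h.symm
  | @s2_in _ t x h =>
    simp only [targets, Finset.mem_insert, Finset.mem_filter_univ]
    rcases h.1 with h | ⟨y, h⟩
    · exact .inr (mem_reach.mpr ⟨t.2, h.1⟩)
    · exact .inl (key (d := true) ⟨_, h⟩).2.symm

/-- A bound for the number of edges at `v`, except for the edges of `Γ` that are not negative. -/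
noncomputable def excess (S : Stage m) (d : Bool) (v : Fin m) : ℕ :=
  2 + (if v ∈ S.mated d then (S.reach d (S.tail d v)).card + load (S.reach !d) (S.mate d v) else 0) +
    load (S.reach !d) v

/-- The constant 2 in `excess` stands for the negative edge at `v` and for the Steiner edge that
(S2) or (S3) adds independently of the search sets. -/
theorem sum_card_targets (d : Bool) (v : Fin m) (U : Finset (Fin m)) :
    ∑ k, (S.targets d v U k).card ≤ U.card + S.excess d v := by
  have h4 := Finset.card_insert_le (S.tail d v) (Finset.univ.filter fun r => v ∈ S.reach (!d) r)
  simp only [Fin.sum_univ_five, targets, excess, load, Finset.card_singleton]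
  split_ifs
  · omega
  · simp only [Finset.card_empty]
    omega

theorem card_le_sum_card {ι κ α : Type} [Fintype κ] (J : Finset ι) (rel : ι → κ → α → Prop)
    (U : κ → Finset α) (hex : ∀ j ∈ J, ∃ k, ∃ t ∈ U k, rel j k t)
    (hinj : ∀ j ∈ J, ∀ j' ∈ J, ∀ k t, rel j k t → rel j' k t → j = j') :
    J.card ≤ ∑ k, (U k).card := by
  rcases J.eq_empty_or_nonempty with rfl | ⟨j₀, hj₀⟩
  · simp
  rw [← Finset.card_sigma]
  obtain ⟨k₀, t₀, -⟩ := hex j₀ hj₀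
  have : Nonempty κ := ⟨k₀⟩
  have : Nonempty α := ⟨t₀⟩
  choose! k t ht hrel using hex
  refine Finset.card_le_card_of_injOn (fun j => (⟨k j, t j⟩ : Σ _ : κ, α)) (fun j hj => ?_) ?_
  · simpa using ht j hj
  · intro j hj j' hj' h
    simp only [Sigma.mk.injEq] at h
    refine hinj j hj j' hj' (k j) (t j) (hrel j hj) ?_
    rw [h.1, eq_of_heq h.2]
    exact hrel j' hj'

theorem length_sel_eq (f : ℕ → Prop) [DecidablePred f] (i : ℕ) :
    (sel f i).length = ((Finset.range i).filter f).card := by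
  convert length_sel f i

/-! ### Bounds on the number of inspected pairs -/

section pairs
variable {d : Bool} {G : Inst} {D : ℕ → ℝ}

/-- The number of edges in a set of edges at `v`. -/
theorem Codes.card_le (hG : S.Codes d G) (hS : S.Valid) (v : Fin m) (J : Finset ℕ)
    (hJ : ∀ j ∈ J, j < G.M ∧ G.src j = v) (U : Finset (Fin m))
    (hU : ∀ j ∈ J, ∀ t c, G.dst j = S.code c → EdgeAt S d v 0 t c (G.wt j) → t ∈ U) :
    J.card ≤ U.card + S.excess d v := by
  refine le_trans (card_le_sum_card J
    (fun j k t => ∃ c, G.dst j = S.code c ∧ EdgeAt S d v k t c (G.wt j))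
    (S.targets d v U) ?_ ?_) (sum_card_targets d v U)
  · intro j hj
    obtain ⟨a, c, ha, hc, h⟩ := hG.decode j (hJ j hj).1
    obtain rfl : a = .inl v := code_injective (by rw [← ha, (hJ j hj).2]; rfl)
    obtain ⟨k, t, hk⟩ := exists_edgeAt h
    exact ⟨k, t, hk.mem_targets hS fun h0 => hU j hj t c hc (h0 ▸ hk), c, hc, hk⟩
  · rintro j hj j' hj' k t ⟨c, hc, hk⟩ ⟨c', hc', hk'⟩
    obtain ⟨rfl, hx⟩ := hk.unique hS hk'
    exact hG.inj j (hJ j hj).1 j' (hJ j' hj').1 ((hJ j hj).2.trans (hJ j' hj').2.symm)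
      (hc.trans hc'.symm) hx

/-- The edges incident to a Steiner vertex are determined by their ends. -/
theorem weight_unique {a b : S.SV} {x y : ℝ} (hab : a.isRight = true ∨ b.isRight = true)
    (h : S.augD d a b x) (h' : S.augD d a b y) : x = y := by
  rcases a with u | r <;> rcases b with v | r'
  · simp at hab
  · cases d <;> exact h.2.trans h'.2.symm
  · cases d <;> exact h.2.trans h'.2.symm
  · exact absurd h (augD_right_right d _ _ _)

/-- The imaginary edges lead to the search sets. -/
theorem Searched.mem_search (hs : S.Searched) (hS : S.Valid) {r : {r : Fin m // r ∈ S.N}}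
    {v : Fin m} {x : ℝ} (h : S.augD d (.inr r) (.inl v) x) (hx : x < 0) : v ∈ S.reach d r := by
  refine mem_reach.mpr ⟨r.2, ?_⟩
  cases d
  · obtain ⟨y, k, hw, hk, hy⟩ := hS.s2_walk (r := r) (v := v) h hx
    exact hs.mem_sOut r.2 (Γ_sub_H hw) (.nil v) (by omega) (by linarith)
  · obtain ⟨y, hw, hy⟩ := hS.s3_walk (r := r) (v := v) h hx
    exact hs.mem_sIn r.2 (.nil v) (Γ_sub_H hw) (by omega) (by linarith)

/-- The edges of `Γ` at `v` that have no counterpart at the new copy lead to the search set of any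
negative vertex whose imaginary edge determines the shift of the new copy. -/
theorem Searched.mem_search_of_low (hs : S.Searched) (hS : S.Valid) {r : {r : Fin m // r ∈ S.N}}
    {v v' t : Fin m} {c : S.SV} {x y : ℝ} (h : S.augD d (.inr r) (.inl v') y)
    (hb : S.base v' = S.base v) (h' : EdgeAt S d v 0 t c x)
    (hlt : x + S.shiftD d v - (S.shiftD d v' - y) < 0) : t ∈ S.search d r := by
  cases h' with
  | nonneg_out h' =>
    simp only [shiftD] at hlt
    obtain ⟨z, k, hw, hk, hz⟩ := hS.s2_walk (r := r) (v := v') h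
      (y := S.shiftΓ v' - S.shiftΓ v - x) (by linarith)
    obtain ⟨l, hl, hc⟩ := exists_walk_copy hb
    exact hs.mem_sOut r.2 (Γ_sub_H hw) (hc.append (Γ_sub_H (Walk.single h')))
      (by simp only [Bool.toNat_false]; omega) (by linarith)
  | nonneg_in h' =>
    simp only [shiftD] at hlt
    obtain ⟨z, hw, hz⟩ := hS.s3_walk (r := r) (v := v') h
      (y := S.shiftΓ v - S.shiftΓ v' - x) (by linarith)
    obtain ⟨l, hl, hc⟩ := exists_walk_copy hb.symm
    exact hs.mem_sIn r.2 (Γ_sub_H (Walk.single h')) (hc.append (Γ_sub_H hw))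
      (by simp only [Bool.toNat_false]; omega) (by linarith)

/-- The three summands correspond to a direct treatment (all m possible heads), to low edges of Γ
(at most z² heads), and to the edges that are negative or do not come from Γ. -/
theorem Codes.length_partners_of_inl (hG : S.Codes d G) (hS : S.Valid) (hs : S.Searched)
    (hshift : G.IsShift D) {z : ℝ} (hm : (m : ℝ) = z ^ 3) {i : ℕ} (hi : i < G.M)
    {r : {r : Fin m // r ∈ S.N}} {v : Fin m} (ha : G.src i = S.code (.inr r))
    (hb : G.dst i = S.code (.inl v)) :
    ((G.partners D i).length : ℝ) ≤ (if z ^ 2 ≤ ((S.reach d r).card : ℝ) then (m : ℝ) else 0) +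
      z ^ 2 + S.excess d v := by
  classical
  have hcnt : ∀ r : {r : Fin m // r ∈ S.N}, ∀ i < G.M, G.src i = S.code (.inr r) →
      G.cnt (G.src i - m) = (S.search d r.1).card := fun r i hi ha => by
    rw [← hG.cnt_eq r ⟨i, hi, ha⟩, ha]
    congr 1
    exact Nat.add_sub_cancel_left _ _
  have hr : S.reach d r = S.search d r := by simp [reach, r.2]
  have hmm : ((m * m : ℕ) : ℝ) = (z ^ 2) ^ 3 := by
    push_cast
    rw [hm]
    ring
  have h0 : (0 : ℝ) ≤ if z ^ 2 ≤ ((S.reach d r).card : ℝ) then (m : ℝ) else 0 := by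
    split_ifs <;> simp
  have hX : z ^ 2 ≤ ((S.reach d r).card : ℝ) →
      (if z ^ 2 ≤ ((S.reach d r).card : ℝ) then (m : ℝ) else 0) = m := fun h => if_pos h
  generalize (if z ^ 2 ≤ ((S.reach d r).card : ℝ) then (m : ℝ) else 0) = X at *
  unfold Inst.partners
  split_ifs with h1 h2
  -- Class 1 with an ordinary head means that the search set of r is large.
  · have h3 : m * m ≤ (S.search d r.1).card ^ 3 := by
      have h4 : ¬ (S.search d r.1).card * (S.search d r.1).card * (S.search d r.1).card <
          m * m := by
        intro h4
        rw [← hcnt r i hi ha] at h4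
        unfold Inst.cls at h1
        have h5 : G.dst i < G.m := by
          rw [hb, hG.m_eq]
          exact v.2
        have h6 : ¬ G.src i < G.m := by
          rw [ha, hG.m_eq]
          exact not_lt.mpr (Nat.le_add_right _ _)
        rw [if_pos h5, if_neg h6, hG.m_eq, if_pos h4] at h1
        split_ifs at h1
        omega
      have : (S.search d r.1).card ^ 3 =
        (S.search d r.1).card * (S.search d r.1).card * (S.search d r.1).card := by ring
      omega
    have h4 : z ^ 2 ≤ ((S.reach d r).card : ℝ) := by
      rw [hr]
      refine le_of_pow_le_pow_left₀ (n := 3) (by norm_num) (Nat.cast_nonneg _) ?_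
      rw [← hmm]
      exact_mod_cast h3
    have h5 := hG.card_le hS v ((Finset.range G.M).filter fun j => G.src j = G.dst i ∧ True)
      (fun j hj => by
        have := Finset.mem_filter.mp hj
        exact ⟨Finset.mem_range.mp this.1, this.2.1.trans hb⟩) Finset.univ
      fun _ _ _ _ _ _ => Finset.mem_univ _
    rw [length_sel_eq, hX h4]
    rw [Finset.card_univ, Fintype.card_fin] at h5
    have h6 : (((Finset.range G.M).filter fun j => G.src j = G.dst i ∧ True).card : ℝ) ≤
      m + S.excess d v := by exact_mod_cast h5
    have h7 : 0 ≤ z ^ 2 := by positivity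
    linarith
  -- The low edges are bounded not by the search set of r but by that of the vertex r' whose edge
  -- attains the shift. That edge is of class 2 too, so its search set is small.
  · obtain ⟨-, i', hi', h3, h4, h5⟩ := hshift i hi h2
    obtain ⟨a', b', ha', hb', hab'⟩ := hG.decode i' hi'
    obtain ⟨h6, h7, -, h8⟩ := hG.cls_ne_two ha' hb' h3
    rcases a' with u | r'
    · simp at h6
    rcases b' with v' | q
    swap
    · simp at h7
    rw [hcnt r' i' hi' ha'] at h8
    have e1 : G.dst i = v := hb
    have e2 : G.dst i' = v' := hb'
    rw [e1, e2, hG.P_eq] at h5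
    rw [e1, e2, hG.base_eq, hG.base_eq] at h4
    have h9 := hG.card_le hS v ((Finset.range G.M).filter fun j => G.src j = G.dst i ∧ G.IsLow D j)
      (fun j hj => by
        have := Finset.mem_filter.mp hj
        exact ⟨Finset.mem_range.mp this.1, this.2.1.trans hb⟩) (S.search d r')
      fun j hj t c hc hk => by
        obtain ⟨hsrc, hl⟩ := (Finset.mem_filter.mp hj).2
        refine hs.mem_search_of_low hS hab' (Fin.ext h4) hk ?_
        have := hl.2
        rw [Inst.copyWt, hsrc, e1, h5, hG.P_eq] at this
        exact this
    have h10 : ((S.search d r'.1).card : ℝ) ≤ z ^ 2 := by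
      refine le_of_pow_le_pow_left₀ (n := 3) (by norm_num) (by positivity) ?_
      rw [← hmm]
      refine Nat.cast_le.mpr (le_trans (le_of_eq ?_) h8.le) |>.trans' (by rw [Nat.cast_pow])
      ring
    have h11 : (((Finset.range G.M).filter fun j => G.src j = G.dst i ∧ G.IsLow D j).card : ℝ) ≤
      (S.search d r'.1).card + S.excess d v := by exact_mod_cast h9
    rw [length_sel_eq]
    linarith
  · simp only [List.length_nil, Nat.cast_zero]
    positivity

theorem Codes.card_le_of_inr (hG : S.Codes d G) (hS : S.Valid) (r : {r : Fin m // r ∈ S.N})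
    (J : Finset ℕ) (hJ : ∀ j ∈ J, j < G.M ∧ G.src j = S.code (.inr r)) :
    J.card ≤ (S.reach d r).card + 1 := by
  classical
  -- The extra vertex `x` is the head r' of the negative edge in (S2), and r itself in (S3).
  obtain ⟨x, hx⟩ : ∃ x, ∀ v y, S.augD d (.inr r) (.inl v) y → v ∈ insert x (S.reach d r) := by
    cases d
    · obtain ⟨x, z, hx⟩ := exists_Γ_of_mem_N r.2
      refine ⟨x, fun v y h => Finset.mem_insert.mpr ?_⟩
      rcases h.1 with h | ⟨z', h⟩
      · exact .inr (mem_reach.mpr ⟨r.2, h.1⟩)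
      · exact .inl (hS.Γ_neg_unique h hx (.inl rfl)).2.1
    · refine ⟨r, fun v y h => Finset.mem_insert.mpr ?_⟩
      rcases h.1 with h | h
      · exact .inr (mem_reach.mpr ⟨r.2, h.1⟩)
      · exact .inl h
  have hdec : ∀ j ∈ J, ∃ v : Fin m, G.dst j = v ∧ S.augD d (.inr r) (.inl v) (G.wt j) := by
    intro j hj
    obtain ⟨a, b, ha, hb, hab⟩ := hG.decode j (hJ j hj).1
    obtain rfl : a = .inr r := code_injective (by rw [← ha, (hJ j hj).2])
    rcases b with v | r'
    · exact ⟨v, hb, hab⟩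
    · exact absurd hab (augD_right_right d _ _ _)
  refine le_trans ?_ (Finset.card_insert_le x _)
  rw [← Finset.card_map Fin.valEmbedding]
  refine Finset.card_le_card_of_injOn G.dst (fun j hj => ?_) fun j hj j' hj' h => ?_
  · obtain ⟨v, hv, h⟩ := hdec j hj
    rw [hv]
    exact Finset.mem_coe.mpr (Finset.mem_map_of_mem Fin.valEmbedding (hx v _ h))
  · obtain ⟨v, hv, hw⟩ := hdec j hj
    obtain ⟨v', hv', hw'⟩ := hdec j' hj'
    obtain rfl : v = v' := Fin.ext (by rw [← hv, ← hv', h])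
    exact hG.inj j (hJ j hj).1 j' (hJ j' hj').1 ((hJ j hj).2.trans (hJ j' hj').2.symm) h
      (weight_unique (.inl rfl) hw hw')

/-- An edge into a Steiner vertex is never redirected, so it meets at most all edges on the other
side of that vertex. -/
theorem Codes.length_partners_of_inr (hG : S.Codes d G) (hS : S.Valid) {i : ℕ}
    {r : {r : Fin m // r ∈ S.N}} (hb : G.dst i = S.code (.inr r)) :
    ((G.partners D i).length : ℝ) ≤ (S.reach d r).card + 1 := by
  have h0 : G.cls i ≠ 2 := fun h => by
    have := Inst.dst_lt_of_cls h
    rw [hb, hG.m_eq] at this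
    have h1 : m + (r.1 : ℕ) < m := this
    omega
  unfold Inst.partners
  split_ifs with h1
  · rw [length_sel_eq]
    exact_mod_cast hG.card_le_of_inr hS r _ fun j hj => by
      have := Finset.mem_filter.mp hj
      exact ⟨Finset.mem_range.mp this.1, this.2.1.trans hb⟩
  · simp only [List.length_nil, Nat.cast_zero]
    positivity

theorem excess_le (d : Bool) (v : Fin m) : S.excess d v ≤ 3 * m + 2 := by
  have h1 := load_le (S.reach !d) v
  have h2 := load_le (S.reach !d) (S.mate d v)
  have h3 : (S.reach d (S.tail d v)).card ≤ m := (Finset.card_le_univ _).trans (by simp)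
  unfold excess
  split_ifs <;> omega

/-- The number of edges of `G'_{τ+1}`. -/
theorem Codes.M_le (hG : S.Codes d G) (hS : S.Valid) : G.M ≤ 12 * (m * m) := by
  have h1 : ∀ i ∈ Finset.range G.M, G.src i ∈ Finset.range (2 * m) := fun i hi => by
    obtain ⟨a, b, ha, -, -⟩ := hG.decode i (Finset.mem_range.mp hi)
    rw [ha, Finset.mem_range]
    exact code_lt a
  have h2 : ∀ k ∈ Finset.range (2 * m), ((Finset.range G.M).filter fun i => G.src i = k).card ≤
      4 * m + 2 := by
    intro k hk
    rcases Finset.eq_empty_or_nonempty ((Finset.range G.M).filter fun i => G.src i = k) with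
      h | ⟨i, hi⟩
    · simp [h]
    obtain ⟨hiM, rfl⟩ := Finset.mem_filter.mp hi
    obtain ⟨a, b, ha, -, -⟩ := hG.decode i (Finset.mem_range.mp hiM)
    have hJ : ∀ j ∈ (Finset.range G.M).filter (fun j => G.src j = G.src i),
        j < G.M ∧ G.src j = S.code a := fun j hj => by
      have := Finset.mem_filter.mp hj
      exact ⟨Finset.mem_range.mp this.1, this.2.trans ha⟩
    rcases a with v | r
    · have h3 := hG.card_le hS v _ hJ Finset.univ fun _ _ _ _ _ _ => Finset.mem_univ _
      have h4 := S.excess_le d v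
      simp only [Finset.card_univ, Fintype.card_fin] at h3
      omega
    · have h3 := hG.card_le_of_inr hS r _ hJ
      have h4 : (S.reach d r).card ≤ m := (Finset.card_le_univ _).trans (by simp)
      omega
  have h3 := Finset.card_le_mul_card_image_of_maps_to h1 (4 * m + 2) h2
  simp only [Finset.card_range] at h3
  nlinarith [Nat.le_mul_self m]

/-- Each index is assigned a pair (r,v), injectively; the pairs that are not hit only add
non-negative terms. -/
theorem sum_le_sum_sum (K : Finset ℕ) (f : ℕ → ℝ) (T : Fin m → Finset (Fin m))
    (e : ℕ → Fin m → Fin m → Prop) (F : Fin m → Fin m → ℝ) (hF : ∀ r v, 0 ≤ F r v)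
    (hex : ∀ i ∈ K, ∃ r, ∃ v ∈ T r, e i r v ∧ f i ≤ F r v)
    (hinj : ∀ i ∈ K, ∀ i' ∈ K, ∀ r v, e i r v → e i' r v → i = i') :
    ∑ i ∈ K, f i ≤ ∑ r, ∑ v ∈ T r, F r v := by
  classical
  rcases K.eq_empty_or_nonempty with rfl | ⟨i₀, hi₀⟩
  · exact Finset.sum_nonneg fun _ _ => Finset.sum_nonneg fun _ _ => hF _ _
  obtain ⟨r₀, -⟩ := hex i₀ hi₀
  have : Nonempty (Fin m) := ⟨r₀⟩
  choose! r v hv he hf using hex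
  have hinj' : Set.InjOn (fun i => (⟨r i, v i⟩ : Σ _ : Fin m, Fin m)) K := by
    intro i hi i' hi' h
    simp only [Sigma.mk.injEq] at h
    refine hinj i hi i' hi' (r i) (v i) (he i hi) ?_
    rw [h.1, eq_of_heq h.2]
    exact he i' hi'
  rw [Finset.sum_sigma']
  refine (Finset.sum_le_sum hf).trans ?_
  rw [← Finset.sum_image (f := fun p : Σ _ : Fin m, Fin m => F p.1 p.2) hinj']
  refine Finset.sum_le_sum_of_subset_of_nonneg (fun p hp => ?_) fun _ _ _ => hF _ _
  obtain ⟨i, hi, rfl⟩ := Finset.mem_image.mp hp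
  simpa using hv i hi

/-- Only imaginary edges have partners. Those leaving a Steiner vertex are indexed by v ∈ A_r, those
entering one by u ∈ B_r, and the bounds for a single edge are summed with the estimates for
`Spread`. -/
theorem Codes.sum_partners (hG : S.Codes d G) (hS : S.Valid) (hs : S.Searched)
    (hshift : G.IsShift D) {n : ℕ} (hlow : S.LowBetweenness n) {z : ℝ} (hz : 1 ≤ z)
    (hm : (m : ℝ) = z ^ 3) :
    ((∑ k ∈ Finset.range G.M, (G.partners D k).length : ℕ) : ℝ) ≤
      40 * (z ^ 7 * (2 : ℝ) ^ Real.sqrt (Real.logb 2 n)) := by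
  classical
  have hspread := hs.spread hlow d
  have hspread' := hspread.symm
  set β := (2 : ℝ) ^ Real.sqrt (Real.logb 2 n)
  set A := S.reach d
  set B := S.reach !d
  have hz0 : 0 ≤ z := by linarith
  have hβ := hspread.one_le
  have h1 : ∑ k ∈ Finset.range G.M with G.cls k ≠ 0 ∧ G.dst k < m,
      ((G.partners D k).length : ℝ) ≤ ∑ r, ∑ v ∈ A r,
        ((if z ^ 2 ≤ ((A r).card : ℝ) then (m : ℝ) else 0) + z ^ 2 + S.excess d v) := by
    refine sum_le_sum_sum _ _ A (fun i r v => G.src i = m + r ∧ G.dst i = v)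
      (fun r v => (if z ^ 2 ≤ ((A r).card : ℝ) then (m : ℝ) else 0) + z ^ 2 + S.excess d v)
      (fun r v => ?_) ?_ ?_
    · have : (0 : ℝ) ≤ if z ^ 2 ≤ ((A r).card : ℝ) then (m : ℝ) else 0 := by split_ifs <;> simp
      positivity
    · intro i hi
      obtain ⟨hi, h0, hlt⟩ := Finset.mem_filter.mp hi
      have hiM := Finset.mem_range.mp hi
      obtain ⟨a, b, ha, hb, hab⟩ := hG.decode i hiM
      have him : ImagD a b (G.wt i) := not_not.mp fun h => h0 ((hG.cls_eq_zero_iff ha hb).mpr h)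
      rw [hb, code_lt_iff] at hlt
      rcases b with v | r
      swap
      · simp at hlt
      rcases a with u | r
      · simpa using him.2
      · exact ⟨r, v, hs.mem_search hS hab him.1, ⟨ha, hb⟩,
          hG.length_partners_of_inl hS hs hshift hm hiM ha hb⟩
    · rintro i hi i' hi' r v ⟨h1, h2⟩ ⟨h1', h2'⟩
      have hiM := Finset.mem_range.mp (Finset.mem_filter.mp hi).1
      have hiM' := Finset.mem_range.mp (Finset.mem_filter.mp hi').1
      obtain ⟨a, b, ha, hb, hab⟩ := hG.decode i hiM
      obtain ⟨a', b', ha', hb', hab'⟩ := hG.decode i' hiM'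
      obtain rfl : a = a' := code_injective (by rw [← ha, ← ha', h1, h1'])
      obtain rfl : b = b' := code_injective (by rw [← hb, ← hb', h2, h2'])
      refine hG.inj i hiM i' hiM' (h1.trans h1'.symm) (h2.trans h2'.symm)
        (weight_unique (.inl ?_) hab hab')
      rw [← Bool.not_eq_false, ← code_lt_iff, ← ha, h1]
      omega
  have h2 : ∑ k ∈ Finset.range G.M with G.cls k ≠ 0 ∧ ¬ G.dst k < m,
      ((G.partners D k).length : ℝ) ≤ ∑ r, ∑ u ∈ B r, (((A r).card : ℝ) + 1) := by
    refine sum_le_sum_sum _ _ B (fun i r u => G.src i = u ∧ G.dst i = m + r)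
      (fun r u => ((A r).card : ℝ) + 1) (fun r v => by positivity) ?_ ?_
    · intro i hi
      obtain ⟨hi, h0, hlt⟩ := Finset.mem_filter.mp hi
      have hiM := Finset.mem_range.mp hi
      obtain ⟨a, b, ha, hb, hab⟩ := hG.decode i hiM
      have him : ImagD a b (G.wt i) := not_not.mp fun h => h0 ((hG.cls_eq_zero_iff ha hb).mpr h)
      rw [hb, code_lt_iff] at hlt
      rcases b with v | r
      · simp at hlt
      rcases a with u | r'
      · have hab' : S.augD (!d) (.inr r) (.inl u) (G.wt i) := by cases d <;> exact hab
        exact ⟨r, u, hs.mem_search hS hab' him.1, ⟨ha, hb⟩, hG.length_partners_of_inr hS hb⟩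
      · exact absurd hab (augD_right_right d _ _ _)
    · rintro i hi i' hi' r v ⟨h1, h2⟩ ⟨h1', h2'⟩
      have hiM := Finset.mem_range.mp (Finset.mem_filter.mp hi).1
      have hiM' := Finset.mem_range.mp (Finset.mem_filter.mp hi').1
      obtain ⟨a, b, ha, hb, hab⟩ := hG.decode i hiM
      obtain ⟨a', b', ha', hb', hab'⟩ := hG.decode i' hiM'
      obtain rfl : a = a' := code_injective (by rw [← ha, ← ha', h1, h1'])
      obtain rfl : b = b' := code_injective (by rw [← hb, ← hb', h2, h2'])
      refine hG.inj i hiM i' hiM' (h1.trans h1'.symm) (h2.trans h2'.symm)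
        (weight_unique (.inr ?_) hab hab')
      rw [← Bool.not_eq_false, ← code_lt_iff, ← hb, h2]
      omega
  have h3 : ((∑ k ∈ Finset.range G.M, (G.partners D k).length : ℕ) : ℝ) =
      ∑ k ∈ Finset.range G.M with G.cls k ≠ 0 ∧ G.dst k < m, ((G.partners D k).length : ℝ) +
      ∑ k ∈ Finset.range G.M with G.cls k ≠ 0 ∧ ¬ G.dst k < m, ((G.partners D k).length : ℝ) := by
    push_cast
    rw [← Finset.filter_filter, ← Finset.filter_filter, Finset.sum_filter_add_sum_filter_not,
      Finset.sum_filter]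
    refine Finset.sum_congr rfl fun k _ => ?_
    split_ifs with h
    · rfl
    · simp only [ne_eq, not_not] at h
      simp [Inst.partners, h]
  have h4 : ∑ r, ∑ u ∈ B r, (((A r).card : ℝ) + 1) ≤ 3 * ((m : ℝ) ^ 2 * β) := by
    simp only [Finset.sum_const, nsmul_eq_mul]
    exact hspread.sum_mul
  have h5 : ∑ r, ∑ v ∈ A r,
        ((if z ^ 2 ≤ ((A r).card : ℝ) then (m : ℝ) else 0) + z ^ 2 + S.excess d v) =
      ∑ r with z ^ 2 ≤ ((A r).card : ℝ), ((A r).card : ℝ) * m +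
        z ^ 2 * ∑ r, ((A r).card : ℝ) + ∑ v, load A v * (S.excess d v : ℝ) := by
    rw [← sum_sum_mem A fun v => (S.excess d v : ℝ), Finset.sum_filter, Finset.mul_sum]
    simp only [← Finset.sum_add_distrib]
    refine Finset.sum_congr rfl fun r _ => ?_
    rw [Finset.sum_add_distrib, Finset.sum_const, nsmul_eq_mul, mul_add, mul_ite, mul_zero]
    ring
  -- Summing a function over all v ∈ A_r weights it by `load A v`. The terms of `excess` then become
  -- the products of loads and set sizes estimated above; negative edges form a matching, so `mate`
  -- and `tail` are injective on `mated`.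
  have h6 : ∑ v, load A v * (S.excess d v : ℝ) = 2 * ∑ r, ((A r).card : ℝ) +
      (∑ v ∈ S.mated d, (load A v : ℝ) * (A (S.tail d v)).card +
        ∑ v ∈ S.mated d, (load A v : ℝ) * load B (S.mate d v)) +
      ∑ v, (load A v : ℝ) * load B v := by
    rw [sum_card_eq, Finset.mul_sum, ← Finset.sum_add_distrib, ← Fintype.sum_ite_mem (S.mated d),
      ← Finset.sum_add_distrib, ← Finset.sum_add_distrib]
    refine Finset.sum_congr rfl fun v _ => ?_
    simp only [excess]
    push_cast
    split_ifs <;> ring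
  have b1 := hspread.sum_big hz hm
  have b2 := hspread.sum_card hz hm
  have b3 := hspread.sum_load_mul_card hz hm _ _ (hS.injOn_tail d)
  have b4 := hspread.sum_load_mul_load _ _ (hS.injOn_mate d)
  have b5 := hspread.sum_load_mul_load Finset.univ id (Set.injOn_id _)
  simp only [id] at b5
  -- Lower powers of z are absorbed into z⁷β. The coefficients are 3 for edges entering a Steiner
  -- vertex, 3 + 4 for large and small search sets, and 8 + 7 + 4 + 4 for `excess`; their sum is
  -- below 40.
  have hp : ∀ k ≤ 7, z ^ k * β ≤ z ^ 7 * β := fun k hk =>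
    mul_le_mul_of_nonneg_right (pow_le_pow_right₀ hz hk) (by linarith)
  have b6 : (m : ℝ) ^ 2 * β ≤ z ^ 7 * β := by
    rw [hm, ← pow_mul]
    exact hp 6 (by norm_num)
  have b7 := mul_le_mul_of_nonneg_left b2 (sq_nonneg z)
  have b8 : z ^ 2 * (4 * (z ^ 5 * β)) = 4 * (z ^ 7 * β) := by ring
  have b9 := hp 5 (by norm_num)
  have b10 : 0 ≤ z ^ 7 * β := by positivity
  rw [h3]
  rw [h5, h6] at h1
  linarith

end pairs

/-! ### The program on the input -/

section input
variable {n w : ℕ} {s : State}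

theorem Input.mat_eq (hI : S.Input n w s) (d : Bool) {r : Fin m} (hr : r ∈ S.N) (v : Fin m) :
    s.na (matA d) (r * m + v) = if v ∈ S.search d r then 1 else 0 := by
  cases d
  · exact hI.out_eq r hr v
  · exact hI.in_eq r hr v

theorem Input.decode (hI : S.Input n w s) (d : Bool) {i : ℕ} (hi : i < s.nv 2) :
    ∃ a b, s.na (srcA d) i = S.code a ∧ s.na (dstA d) i = S.code b ∧ S.augD d a b (s.ra 2 i) := by
  obtain ⟨a, b, ha, hb⟩ := hI.edges.2 i hi
  have h := (hI.edges.1 a b _).mpr ⟨i, hi, ha, hb, rfl⟩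
  cases d
  · exact ⟨a, b, ha, hb, h⟩
  · exact ⟨b, a, hb, ha, h⟩

theorem Input.codes (hI : S.Input n w s) (d : Bool) {idx : ℕ → ℕ} {cnt : Bool → ℕ → ℕ} {P : ℕ → ℝ}
    (hP : ∀ v < m, P v = - s.ra 0 v)
    (hcnt : ∀ r : {r : Fin m // r ∈ S.N}, (∃ i < s.nv 2, s.na (srcA d) i = S.code (.inr r)) →
      cnt d r.1 = (S.search d r.1).card) :
    S.Codes d (instOf m (s.nv 2) s idx cnt P d) where
  m_eq := rfl
  decode _ hi := hI.decode d hi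
  encode a b x h := by
    cases d
    · exact (hI.edges.1 a b x).mp h
    · obtain ⟨i, hi, ha, hb, hx⟩ := (hI.edges.1 b a x).mp h
      exact ⟨i, hi, hb, ha, hx⟩
  inj i hi j hj h1 h2 h3 := by
    cases d
    · exact hI.edges_nodup i hi j hj h1 h2 h3
    · exact hI.edges_nodup i hi j hj h2 h1 h3
  base_eq := hI.base_eq
  P_eq v := by
    cases d
    · exact hI.shift_eq v
    · exact (hP v v.2).trans (congrArg Neg.neg (hI.shift_eq v))
  cnt_eq := hcnt

theorem Input.card_of_countsOf (hI : S.Input n w s) {d : Bool} {cnt : ℕ → ℕ}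
    (h : CountsOf m (s.nv 2) d s cnt) (r : {r : Fin m // r ∈ S.N})
    (hr : ∃ i < s.nv 2, s.na (srcA d) i = S.code (.inr r)) : cnt r.1 = (S.search d r.1).card := by
  obtain ⟨i, hi, hr'⟩ := hr
  have h1 := h i hi (by rw [hr']; exact Nat.le_add_right _ _)
  have h2 : s.na (srcA d) i - m = r.1 := by
    rw [hr']
    exact Nat.add_sub_cancel_left _ _
  rw [h2, Finset.sum_range] at h1
  rw [h1, Finset.sum_congr rfl fun v _ => hI.mat_eq d r.2 v]
  simp

theorem Input.M_le (hI : S.Input n w s) (hS : S.Valid) : s.nv 2 ≤ 12 * (m * m) := by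
  -- The number of edges does not depend on what the program computes, so the numbering and the
  -- counts may be chosen at will; the counts are set to the true sizes.
  refine (hI.codes false (idx := id) (P := fun v => - s.ra 0 v)
    (cnt := fun _ r => if h : r < m then (S.search false ⟨r, h⟩).card else 0) (fun _ _ => rfl)
    fun r _ => ?_).M_le hS
  simp

/-- The largest word that occurs is bounded through the number of emitted edges, quadratic in the at
most 12m² input edges; this gives the fourth power of m + 1. -/
theorem Input.ready (hI : S.Input n w s) (hS : S.Valid) (hw : 400 * (m + 1) ^ 4 < 2 ^ w) :
    Ready w m (s.nv 2) s where
  nv1 := hI.m_eq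
  nv2 := rfl
  src_lt i hi := by
    obtain ⟨a, b, ha, hb⟩ := hI.edges.2 i hi
    rw [ha]
    exact code_lt a
  dst_lt i hi := by
    obtain ⟨a, b, ha, hb⟩ := hI.edges.2 i hi
    rw [hb]
    exact code_lt b
  base_lt v hv := by
    rw [hI.base_eq ⟨v, hv⟩]
    exact (S.base _).2
  base_base v hv := by
    rw [hI.base_eq ⟨v, hv⟩, hI.base_eq, hS.base_base]
  mat_le d i hi hmi v hv := by
    obtain ⟨a, b, ha, hb, -⟩ := hI.decode d hi
    rcases a with u | r
    · have h1 : s.na (srcA d) i = u := ha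
      have := u.2
      omega
    · have h1 : s.na (srcA d) i - m = r.1 := by
        rw [ha]
        exact Nat.add_sub_cancel_left _ _
      have := hI.mat_eq d r.2 ⟨v, hv⟩
      rw [h1, this]
      split_ifs <;> simp
  lin_lt := by
    refine lt_of_le_of_lt ?_ hw
    have : m + 1 ≤ (m + 1) ^ 4 := Nat.le_self_pow (by norm_num) _
    omega
  cube_lt := by
    refine lt_of_le_of_lt ?_ hw
    have h1 : m * m * m ≤ (m + 1) ^ 3 := by
      rw [← pow_three']
      exact Nat.pow_le_pow_left (Nat.le_succ m) 3
    have h2 : (m + 1) ^ 3 ≤ (m + 1) ^ 4 := Nat.pow_le_pow_right (by omega) (by norm_num)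
    omega
  out_lt := by
    refine lt_of_le_of_lt ?_ hw
    have h1 := hI.M_le hS
    have h2 : s.nv 2 * (s.nv 2 + 1) ≤ 12 * (m * m) * (12 * (m * m) + 1) :=
      Nat.mul_le_mul h1 (by omega)
    have h3 : 2 * (12 * (m * m) * 2 + 12 * (m * m) * (12 * (m * m) + 1)) + 2 ≤
        400 * (m + 1) ^ 4 := by
      ring_nf
      nlinarith [Nat.zero_le m, Nat.zero_le (m ^ 3), Nat.zero_le (m ^ 2), Nat.zero_le (m ^ 4)]
    omega

/-- Correctness of the program, and its running time in terms of `m`. -/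
theorem Input.exec_program (hI : S.Input n w s) (hS : S.Valid) (hlow : S.LowBetweenness n)
    (hs : S.Searched) (hw : 400 * (m + 1) ^ 4 < 2 ^ w) :
    ∃ (s' : State) (t : ℕ) (O : S.Out), Exec w program s s' t ∧
      (t : ℝ) ≤ 60 + 3500 * ((m : ℝ) ^ (7 / 3 : ℝ) * (2 : ℝ) ^ Real.sqrt (Real.logb 2 n)) ∧
      O.Output s' ∧ O.Good := by
  obtain ⟨s', t, hex, idx, cnt, P, D, hP, hcnt, hshift, hnum, hD, hout, ht⟩ :=
    runs_program (hI.ready hS hw)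
  have hG : ∀ d, S.Codes d (instOf m (s.nv 2) s idx cnt P d) := fun d =>
    hI.codes d hP (hI.card_of_countsOf (hcnt d))
  have hbase : ∀ v : Fin m, s.na 0 (S.base v) = S.base v := fun v => by
    rw [hI.base_eq, hS.base_base]
  have hmem := fun v : Fin m => hnum.mem (S.base v) (S.base v).2 (hbase v)
  have hnew : ∀ j < s'.nv 3, ∃ v : Fin m, S.base v = v ∧ (j = idx v ∨ j = idx v + 1) := by
    intro j hj
    obtain ⟨v, hv, hb, h⟩ := hnum.exists_eq j hj
    refine ⟨⟨v, hv⟩, Fin.ext ?_, h⟩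
    rw [← hI.base_eq]
    exact hb
  have hlt : ∀ j : Fin (s'.nv 3), s'.na 6 j < m := fun j => by
    obtain ⟨v, hv, h⟩ := hnew j j.2
    have h1 := hmem v
    rw [hv] at h1
    rcases h with h | h
    · rw [h, h1.2.1]
      exact v.2
    · rw [h, h1.2.2]
      exact v.2
  -- The output graph is read off from the final memory, so that `Output` holds almost by definition
  -- and all content is in `Good`.
  let O : S.Out :=
    { q := s'.nv 3
      newBase := fun j => ⟨s'.na 6 j, hlt j⟩
      newShift := fun j => s'.ra 3 j
      E := fun a b x => (S.codeOut _ a, S.codeOut _ b, x) ∈ s'.out }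
  have hidx : ∀ (d : Bool) (v : Fin m), idx (S.base v) + d.toNat < O.q := fun d v => by
    have h1 := (hmem v).1
    have h2 := Bool.toNat_le d
    show _ < s'.nv 3
    omega
  let copy : Bool → Fin m → Fin O.q := fun d v => ⟨idx (S.base v) + d.toNat, hidx d v⟩
  obtain ⟨hgood, hcode⟩ := good_of_newEdges hS O (fun d => instOf m (s.nv 2) s idx cnt P d) D copy
    s'.out hG hshift (fun d v => by
      show idx (s.na 0 v) + (2 * m + d.toNat) = 2 * m + (idx (S.base v) + d.toNat)
      rw [hI.base_eq]
      omega) (fun d v => by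
      refine Fin.ext ?_
      cases d
      · exact (hmem v).2.1
      · exact (hmem v).2.2) (fun d v => by
      have h1 := hD (S.base v) (S.base v).2 (hbase v)
      cases d
      · exact h1.1
      · exact h1.2) (fun j => by
      obtain ⟨v, hv, h⟩ := hnew j j.2
      rcases h with h | h
      · exact ⟨false, v, hv, Fin.ext (by simp only [copy, hv]; exact h)⟩
      · exact ⟨true, v, hv, Fin.ext (by simp only [copy, hv]; exact h)⟩) hout fun a b x => Iff.rfl
  refine ⟨s', t, O, hex, ?_, ⟨rfl, fun j => rfl, fun j => rfl, ?_, ?_⟩, hgood⟩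
  · set β := (2 : ℝ) ^ Real.sqrt (Real.logb 2 n)
    have hβ : 1 ≤ β := (hs.spread hlow false).one_le
    -- The estimates need m^(1/3) ≥ 1; for m = 0 only constant time is spent.
    rcases Nat.eq_zero_or_pos m with rfl | hm0
    · have hM := hI.M_le hS
      simp only [mul_zero, nonpos_iff_eq_zero] at hM
      rw [hM] at ht
      simp only [mul_zero, Finset.range_zero, Finset.sum_empty, add_zero] at ht
      have h1 : (t : ℝ) ≤ 60 := by exact_mod_cast ht
      have h2 : (0 : ℝ) ≤ 3500 * (((0 : ℕ) : ℝ) ^ (7 / 3 : ℝ) * β) := by positivity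
      linarith
    · have hm1 : (1 : ℝ) ≤ m := by exact_mod_cast hm0
      set z := (m : ℝ) ^ (1 / 3 : ℝ) with hz
      have hz1 : 1 ≤ z := Real.one_le_rpow hm1 (by norm_num)
      have hzk : ∀ k : ℕ, z ^ k = (m : ℝ) ^ ((k : ℝ) / 3) := fun k => by
        rw [hz, ← Real.rpow_natCast, ← Real.rpow_mul (by linarith)]
        congr 1
        ring
      have hz3 : (m : ℝ) = z ^ 3 := by
        rw [hzk]
        norm_num
      have hz7 : (m : ℝ) ^ (7 / 3 : ℝ) = z ^ 7 := by
        rw [hzk]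
        norm_num
      have hp : ∀ k ≤ 7, z ^ k ≤ z ^ 7 * β := fun k hk =>
        (pow_le_pow_right₀ hz1 hk).trans (le_mul_of_one_le_right (by positivity) hβ)
      have b1 := (hG false).sum_partners hS hs (hshift false) hlow hz1 hz3
      have b2 := (hG true).sum_partners hS hs (hshift true) hlow hz1 hz3
      have b3 : ((s.nv 2 : ℕ) : ℝ) ≤ 12 * (m * m) := by exact_mod_cast hI.M_le hS
      have b4 : (t : ℝ) ≤ ((60 + 50 * m + 20 * (m * m) + 200 * s.nv 2 +
        11 * ∑ k ∈ Finset.range (s.nv 2),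
          ((instOf m (s.nv 2) s idx cnt P false).partners (D false) k).length +
        11 * ∑ k ∈ Finset.range (s.nv 2),
          ((instOf m (s.nv 2) s idx cnt P true).partners (D true) k).length : ℕ) : ℝ) :=
        Nat.cast_le.mpr ht
      rw [Nat.cast_add, Nat.cast_add, Nat.cast_mul, Nat.cast_mul] at b4
      simp only [Nat.cast_add, Nat.cast_mul, Nat.cast_ofNat] at b4
      have b5 := hp 3 (by norm_num)
      have b6 := hp 6 (by norm_num)
      have b7 : (m : ℝ) * m = z ^ 6 := by
        rw [hz3]
        ring
      change ((∑ k ∈ Finset.range (s.nv 2), _ : ℕ) : ℝ) ≤ _ at b1 b2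
      rw [hz7]
      rw [← hz3] at b5
      linarith
  · intro a b x
    constructor
    · rintro ⟨i, hi, h⟩
      simp only [Prod.mk.injEq] at h
      exact ⟨i, hi, h.1.symm, h.2.1.symm, h.2.2.symm⟩
    · rintro ⟨i, hi, h1, h2, h3⟩
      exact ⟨i, hi, by rw [h1, h2, h3]⟩
  · intro i hi
    exact hcode _ ⟨i, hi, rfl⟩

end input
end Stage

/-! ### The running time in terms of `n` -/

/-- With x = log₂ n the numerator is K + 6 log x + √x log 2 = o(x), while the denominator is x log
2. -/
theorem tendsto_exponent (K : ℝ) : Tendsto (fun n : ℕ =>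
    (K + 6 * Real.log (Real.logb 2 n) + Real.sqrt (Real.logb 2 n) * Real.log 2) / Real.log n)
    atTop (𝓝 0) := by
  have h1 : Tendsto (fun n : ℕ => Real.logb 2 n) atTop atTop :=
    (Real.tendsto_logb_atTop (by norm_num)).comp tendsto_natCast_atTop_atTop
  have h2 : (fun x : ℝ => Real.sqrt x) =o[atTop] (id : ℝ → ℝ) := by
    refine (Asymptotics.isLittleO_iff_tendsto' ?_).mpr ?_
    · filter_upwards [eventually_gt_atTop (0 : ℝ)] with x hx h
      exact absurd h hx.ne'
    · simp only [id, Real.sqrt_div_self]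
      exact tendsto_inv_atTop_zero.comp Real.tendsto_sqrt_atTop
  have h3 : (fun x : ℝ => K + 6 * Real.log x + Real.sqrt x * Real.log 2) =o[atTop]
      (fun x : ℝ => x * Real.log 2) := by
    have h4 : (fun x : ℝ => K + 6 * Real.log x + Real.sqrt x * Real.log 2) =o[atTop]
        (id : ℝ → ℝ) :=
      ((Asymptotics.isLittleO_const_id_atTop K).add (Real.isLittleO_log_id_atTop.const_mul_left 6)).add
        (by simpa only [mul_comm] using h2.const_mul_left (Real.log 2))
    have h5 : Real.log 2 ≠ 0 := (Real.log_pos (by norm_num)).ne'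
    simpa only [id, mul_comm] using h4.const_mul_right h5
  refine (h3.tendsto_div_nhds_zero.comp h1).congr fun n => ?_
  simp only [Function.comp_apply]
  congr 1
  rw [Real.logb, div_mul_cancel₀ _ (Real.log_pos (by norm_num)).ne']

end Shortcut

theorem mainTheorem8 :
    ∃ P : Cmd, ∀ C : ℝ, ∃ (q : ℕ) (e : ℕ → ℝ), Tendsto e atTop (𝓝 0) ∧
      ∀ (n m : ℕ), 2 ≤ n → (m : ℝ) ≤ C * n * (Real.logb 2 n) ^ 2 →
      ∀ S : Stage m, S.Valid → S.LowBetweenness n → S.Searched →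
      ∀ w : ℕ, q * (Nat.log 2 n + 1) ≤ w → ∀ s : State, S.Input n w s →
        ∃ (s' : State) (t : ℕ) (O : S.Out),
          Exec w P s s' t ∧ (t : ℝ) ≤ (n : ℝ) ^ (7 / 3 + e n : ℝ) ∧ O.Output s' ∧ O.Good := by
  refine ⟨program, fun C => ?_⟩
  -- Besides C ≤ c, having c ≥ 1 makes c·l² ≥ 1, so its exponents may be rounded up.
  set c : ℕ := ⌈|C|⌉₊ + 1
  have hc1 : (1 : ℝ) ≤ c := by
    have : (0 : ℝ) ≤ (⌈|C|⌉₊ : ℝ) := Nat.cast_nonneg _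
    push_cast [c]
    linarith
  have hC : C ≤ c := by
    have h1 := le_abs_self C
    have h2 := Nat.le_ceil |C|
    push_cast [c]
    linarith
  -- The word length must cover 400(m+1)⁴ with m + 1 ≤ n³(c+1): n¹² gives the 12, and a constant a
  -- is at most n^a as n ≥ 2. In the exponent, 3560 = 60 + 3500 combines the constants of the
  -- running time.
  refine ⟨12 + 400 * (c + 1) ^ 4, _, tendsto_exponent (Real.log (3560 * (c : ℝ) ^ 3)), ?_⟩
  intro n m hn hm S hS hlow hs w hw s hI
  have hn' : (2 : ℝ) ≤ n := by exact_mod_cast hn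
  set l := Real.logb 2 n with hl
  have hl1 : 1 ≤ l := by
    rw [hl, Real.le_logb_iff_rpow_le (by norm_num) (by linarith)]
    simpa using hn'
  have hln : l ≤ n := by
    rw [hl, Real.logb_le_iff_le_rpow (by norm_num) (by linarith), Real.rpow_natCast]
    exact_mod_cast Nat.lt_two_pow_self.le
  have hm' : (m : ℝ) ≤ n * (c * l ^ 2) := by
    refine hm.trans ?_
    have : C * (n * l ^ 2) ≤ c * (n * l ^ 2) := mul_le_mul_of_nonneg_right hC (by positivity)
    linarith
  have hword : 400 * (m + 1) ^ 4 < 2 ^ w := by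
    have h1 : m ≤ n ^ 3 * c := by
      have h2 : (n : ℝ) * (c * l ^ 2) ≤ n * (c * n ^ 2) := by gcongr
      have h3 : (m : ℝ) ≤ (n : ℝ) ^ 3 * c := by linarith
      exact_mod_cast h3
    have h2 : m + 1 ≤ n ^ 3 * (c + 1) := by
      have : 1 ≤ n ^ 3 := Nat.one_le_pow _ _ (by omega)
      linarith
    calc 400 * (m + 1) ^ 4 ≤ 400 * (n ^ 3 * (c + 1)) ^ 4 := by gcongr
      _ = n ^ 12 * (400 * (c + 1) ^ 4) := by ring
      _ ≤ n ^ 12 * n ^ (400 * (c + 1) ^ 4) := by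
        gcongr
        exact (Nat.lt_pow_self (by omega)).le
      _ = n ^ (12 + 400 * (c + 1) ^ 4) := (pow_add _ _ _).symm
      _ < (2 ^ (Nat.log 2 n + 1)) ^ (12 + 400 * (c + 1) ^ 4) :=
        Nat.pow_lt_pow_left (Nat.lt_pow_succ_log_self (by norm_num) n) (by omega)
      _ ≤ 2 ^ w := by
        rw [← pow_mul, mul_comm]
        exact Nat.pow_le_pow_right (by norm_num) hw
  obtain ⟨s', t, O, hex, ht, hO, hgood⟩ := hI.exec_program hS hlow hs hword
  refine ⟨s', t, O, hex, ht.trans ?_, hO, hgood⟩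
  have hcl : 1 ≤ c * l ^ 2 := one_le_mul_of_one_le_of_one_le hc1 (one_le_pow₀ hl1)
  set β := (2 : ℝ) ^ Real.sqrt l with hβ
  have hβ1 : 1 ≤ β := Real.one_le_rpow (by norm_num) (Real.sqrt_nonneg _)
  -- The exponent 7/3 of the polylogarithmic factor is rounded up to 3, which yields the coefficient
  -- 6 of log l in the exponent.
  have h1 : (m : ℝ) ^ (7 / 3 : ℝ) ≤ (n : ℝ) ^ (7 / 3 : ℝ) * (c * l ^ 2) ^ 3 := by
    refine (Real.rpow_le_rpow (Nat.cast_nonneg _) hm' (by norm_num)).trans ?_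
    rw [Real.mul_rpow (by positivity) (by positivity)]
    refine mul_le_mul_of_nonneg_left ?_ (by positivity)
    rw [← Real.rpow_natCast _ 3]
    exact Real.rpow_le_rpow_of_exponent_le hcl (by norm_num)
  have h2 : (n : ℝ) ^ ((Real.log (3560 * (c : ℝ) ^ 3) + 6 * Real.log l +
      Real.sqrt l * Real.log 2) / Real.log n) = 3560 * (c * l ^ 2) ^ 3 * β := by
    have h3 : 0 < Real.log n := Real.log_pos (by linarith)
    have h4 : Real.log (3560 * (c * l ^ 2) ^ 3 * β) = Real.log (3560 * (c : ℝ) ^ 3) + 6 * Real.log l +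
        Real.sqrt l * Real.log 2 := by
      rw [Real.log_mul (by positivity) (by positivity), hβ, Real.log_rpow (by norm_num), mul_pow,
        ← mul_assoc, Real.log_mul (by positivity) (by positivity), ← pow_mul, Real.log_pow]
      norm_num
    rw [← h4, Real.rpow_def_of_pos (by linarith), mul_div_cancel₀ _ h3.ne',
      Real.exp_log (by positivity)]
  rw [Real.rpow_add (by linarith), h2]
  have hn7 : 1 ≤ (n : ℝ) ^ (7 / 3 : ℝ) := Real.one_le_rpow (by linarith) (by norm_num)
  have h3 : 1 ≤ (n : ℝ) ^ (7 / 3 : ℝ) * ((c * l ^ 2) ^ 3 * β) :=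
    one_le_mul_of_one_le_of_one_le hn7 (one_le_mul_of_one_le_of_one_le (one_le_pow₀ hcl) hβ1)
  have h4 := mul_le_mul_of_nonneg_right h1 (show 0 ≤ β by linarith)
  linarith
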